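/- Let $\epsilon\in\{+,-\}$ (read as $\pm1$ in formulas), let $q$ be a prime power and let $r$ be an odd prime dividing $q-\epsilon$. Let $G=\operatorname{PGL}_r^\epsilon(q)$, that is, $G=\operatorname{PGL}_r(q)$ if $\epsilon=+$ and $G=\operatorname{PGU}_r(q)$ if $\epsilon=-$, and let $H$ be a maximal subgroup of $G$ with $H\cong\mathbb{Z}_a{:}\mathbb{Z}_r$ (a semidirect product), where $a=\frac{q^r-\epsilon}{q-\epsilon}$. Consider the action of $G$ on the cosets of $H$. Let $m(G,H,n)$ be the number of orbits of $H$ of length $n$ (the multiplicity of the subdegree $n$), and let $\operatorname{val}(G,H)$ be the valency of the Saxl graph of this action, in which two distinct points are adjacent if and only if their pointwise stabiliser in $G$ is trivial. Then $r$ divides $a$, the set of subdegrees (orbit lengths of $H$) is exactly $\{1,\ |H|,\ a,\ a/r\}$, and these have multiplicities $$m(G,H,1)=1,\qquad m(G,H,|H|)=\frac{\operatorname{val}(G,H)}{|H|},\qquad m(G,H,a/r)=r-1,$$ $$m(G,H,a)=\frac{1}{r^3}\Bigl(r(r-1)(q-\epsilon)^{r-1}-r^4+r^3-r^2+(r-1)^2|H|\Bigr),$$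 where $$\operatorname{val}(G,H)=|G:H|-\frac{|H|}{r^3}(r-1)\Bigl((r-1)\Bigl(\frac{|H|}{r}-r\Bigr)+(q-\epsilon)^{r-1}\Bigr)+\frac{|H|}{r^2}-1.$$ -/

import Mathlib

open scoped MatrixGroups Matrix

/-- The type `ε ∈ {+, -}` of a classical group: `plus` is linear, `minus` is unitary. -/
inductive LieSign : Type
  | plus
  | minus

/-- The sign `ε` read as the integer `1` or `-1`. -/
def LieSign.toInt : LieSign → ℤ
  | .plus => 1
  | .minus => -1

/-- The group of all `g ∈ GL_n(K)` with `g * σ(g)ᵀ = 1`, where `σ` is applied entrywise.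
For `|K| = q ^ 2` and `σ : x ↦ x ^ q` this is the general unitary group `GU_n(q)`, i.e. the
isometry group of the standard nondegenerate Hermitian form. -/
def unitaryGL (n : ℕ) {K : Type} [Field K] (σ : K →+* K) : Subgroup (GL (Fin n) K) where
  carrier := {g | (g : Matrix (Fin n) (Fin n) K) *
    ((g : Matrix (Fin n) (Fin n) K).map σ)ᵀ = 1}
  one_mem' := by simp
  mul_mem' := by
    intro g h hg hh
    simp only [Set.mem_ofPred_eq, Units.val_mul, Matrix.map_mul, Matrix.transpose_mul] at *
    calc (g.val * h.val) * ((h.val.map σ)ᵀ * (g.val.map σ)ᵀ)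
        = g.val * (h.val * (h.val.map σ)ᵀ) * (g.val.map σ)ᵀ := by
          simp only [Matrix.mul_assoc]
      _ = 1 := by rw [hh, Matrix.mul_one, hg]
  inv_mem' := by
    intro g hg
    simp only [Set.mem_ofPred_eq] at *
    have h1 : (g⁻¹).val = (g.val.map σ)ᵀ := by
      calc (g⁻¹).val = (g⁻¹).val * (g.val * (g.val.map σ)ᵀ) := by rw [hg, Matrix.mul_one]
        _ = (g.val.map σ)ᵀ := by rw [← Matrix.mul_assoc, Units.inv_mul, Matrix.one_mul]
    have h2 : ((g⁻¹).val.map σ)ᵀ * (g.val.map σ)ᵀ = 1 := by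
      rw [← Matrix.transpose_mul, ← Matrix.map_mul, Units.mul_inv]
      simp
    rw [h1] at h2 ⊢
    exact mul_eq_one_comm.mp h2

/-- The general unitary group `GU_n(q)`, `q = p ^ k`, over the field with `q ^ 2` elements. -/
noncomputable abbrev GU (n p : ℕ) [Fact p.Prime] (k : ℕ) :
    Subgroup (GL (Fin n) (GaloisField p (2 * k))) :=
  unitaryGL n (iterateFrobenius (GaloisField p (2 * k)) p k)

/-- `PGL_n^ε(q)` for `q = p ^ k`: it is `PGL_n(q)` for `ε = +`, and
`PGU_n(q) = GU_n(q) / Z(GU_n(q))` for `ε = -`. -/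
def PGLsign (ε : LieSign) (n p : ℕ) [Fact p.Prime] (k : ℕ) : Type :=
  match ε with
  | .plus => PGL(Fin n, GaloisField p k)
  | .minus => GU n p k ⧸ Subgroup.center (GU n p k)

noncomputable instance (ε : LieSign) (n p : ℕ) [Fact p.Prime] (k : ℕ) :
    Group (PGLsign ε n p k) :=
  match ε with
  | .plus => inferInstanceAs (Group PGL(Fin n, GaloisField p k))
  | .minus => inferInstanceAs (Group (GU n p k ⧸ Subgroup.center (GU n p k)))

/-- `H` is a (split) extension of shape `ℤ_a : ℤ_r`, i.e. a semidirect product of a cyclic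
normal subgroup of order `a` by a cyclic group of order `r`. -/
def IsCyclicByCyclic (H : Type) [Group H] (a r : ℕ) : Prop :=
  ∃ φ : Multiplicative (ZMod r) →* MulAut (Multiplicative (ZMod a)),
    Nonempty (H ≃* Multiplicative (ZMod a) ⋊[φ] Multiplicative (ZMod r))

/-- The Saxl graph of `G` acting on `Ω`: two distinct points are adjacent if and only if they
form a base, i.e. their pointwise stabiliser is trivial. -/
def saxlGraph (G Ω : Type) [Group G] [MulAction G Ω] : SimpleGraph Ω where
  Adj α β := α ≠ β ∧ MulAction.stabilizer G α ⊓ MulAction.stabilizer G β = ⊥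
  symm := ⟨fun _ _ h => ⟨h.1.symm, by rw [inf_comm]; exact h.2⟩⟩
  loopless := ⟨fun _ h => h.1 rfl⟩

/-- `val(G, H)`: the valency of the Saxl graph of `G` acting on the cosets of `H`, read off at
the base point `H`; by `card_neighborSet_saxlGraph` all vertices have this valency. -/
noncomputable def saxlVal {G : Type} [Group G] (H : Subgroup G) : ℕ :=
  Nat.card ((saxlGraph G (G ⧸ H)).neighborSet ((1 : G) : G ⧸ H))

/-- The set of subdegrees of `G` acting on the cosets of `H`: the lengths of the suborbits,
i.e. of the orbits of the point stabiliser `H`. -/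
def subdegrees {G : Type} [Group G] (H : Subgroup G) : Set ℕ :=
  {n | ∃ α : G ⧸ H, Nat.card (MulAction.orbit H α) = n}

/-- `m(G, H, n)`: the number of suborbits of length `n`. -/
noncomputable def subdegreeMult {G : Type} [Group G] (H : Subgroup G) (n : ℕ) : ℕ :=
  Nat.card {o : MulAction.orbitRel.Quotient H (G ⧸ H) // Nat.card o.orbit = n}

theorem saxlGraph_adj_smul {G Ω : Type} [Group G] [MulAction G Ω] (g : G) (α β : Ω) :
    (saxlGraph G Ω).Adj (g • α) (g • β) ↔ (saxlGraph G Ω).Adj α β := by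
  have key : ∀ (g : G) (α β : Ω), (saxlGraph G Ω).Adj α β →
      (saxlGraph G Ω).Adj (g • α) (g • β) := by
    rintro g α β ⟨h1, h2⟩
    refine ⟨fun h => h1 (MulAction.injective g h), ?_⟩
    rw [eq_bot_iff] at h2 ⊢
    rintro x ⟨hx1, hx2⟩
    have hx1' : x • g • α = g • α := hx1
    have hx2' : x • g • β = g • β := hx2
    have h3 : g⁻¹ * x * g ∈ (⊥ : Subgroup G) := by
      apply h2
      refine ⟨?_, ?_⟩
      · change (g⁻¹ * x * g) • α = α
        rw [mul_smul, mul_smul, hx1', inv_smul_smul]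
      · change (g⁻¹ * x * g) • β = β
        rw [mul_smul, mul_smul, hx2', inv_smul_smul]
    rw [Subgroup.mem_bot] at h3 ⊢
    have h4 : x = g * (g⁻¹ * x * g) * g⁻¹ := by group
    rw [h4, h3]; simp
  refine ⟨fun h => ?_, key g α β⟩
  have := key g⁻¹ _ _ h
  rwa [inv_smul_smul, inv_smul_smul] at this

/-- The Saxl graph of a coset action is regular of valency `saxlVal H`. -/
theorem card_neighborSet_saxlGraph {G : Type} [Group G] (H : Subgroup G) (α : G ⧸ H) :
    Nat.card ((saxlGraph G (G ⧸ H)).neighborSet α) = saxlVal H := by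
  obtain ⟨g, hg⟩ := MulAction.exists_smul_eq G ((1 : G) : G ⧸ H) α
  refine (Nat.card_congr ((MulAction.toPerm g).subtypeEquiv fun β => ?_)).symm
  change _ ↔ (saxlGraph G (G ⧸ H)).Adj α (g • β)
  rw [← hg, saxlGraph_adj_smul]
  rfl

/-! Write `G = Γ/Z` with `Γ = GL_r(q)` or `GU_r(q)` over the field `F`, where the group `Z` of
scalars has order `r m = q - ε`. Since `r ∣ a`, the cyclic part of `H` contains a subgroup `⟨z⟩` of
order `r` that is normal in `H`. Lift `z` to `s ∈ Γ`; then `s^r = x` is scalar. If `x` were an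
`r`-th power in `Z`, i.e. `x^m = 1`, then `s` would be diagonalizable, and the normalizer of `⟨z⟩`
would contain a permutation involution without being all of `G`; but by maximality it would equal
`H`, whose order `a r` is odd. Hence `X^r - x` is irreducible, `F[s]` is a field of degree `r`, and
`H = C_G(z)` (`exists_eq_centralizer`). The action on the cosets of `H` is therefore the action on
the conjugacy class of `z`, and the subdegrees are the indices `|H : C_H(y)|` for conjugates `y` of
`z`.

The class of `z` consists of the images of those `g` for which `g^r` is a scalar with `m`-th power
`x^m`. The torus `T`, the image of `F[s] ∩ Γ`, has order `a` and index `r` in `H`; its cosets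
consist of the elements inducing `s ↦ c s` with `c^r = 1`. A nontrivial element of `T` generates
`F[s]`, so `C_T(y) = 1` for `y ∉ H`, whence `|C_H(y)|` is `1` or `r`. If `y ∈ H` and `y ≠ z`, then
`y ∉ T`, `C_T(y) = ⟨z⟩` and `|C_H(y)| = r^2`. This yields the four subdegrees.

For the multiplicities, multiplication by `s` multiplies the `r`-th powers of the elements of a
nontrivial coset of `T` by `x`, so such a coset meets every class equally and contains `a/r`
conjugates of `z`. The number of `y ∉ H` with `|C_H(y)| = r` comes from counting the commuting pairs
`(k, y)` with `k` in a fixed nontrivial coset of `T` and `y` conjugate to `z` in two ways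
(`natCard_commuting_pairs`, `natCard_pairs`). A proportion `1/r` of the elements `k` are conjugate,
up to scalars, to `diag(1, ζ, …, ζ^(r-1))`, and each commutes with `(r-1)(q-ε)^(r-1)/r` conjugates
of `z`; the others are irreducible and commute with `1 + (r-1)a/r` of them. All remaining points are
regular, and a lower bound for `|Γ|` shows that there are some. What the argument needs from `Γ` is
collected in `IsScalarModel`, which is verified for both families. -/

/-! ### The field generated by a matrix whose `r`-th power is a scalar -/

open Polynomial in
/-- The algebra map from `F[X]/(X^r - x)` to matrices sending the root to `s`, where `s^r = x`. -/
noncomputable def adjoinRootToMatrix {F : Type*} [Field F] {r : ℕ} {x : F}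
    (s : Matrix (Fin r) (Fin r) F) (hs : s ^ r = x • (1 : Matrix (Fin r) (Fin r) F)) :
    AdjoinRoot (X ^ r - C x) →ₐ[F] Matrix (Fin r) (Fin r) F :=
  Ideal.Quotient.liftₐ (Ideal.span {(X ^ r - C x : F[X])}) (aeval s) (by
    intro f hf
    obtain ⟨g, rfl⟩ := Ideal.mem_span_singleton'.1 hf
    rw [map_mul]
    simp [hs, Algebra.algebraMap_eq_smul_one])

section Commutant

open Polynomial

variable {F : Type*} [Field F] {r : ℕ} {x : F}

theorem adjoinRootToMatrix_root (s : Matrix (Fin r) (Fin r) F)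
    (hs : s ^ r = x • (1 : Matrix (Fin r) (Fin r) F)) :
    adjoinRootToMatrix s hs (AdjoinRoot.root _) = s := by
  change (aeval s) (X : F[X]) = s
  simp

theorem AdjoinRoot.exists_aeval_root (f : F[X]) (l : AdjoinRoot f) :
    ∃ P : F[X], l = aeval (AdjoinRoot.root f) P := by
  obtain ⟨P, rfl⟩ := AdjoinRoot.mk_surjective l
  exact ⟨P, by rw [AdjoinRoot.aeval_eq]⟩

theorem finrank_adjoinRoot_X_pow_sub_C (hr : r.Prime) :
    Module.finrank F (AdjoinRoot (X ^ r - C x)) = r := by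
  have h0 : (X ^ r - C x : F[X]) ≠ 0 := X_pow_sub_C_ne_zero hr.pos x
  rw [(AdjoinRoot.powerBasis h0).finrank, AdjoinRoot.powerBasis_dim, natDegree_X_pow_sub_C]

variable (hr : r.Prime) (hx : ∀ b : F, b ^ r ≠ x)

-- `F[s]` is a field of degree `r` over `F`, so `F^r` is a line over it and every nonzero vector is
-- a basis.
include hr hx in
theorem adjoinRootToMatrix_mulVec_bijective (s : Matrix (Fin r) (Fin r) F)
    (hs : s ^ r = x • (1 : Matrix (Fin r) (Fin r) F)) {v : Fin r → F} (hv : v ≠ 0) :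
    Function.Bijective fun l => (adjoinRootToMatrix s hs l).mulVec v := by
  have : Fact (Irreducible (X ^ r - C x : F[X])) := ⟨X_pow_sub_C_irreducible_of_prime hr hx⟩
  have h0 : (X ^ r - C x : F[X]) ≠ 0 := X_pow_sub_C_ne_zero hr.pos x
  have : FiniteDimensional F (AdjoinRoot (X ^ r - C x)) := (AdjoinRoot.powerBasis h0).finite
  let f : AdjoinRoot (X ^ r - C x) →ₗ[F] (Fin r → F) :=
    { toFun := fun l => (adjoinRootToMatrix s hs l).mulVec v
      map_add' := by intro a b; simp [Matrix.add_mulVec]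
      map_smul' := by intro a b; simp [Matrix.smul_mulVec] }
  have hinj : Function.Injective f := by
    rw [← LinearMap.ker_eq_bot, LinearMap.ker_eq_bot']
    intro l hl
    by_contra hne
    apply hv
    have h1 : (adjoinRootToMatrix s hs l).mulVec v = 0 := hl
    have h2 : (adjoinRootToMatrix s hs (l⁻¹ * l)).mulVec v = 0 := by
      rw [map_mul, ← Matrix.mulVec_mulVec, h1, Matrix.mulVec_zero]
    rwa [inv_mul_cancel₀ hne, map_one, Matrix.one_mulVec] at h2
  refine ⟨hinj, (LinearMap.injective_iff_surjective_of_finrank_eq_finrank ?_).1 hinj⟩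
  rw [finrank_adjoinRoot_X_pow_sub_C hr]; simp

include hr hx in
theorem adjoinRootToMatrix_injective (s : Matrix (Fin r) (Fin r) F)
    (hs : s ^ r = x • (1 : Matrix (Fin r) (Fin r) F)) :
    Function.Injective (adjoinRootToMatrix s hs) := by
  have : NeZero r := ⟨hr.ne_zero⟩
  have hv : (fun _ => 1 : Fin r → F) ≠ 0 := fun h => one_ne_zero (congrFun h 0)
  intro a b hab
  exact (adjoinRootToMatrix_mulVec_bijective hr hx s hs hv).1 (by simp [hab])

include hr hx in
/-- The commutant of `s` is the field generated by `s`. -/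
theorem exists_adjoinRootToMatrix_eq (s : Matrix (Fin r) (Fin r) F)
    (hs : s ^ r = x • (1 : Matrix (Fin r) (Fin r) F)) {g : Matrix (Fin r) (Fin r) F}
    (hg : g * s = s * g) : ∃ l, adjoinRootToMatrix s hs l = g := by
  have : NeZero r := ⟨hr.ne_zero⟩
  have hv : (fun _ => 1 : Fin r → F) ≠ 0 := fun h => one_ne_zero (congrFun h 0)
  have hb := adjoinRootToMatrix_mulVec_bijective hr hx s hs hv
  -- A matrix commuting with `s` is determined by its value on the cyclic vector `(1, …, 1)`; `l` is
  -- the field element with the same value there.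
  obtain ⟨l, hl⟩ := hb.2 (g.mulVec fun _ => 1)
  refine ⟨l, ?_⟩
  have hcomm : ∀ y, g * adjoinRootToMatrix s hs y = adjoinRootToMatrix s hs y * g := by
    intro y
    obtain ⟨P, rfl⟩ := AdjoinRoot.exists_aeval_root _ y
    rw [← Polynomial.aeval_algHom_apply, adjoinRootToMatrix_root]
    exact (Polynomial.aeval_eq_sum_range s (p := P)) ▸ (by
      rw [Finset.mul_sum, Finset.sum_mul]
      refine Finset.sum_congr rfl fun i _ => ?_
      rw [mul_smul_comm, smul_mul_assoc, (Commute.pow_right (show Commute g s from hg) i).eq])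
  apply Matrix.mulVec_injective
  funext w
  obtain ⟨y, rfl⟩ := hb.2 w
  dsimp only at hl ⊢
  rw [Matrix.mulVec_mulVec (M := g), hcomm, ← Matrix.mulVec_mulVec (N := g), ← hl,
    Matrix.mulVec_mulVec, Matrix.mulVec_mulVec, ← map_mul, ← map_mul, mul_comm]

include hr hx in
/-- A nonscalar element of the field generated by `s` generates this field. -/
theorem exists_aeval_eq_root (l : AdjoinRoot (X ^ r - C x))
    (hl : ∀ c : F, l ≠ algebraMap F _ c) :
    ∃ P : F[X], AdjoinRoot.root (X ^ r - C x) = aeval l P := by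
  have : Fact (Irreducible (X ^ r - C x : F[X])) := ⟨X_pow_sub_C_irreducible_of_prime hr hx⟩
  -- A field extension of prime degree has no proper intermediate algebras.
  have := Subalgebra.isSimpleOrder_of_finrank_prime F (AdjoinRoot (X ^ r - C x))
    (by rw [finrank_adjoinRoot_X_pow_sub_C hr]; exact hr)
  rcases eq_bot_or_eq_top (Algebra.adjoin F {l}) with h | h
  · have : l ∈ Algebra.adjoin F {l} := Algebra.self_mem_adjoin_singleton F l
    rw [h, Algebra.mem_bot] at this
    obtain ⟨c, hc⟩ := this
    exact absurd hc.symm (hl c)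
  · have : AdjoinRoot.root (X ^ r - C x) ∈ Algebra.adjoin F {l} := h ▸ Algebra.mem_top
    rw [Algebra.adjoin_singleton_eq_range_aeval] at this
    obtain ⟨P, hP⟩ := this
    exact ⟨P, hP.symm⟩

include hr hx in
/-- A matrix commuting with a nonscalar element of the commutant of `s` commutes with `s`. -/
theorem commute_of_commute_commutant {s g t : Matrix (Fin r) (Fin r) F}
    (hs : s ^ r = x • (1 : Matrix (Fin r) (Fin r) F)) (ht : t * s = s * t)
    (htn : ∀ c : F, t ≠ c • (1 : Matrix (Fin r) (Fin r) F)) (hg : g * t = t * g) :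
    g * s = s * g := by
  obtain ⟨l, rfl⟩ := exists_adjoinRootToMatrix_eq hr hx s hs ht
  obtain ⟨P, hP⟩ := exists_aeval_eq_root hr hx l (fun c hc => htn c (by
    rw [hc, AlgHom.commutes, Algebra.algebraMap_eq_smul_one]))
  have h1 : s = aeval (adjoinRootToMatrix s hs l) P := by
    rw [Polynomial.aeval_algHom_apply, ← hP, adjoinRootToMatrix_root]
  have : Commute g (aeval (adjoinRootToMatrix s hs l) P) := by
    rw [Polynomial.aeval_eq_sum_range]
    refine Commute.sum_right _ _ _ fun i _ => ?_
    exact Commute.smul_right (Commute.pow_right hg i) _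
  rw [← h1] at this
  exact this.eq

include hr hx in
/-- An element of the commutant of `s` whose `r`-th power is `c • s^(j r)` with `c = μ ^ r` is
`μ ζ^i s^j`. -/
theorem eq_smul_of_pow_eq {ζ : F} (hζ : IsPrimitiveRoot ζ r) {s t : Matrix (Fin r) (Fin r) F}
    (hs : s ^ r = x • (1 : Matrix (Fin r) (Fin r) F)) (ht : t * s = s * t) {j : ℕ} {μ : F}
    (hμ : μ ≠ 0) (h : t ^ r = (μ ^ r * x ^ j) • (1 : Matrix (Fin r) (Fin r) F)) :
    ∃ i < r, t = (μ * ζ ^ i) • s ^ j := by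
  have : Fact (Irreducible (X ^ r - C x : F[X])) := ⟨X_pow_sub_C_irreducible_of_prime hr hx⟩
  have : NeZero r := ⟨hr.ne_zero⟩
  obtain ⟨l, rfl⟩ := exists_adjoinRootToMatrix_eq hr hx s hs ht
  have hinj := adjoinRootToMatrix_injective hr hx s hs
  set z := AdjoinRoot.root (X ^ r - C x : F[X]) with hz
  have hzr : z ^ r = algebraMap F _ x := by
    apply hinj
    rw [map_pow, adjoinRootToMatrix_root, hs, AlgHom.commutes, Algebra.algebraMap_eq_smul_one]
  have hx0 : x ≠ 0 := by rintro rfl; exact hx 0 (zero_pow hr.ne_zero)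
  have hz0 : z ≠ 0 := by
    intro h0
    rw [h0, zero_pow hr.ne_zero] at hzr
    exact hx0 ((map_eq_zero _).1 hzr.symm)
  have hlr : l ^ r = algebraMap F _ (μ ^ r * x ^ j) := by
    apply hinj
    rw [map_pow, h, AlgHom.commutes, Algebra.algebraMap_eq_smul_one]
  have hμ' : algebraMap F (AdjoinRoot (X ^ r - C x)) μ ≠ 0 := by simpa using hμ
  -- `l` and `μ z^j` have the same `r`-th power, so their quotient in the field is a power of `ζ`.
  have h1 : (l / (algebraMap F _ μ * z ^ j)) ^ r = 1 := by
    rw [div_pow, hlr, mul_pow, ← pow_mul, mul_comm j r, pow_mul, hzr, map_mul, map_pow, map_pow]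
    exact div_self (mul_ne_zero (pow_ne_zero _ hμ') (pow_ne_zero _ (by simpa using hx0)))
  have hζ' : IsPrimitiveRoot (algebraMap F (AdjoinRoot (X ^ r - C x)) ζ) r :=
    hζ.map_of_injective (algebraMap F _).injective
  obtain ⟨i, hi, hi'⟩ := hζ'.eq_pow_of_pow_eq_one h1
  refine ⟨i, hi, ?_⟩
  have h2 : l = algebraMap F _ (μ * ζ ^ i) * z ^ j := by
    rw [eq_div_iff (mul_ne_zero hμ' (pow_ne_zero _ hz0))] at hi'
    rw [← hi', map_mul, map_pow]; ring
  rw [h2, map_mul, map_pow, adjoinRootToMatrix_root, AlgHom.commutes,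
    Algebra.algebraMap_eq_smul_one, smul_mul_assoc, one_mul]

include hr hx in
/-- If `g` commutes up to a scalar with a nonscalar element of the commutant of `s`, then `g`
commutes up to an `r`-th root of unity with `s`. -/
theorem exists_commute_up_to_scalar {ζ : F} (hζ : IsPrimitiveRoot ζ r)
    {s t g g' : Matrix (Fin r) (Fin r) F}
    (hs : s ^ r = x • (1 : Matrix (Fin r) (Fin r) F)) (ht : t * s = s * t)
    (htn : ∀ c : F, t ≠ c • (1 : Matrix (Fin r) (Fin r) F)) (hgg : g' * g = 1) {c : F}
    (hg : g * t = c • (t * g)) : ∃ i < r, g * s = ζ ^ i • (s * g) := by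
  obtain ⟨l, rfl⟩ := exists_adjoinRootToMatrix_eq hr hx s hs ht
  obtain ⟨P, hP⟩ := exists_aeval_eq_root hr hx l (fun c hc => htn c (by
    rw [hc, AlgHom.commutes, Algebra.algebraMap_eq_smul_one]))
  have hgg' : g * g' = 1 := mul_eq_one_comm.1 hgg
  have h1 : s = aeval (adjoinRootToMatrix s hs l) P := by
    rw [Polynomial.aeval_algHom_apply, ← hP, adjoinRootToMatrix_root]
  -- Conjugation by `g` sends `t` to `c t`, hence `s = P(t)` to `P(c t)`, which again lies in
  -- `F[s]`. Having the same `r`-th power as `s`, it is `ζ^i s`.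
  have h2 : g * s = adjoinRootToMatrix s hs (aeval (c • l) P) * g := by
    rw [← Polynomial.aeval_algHom_apply, map_smul]
    conv_lhs => rw [h1]
    rw [Polynomial.aeval_eq_sum_range, Polynomial.aeval_eq_sum_range, Finset.mul_sum,
      Finset.sum_mul]
    refine Finset.sum_congr rfl fun i _ => ?_
    rw [mul_smul_comm, smul_mul_assoc]
    congr 1
    have : SemiconjBy g (adjoinRootToMatrix s hs l) (c • adjoinRootToMatrix s hs l) := by
      rw [SemiconjBy, hg, smul_mul_assoc]
    exact (this.pow_right i).eq
  set u := adjoinRootToMatrix s hs (aeval (c • l) P) with hu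
  have hur : u ^ r = ((1 : F) ^ r * x ^ 1) • (1 : Matrix (Fin r) (Fin r) F) := by
    have h3 : SemiconjBy g s u := h2
    have h4 := (h3.pow_right r).eq
    rw [hs, mul_smul_comm, mul_one] at h4
    calc u ^ r = u ^ r * g * g' := by rw [mul_assoc, hgg', mul_one]
      _ = _ := by rw [← h4, smul_mul_assoc, hgg', one_pow, one_mul, pow_one]
  have hus : u * s = s * u := by
    conv_lhs => rw [← adjoinRootToMatrix_root s hs]
    conv_rhs => rw [← adjoinRootToMatrix_root s hs]
    rw [hu, ← map_mul, ← map_mul, mul_comm]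
  obtain ⟨i, hi, hi'⟩ := eq_smul_of_pow_eq hr hx hζ hs hus (j := 1) one_ne_zero hur
  refine ⟨i, hi, ?_⟩
  rw [h2, hi', one_mul, pow_one, smul_mul_assoc]

include hr hx in
/-- Two matrices with the same `r`-th power `x`, not an `r`-th power in `F`, are conjugate. -/
theorem exists_conj_of_pow_eq {s t : Matrix (Fin r) (Fin r) F}
    (hs : s ^ r = x • (1 : Matrix (Fin r) (Fin r) F))
    (ht : t ^ r = x • (1 : Matrix (Fin r) (Fin r) F)) :
    ∃ g g' : Matrix (Fin r) (Fin r) F, g * g' = 1 ∧ g' * g = 1 ∧ g * s = t * g := by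
  have : NeZero r := ⟨hr.ne_zero⟩
  have hv : (fun _ => 1 : Fin r → F) ≠ 0 := fun h => one_ne_zero (congrFun h 0)
  have hb := adjoinRootToMatrix_mulVec_bijective hr hx s hs hv
  have hb' := adjoinRootToMatrix_mulVec_bijective hr hx t ht hv
  let f (s : Matrix (Fin r) (Fin r) F) (hs : s ^ r = x • (1 : Matrix (Fin r) (Fin r) F)) :
      AdjoinRoot (X ^ r - C x) →ₗ[F] (Fin r → F) :=
    { toFun := fun l => (adjoinRootToMatrix s hs l).mulVec fun _ => 1
      map_add' := by intro a b; simp [Matrix.add_mulVec]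
      map_smul' := by intro a b; simp [Matrix.smul_mulVec] }
  -- Both `s` and `t` turn `F^r` into a line over `F[X]/(X^r - x)` with basis `(1, …, 1)`; the
  -- module isomorphism matching these bases carries `s` to `t`.
  let e := LinearEquiv.ofBijective (f s hs) hb
  let e' := LinearEquiv.ofBijective (f t ht) hb'
  let E := e.symm.trans e'
  refine ⟨LinearMap.toMatrix' E.toLinearMap, LinearMap.toMatrix' E.symm.toLinearMap, ?_, ?_, ?_⟩
  · rw [← LinearMap.toMatrix'_comp]; simp
  · rw [← LinearMap.toMatrix'_comp]; simp
  · apply Matrix.mulVec_injective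
    funext w
    rw [← Matrix.mulVec_mulVec, ← Matrix.mulVec_mulVec, LinearMap.toMatrix'_mulVec,
      LinearMap.toMatrix'_mulVec]
    obtain ⟨y, rfl⟩ := e.surjective w
    have h1 : s.mulVec (e y) = e (AdjoinRoot.root _ * y) := by
      change s.mulVec ((adjoinRootToMatrix s hs y).mulVec _)
        = (adjoinRootToMatrix s hs (_ * y)).mulVec _
      rw [map_mul, adjoinRootToMatrix_root, Matrix.mulVec_mulVec]
    have h2 : t.mulVec (e' y) = e' (AdjoinRoot.root _ * y) := by
      change t.mulVec ((adjoinRootToMatrix t ht y).mulVec _)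
        = (adjoinRootToMatrix t ht (_ * y)).mulVec _
      rw [map_mul, adjoinRootToMatrix_root, Matrix.mulVec_mulVec]
    rw [h1]
    change e' (e.symm (e _)) = t.mulVec (e' (e.symm (e y)))
    rw [e.symm_apply_apply, e.symm_apply_apply, h2]

end Commutant

/-! ### Roots of unity and powers in finite fields -/

section FiniteFields

variable {K : Type*} [Field K] [Finite K]

theorem exists_isPrimitiveRoot_of_dvd {d : ℕ} (h : d ∣ Nat.card K - 1) :
    ∃ ζ : K, IsPrimitiveRoot ζ d := by
  obtain ⟨g, hg⟩ := IsCyclic.exists_ofOrder_eq_natCard (α := Kˣ)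
  rw [Nat.card_units] at hg
  obtain ⟨e, he⟩ := h
  have h1 : IsPrimitiveRoot (g : K) (Nat.card K - 1) := by
    rw [IsPrimitiveRoot.coe_units_iff, ← hg]; exact IsPrimitiveRoot.orderOf g
  have h0 : 0 < Nat.card K - 1 := by have := Finite.one_lt_card (α := K); omega
  exact ⟨(g : K) ^ e, h1.pow h0 (by rw [he, mul_comm])⟩

theorem card_pow_eq_one_of_dvd {d : ℕ} (h : d ∣ Nat.card K - 1) :
    Nat.card {x : K // x ^ d = 1} = d := by
  obtain ⟨ζ, hζ⟩ := exists_isPrimitiveRoot_of_dvd h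
  have h0 : 0 < Nat.card K - 1 := by have := Finite.one_lt_card (α := K); omega
  have hd : 0 < d := Nat.pos_of_dvd_of_pos h h0
  conv_rhs => rw [← hζ.card_nthRootsFinset]
  rw [← Nat.card_eq_finsetCard]
  exact Nat.card_congr (Equiv.subtypeEquivRight fun x => by
    rw [Polynomial.mem_nthRootsFinset hd])

/-- In a finite field with `d * e + 1` elements, `e`-torsion units are `d`-th powers. -/
theorem exists_pow_eq_of_pow_eq_one {d e : ℕ} (h : d * e = Nat.card K - 1) {x : K}
    (hx : x ^ e = 1) : ∃ y : K, y ^ d = x := by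
  have h0 : 0 < Nat.card K - 1 := by have := Finite.one_lt_card (α := K); omega
  have he : e ≠ 0 := by rintro rfl; omega
  obtain ⟨g, hg⟩ := exists_isPrimitiveRoot_of_dvd (K := K) (dvd_refl (Nat.card K - 1))
  have : NeZero (Nat.card K - 1) := ⟨h0.ne'⟩
  obtain ⟨k, -, rfl⟩ := hg.eq_pow_of_pow_eq_one (ξ := x)
    (by rw [← h, mul_comm, pow_mul, hx, one_pow])
  rw [← pow_mul, hg.pow_eq_one_iff_dvd, ← h] at hx
  obtain ⟨c, rfl⟩ := Nat.dvd_of_mul_dvd_mul_right (Nat.pos_of_ne_zero he) hx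
  exact ⟨g ^ c, by rw [← pow_mul, mul_comm]⟩

end FiniteFields

/-! ### Suborbits of the action on a conjugacy class -/

section Suborbits

theorem natCard_subtype_card_orbit_eq {H X : Type*} [Group H] [MulAction H X] [Finite X] (n : ℕ) :
    Nat.card {α : X // Nat.card (MulAction.orbit H α) = n} =
      Nat.card {o : MulAction.orbitRel.Quotient H X // Nat.card o.orbit = n} * n := by
  have e : {α : X // Nat.card (MulAction.orbit H α) = n} ≃
      Σ o : {o : MulAction.orbitRel.Quotient H X // Nat.card o.orbit = n}, o.1.orbit :=
    { toFun := fun α => ⟨⟨Quotient.mk'' α.1, α.2⟩, ⟨α.1, by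
        rw [MulAction.orbitRel.Quotient.mem_orbit]⟩⟩
      invFun := fun p => ⟨p.2.1, by
        have h := p.2.2
        rw [MulAction.orbitRel.Quotient.mem_orbit] at h
        have h1 := p.1.2
        rw [← h] at h1
        exact h1⟩
      left_inv := fun α => rfl
      right_inv := by
        rintro ⟨⟨o, ho⟩, ⟨x, hx⟩⟩
        rw [MulAction.orbitRel.Quotient.mem_orbit] at hx
        subst hx
        rfl }
  have : Finite (MulAction.orbitRel.Quotient H X) := Quotient.finite _
  have : Fintype {o : MulAction.orbitRel.Quotient H X // Nat.card o.orbit = n} := Fintype.ofFinite _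
  rw [Nat.card_congr e, Nat.card_sigma, Finset.sum_congr rfl fun o _ => o.2, Finset.sum_const,
    Finset.card_univ, Nat.card_eq_fintype_card, smul_eq_mul]

theorem natCard_orbit_mul_natCard_stabilizer {H X : Type*} [Group H] [MulAction H X] (α : X) :
    Nat.card (MulAction.orbit H α) * Nat.card (MulAction.stabilizer H α) = Nat.card H := by
  rw [Nat.card_congr (MulAction.orbitEquivQuotientStabilizer H α)]
  exact Subgroup.index_mul_card _

variable {G : Type} [Group G]

/-- The conjugate of `z` attached to a coset of the centralizer of `z`. -/
def cosetConj (z : G) : G ⧸ Subgroup.centralizer {z} → G :=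
  Quotient.lift (fun g => g * z * g⁻¹) (by
    intro g h hgh
    have h1 := QuotientGroup.leftRel_apply.1 hgh
    rw [Subgroup.mem_centralizer_singleton_iff] at h1
    have h2 : z = (g⁻¹ * h) * z * (g⁻¹ * h)⁻¹ := by rw [h1]; group
    calc g * z * g⁻¹ = g * ((g⁻¹ * h) * z * (g⁻¹ * h)⁻¹) * g⁻¹ := by rw [← h2]
      _ = h * z * h⁻¹ := by group)

theorem cosetConj_mk (z g : G) : cosetConj z (g : G ⧸ Subgroup.centralizer {z}) = g * z * g⁻¹ :=
  rfl

theorem cosetConj_injective (z : G) : Function.Injective (cosetConj z) := by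
  intro α β h
  obtain ⟨g, rfl⟩ := QuotientGroup.mk_surjective α
  obtain ⟨k, rfl⟩ := QuotientGroup.mk_surjective β
  rw [cosetConj_mk, cosetConj_mk] at h
  rw [QuotientGroup.eq, Subgroup.mem_centralizer_singleton_iff]
  calc g⁻¹ * k * z = g⁻¹ * (k * z * k⁻¹) * k := by group
    _ = z * (g⁻¹ * k) := by rw [← h]; group

theorem isConj_iff_exists_cosetConj (z y : G) : IsConj z y ↔ ∃ α, cosetConj z α = y := by
  rw [isConj_iff]
  constructor
  · rintro ⟨c, hc⟩; exact ⟨(c : G ⧸ Subgroup.centralizer {z}), hc⟩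
  · rintro ⟨α, h⟩
    obtain ⟨g, rfl⟩ := QuotientGroup.mk_surjective α
    exact ⟨g, h⟩

theorem stabilizer_eq_centralizer_cosetConj (z : G) (α : G ⧸ Subgroup.centralizer {z}) :
    MulAction.stabilizer G α = Subgroup.centralizer {cosetConj z α} := by
  obtain ⟨g, rfl⟩ := QuotientGroup.mk_surjective α
  ext x
  rw [MulAction.mem_stabilizer_iff, Subgroup.mem_centralizer_singleton_iff, cosetConj_mk,
    MulAction.Quotient.smul_coe, smul_eq_mul, eq_comm, QuotientGroup.eq,
    Subgroup.mem_centralizer_singleton_iff]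
  constructor
  · intro h
    calc x * (g * z * g⁻¹) = g * ((g⁻¹ * (x * g)) * z) * g⁻¹ := by group
      _ = _ := by rw [h]; group
  · intro h
    calc g⁻¹ * (x * g) * z = g⁻¹ * (x * (g * z * g⁻¹)) * g := by group
      _ = _ := by rw [h]; group

theorem natCard_stabilizer_cosetConj (z : G) (α : G ⧸ Subgroup.centralizer {z}) :
    Nat.card (MulAction.stabilizer (Subgroup.centralizer {z}) α) =
      Nat.card (Subgroup.centralizer {z} ⊓ Subgroup.centralizer {cosetConj z α} : Subgroup G) := by
  rw [← stabilizer_eq_centralizer_cosetConj]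
  refine Nat.card_congr ⟨fun x => ⟨x.1.1, x.1.2, x.2⟩, fun x => ⟨⟨x.1, x.2.1⟩, x.2.2⟩,
    fun x => rfl, fun x => rfl⟩

/-- Points of the coset space of a centralizer, in terms of conjugates. -/
theorem natCard_subtype_cosetConj (z : G) (P : G → Prop) :
    Nat.card {α : G ⧸ Subgroup.centralizer {z} // P (cosetConj z α)} =
      Nat.card {y : G // IsConj z y ∧ P y} := by
  refine Nat.card_congr (Equiv.ofBijective (fun α => ⟨cosetConj z α.1,
    (isConj_iff_exists_cosetConj z _).2 ⟨α.1, rfl⟩, α.2⟩) ⟨?_, ?_⟩)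
  · intro α β h
    exact Subtype.ext (cosetConj_injective z (congrArg Subtype.val h))
  · rintro ⟨y, hy, hP⟩
    obtain ⟨α, rfl⟩ := (isConj_iff_exists_cosetConj z y).1 hy
    exact ⟨⟨α, hP⟩, rfl⟩

theorem natCard_orbit_eq_iff [Finite G] (z : G) (α : G ⧸ Subgroup.centralizer {z}) (n : ℕ) :
    Nat.card (MulAction.orbit (Subgroup.centralizer {z}) α) = n ↔
      n * Nat.card (Subgroup.centralizer {z} ⊓ Subgroup.centralizer {cosetConj z α} : Subgroup G) =
        Nat.card (Subgroup.centralizer {z}) := by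
  rw [← natCard_orbit_mul_natCard_stabilizer (H := Subgroup.centralizer {z}) α,
    natCard_stabilizer_cosetConj]
  constructor
  · rintro rfl; rfl
  · intro h
    exact (Nat.eq_of_mul_eq_mul_right Nat.card_pos h).symm

/-- Multiplying the multiplicity by `n` counts points instead of orbits, and points are conjugates
of `z`; the length of an orbit is read off from the order of the common centralizer. -/
theorem subdegreeMult_centralizer_mul [Finite G] (z : G) (n : ℕ) :
    subdegreeMult (Subgroup.centralizer {z}) n * n = Nat.card {y : G // IsConj z y ∧
      n * Nat.card (Subgroup.centralizer {z} ⊓ Subgroup.centralizer {y} : Subgroup G) =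
        Nat.card (Subgroup.centralizer {z})} := by
  rw [← natCard_subtype_cosetConj z fun y =>
    n * Nat.card (Subgroup.centralizer {z} ⊓ Subgroup.centralizer {y} : Subgroup G) =
        Nat.card (Subgroup.centralizer {z}), subdegreeMult, ← natCard_subtype_card_orbit_eq]
  exact Nat.card_congr (Equiv.subtypeEquivRight fun α => natCard_orbit_eq_iff z α n)

theorem mem_subdegrees_centralizer [Finite G] (z : G) (n : ℕ) :
    n ∈ subdegrees (Subgroup.centralizer {z}) ↔ ∃ y, IsConj z y ∧
      n * Nat.card (Subgroup.centralizer {z} ⊓ Subgroup.centralizer {y} : Subgroup G) =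
        Nat.card (Subgroup.centralizer {z}) := by
  constructor
  · rintro ⟨α, hα⟩
    exact ⟨_, (isConj_iff_exists_cosetConj z _).2 ⟨α, rfl⟩, (natCard_orbit_eq_iff z α n).1 hα⟩
  · rintro ⟨y, hy, h⟩
    obtain ⟨α, rfl⟩ := (isConj_iff_exists_cosetConj z y).1 hy
    exact ⟨α, (natCard_orbit_eq_iff z α n).2 h⟩

theorem saxlVal_centralizer (z : G) :
    saxlVal (Subgroup.centralizer {z}) = Nat.card {y : G // IsConj z y ∧ z ≠ y ∧
      Nat.card (Subgroup.centralizer {z} ⊓ Subgroup.centralizer {y} : Subgroup G) = 1} := by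
  rw [← natCard_subtype_cosetConj z fun y => z ≠ y ∧
      Nat.card (Subgroup.centralizer {z} ⊓ Subgroup.centralizer {y} : Subgroup G) = 1, saxlVal]
  refine Nat.card_congr (Equiv.subtypeEquivRight fun α => ?_)
  have h1 : cosetConj z ((1 : G) : G ⧸ Subgroup.centralizer {z}) = z := by
    rw [cosetConj_mk]; group
  change (_ ≠ α ∧ _ ⊓ _ = ⊥) ↔ _
  rw [stabilizer_eq_centralizer_cosetConj, stabilizer_eq_centralizer_cosetConj, h1,
    Subgroup.card_eq_one]
  refine and_congr_left' (not_congr ⟨?_, ?_⟩)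
  · rintro rfl; exact h1.symm
  · intro h; apply cosetConj_injective z; rw [h1]; exact h

theorem index_centralizer_eq_natCard (z : G) :
    (Subgroup.centralizer {z}).index = Nat.card {y : G // IsConj z y} := by
  have := natCard_subtype_cosetConj z fun _ => True
  simp only [and_true] at this
  rw [← this, Subgroup.index]
  exact (Nat.card_congr (Equiv.subtypeUnivEquiv fun _ => trivial)).symm

theorem natCard_subtype_eq_add {X : Type*} [Finite X] (P Q : X → Prop) :
    Nat.card {y // P y} = Nat.card {y // P y ∧ Q y} + Nat.card {y // P y ∧ ¬ Q y} := by
  classical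
  have := Fintype.ofFinite X
  simp only [Nat.card_eq_fintype_card, Fintype.card_subtype]
  rw [← Finset.filter_filter, ← Finset.filter_filter, Finset.card_filter_add_card_filter_not]

/-- The subdegrees of the action on a conjugacy class, from the sizes of the centralizers of pairs
of its elements. -/
theorem subdegrees_of_centralizer_counts [Finite G] (z : G) {b r M : ℕ} (hr : 2 < r)
    (hb : 1 < b) (hM : 0 < M) (hcard : Nat.card (Subgroup.centralizer {z}) = r * b * r)
    (h1 : ∀ y, IsConj z y → y ∈ Subgroup.centralizer {z} → y ≠ z →
      Nat.card (Subgroup.centralizer {z} ⊓ Subgroup.centralizer {y} : Subgroup G) = r * r)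
    (h2 : ∀ y, IsConj z y → y ∉ Subgroup.centralizer {z} →
      Nat.card (Subgroup.centralizer {z} ⊓ Subgroup.centralizer {y} : Subgroup G) = 1 ∨
      Nat.card (Subgroup.centralizer {z} ⊓ Subgroup.centralizer {y} : Subgroup G) = r)
    (h3 : Nat.card {y : G // IsConj z y ∧ y ∈ Subgroup.centralizer {z} ∧ y ≠ z} = (r - 1) * b)
    (h4 : Nat.card {y : G // IsConj z y ∧ y ∉ Subgroup.centralizer {z} ∧
      Nat.card (Subgroup.centralizer {z} ⊓ Subgroup.centralizer {y} : Subgroup G) = r} = M)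
    (h5 : 1 + (r - 1) * b + M < (Subgroup.centralizer {z}).index) :
    subdegrees (Subgroup.centralizer {z}) =
      {1, Nat.card (Subgroup.centralizer {z}), r * b, b} ∧
    subdegreeMult (Subgroup.centralizer {z}) 1 = 1 ∧
    subdegreeMult (Subgroup.centralizer {z}) b = r - 1 ∧
    subdegreeMult (Subgroup.centralizer {z}) (r * b) * (r * b) = M ∧
    subdegreeMult (Subgroup.centralizer {z}) (r * b * r) * (r * b * r) =
      saxlVal (Subgroup.centralizer {z}) ∧
    saxlVal (Subgroup.centralizer {z}) + (1 + (r - 1) * b + M) =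
      (Subgroup.centralizer {z}).index := by
  set H := Subgroup.centralizer {z} with hH
  set st : G → ℕ := fun y => Nat.card (H ⊓ Subgroup.centralizer {y} : Subgroup G) with hst
  have hzH : z ∈ H := by rw [hH, Subgroup.mem_centralizer_singleton_iff]
  have hstz : st z = r * b * r := by
    simp only [hst, ← hH, inf_idem, hcard]
  have hb0 : 0 < b := by omega
  have hr0 : 0 < r := by omega
  have f1 : r < r * b * r := by nlinarith [Nat.mul_le_mul hr.le hb.le]
  -- Since `|H| = r b r`, the orbit of `y` has length `1`, `b`, `r b` or `r b r` according as
  -- `|C_H(y)|` is `|H|`, `r^2`, `r` or `1`; `b > 1` separates the first two cases.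
  have e1 : ∀ y, IsConj z y → (1 * st y = r * b * r ↔ y = z) := by
    intro y hy
    constructor
    · intro h
      by_contra hne
      by_cases hyH : y ∈ H
      · have := h1 y hy hyH hne
        simp only [hst, this] at h
        nlinarith
      · rcases h2 y hy hyH with h' | h' <;> simp only [hst, h'] at h <;> omega
    · rintro rfl; rw [hstz, one_mul]
  have e2 : ∀ y, IsConj z y → (b * st y = r * b * r ↔ y ∈ H ∧ y ≠ z) := by
    intro y hy
    constructor
    · intro h
      refine ⟨?_, ?_⟩
      · by_contra hyH
        rcases h2 y hy hyH with h' | h' <;> simp only [hst, h'] at h <;> nlinarith [mul_pos hb0 hr0]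
      · rintro rfl
        rw [hstz] at h
        nlinarith [mul_pos (mul_pos hr0 hb0) hr0]
    · rintro ⟨h, h'⟩
      simp only [hst, h1 y hy h h']; ring
  have e3 : ∀ y, IsConj z y → (r * b * st y = r * b * r ↔ y ∉ H ∧ st y = r) := by
    intro y hy
    constructor
    · intro h
      have h6 := Nat.eq_of_mul_eq_mul_left (Nat.mul_pos hr0 hb0) h
      refine ⟨fun hyH => ?_, h6⟩
      by_cases hyz : y = z
      · subst hyz
        rw [hstz] at h6
        nlinarith [mul_pos hr0 hr0]
      · have := h1 y hy hyH hyz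
        simp only [hst] at h6
        rw [this] at h6
        nlinarith
    · rintro ⟨-, h⟩; rw [h]
  have e4 : ∀ y, IsConj z y → (r * b * r * st y = r * b * r ↔ z ≠ y ∧ st y = 1) := by
    intro y hy
    have hpos : 0 < r * b * r := Nat.mul_pos (Nat.mul_pos hr0 hb0) hr0
    constructor
    · intro h
      have h6 : st y = 1 := Nat.eq_of_mul_eq_mul_left hpos (by rw [h, mul_one])
      refine ⟨?_, h6⟩
      rintro rfl
      omega
    · rintro ⟨-, h⟩; rw [h, mul_one]
  have c1 : Nat.card {y : G // IsConj z y ∧ 1 * st y = r * b * r} = 1 := by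
    rw [Nat.card_eq_one_iff_unique]
    refine ⟨⟨fun u v => Subtype.ext ?_⟩, ⟨⟨z, IsConj.refl z, (e1 z (IsConj.refl z)).2 rfl⟩⟩⟩
    rw [(e1 u.1 u.2.1).1 u.2.2, (e1 v.1 v.2.1).1 v.2.2]
  have c2 : Nat.card {y : G // IsConj z y ∧ b * st y = r * b * r} = (r - 1) * b := by
    rw [← h3]
    exact Nat.card_congr (Equiv.subtypeEquivRight fun y => and_congr_right fun hy => e2 y hy)
  have c3 : Nat.card {y : G // IsConj z y ∧ r * b * st y = r * b * r} = M := by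
    rw [← h4]
    exact Nat.card_congr (Equiv.subtypeEquivRight fun y => and_congr_right fun hy => e3 y hy)
  have c4 : Nat.card {y : G // IsConj z y ∧ r * b * r * st y = r * b * r} = saxlVal H := by
    rw [saxlVal_centralizer]
    exact Nat.card_congr (Equiv.subtypeEquivRight fun y => and_congr_right fun hy => e4 y hy)
  have hsplit : saxlVal H + (1 + (r - 1) * b + M) = H.index := by
    rw [index_centralizer_eq_natCard, ← c4,
      natCard_subtype_eq_add (fun y => IsConj z y) (fun y => y = z),
      natCard_subtype_eq_add (fun y => IsConj z y ∧ ¬ y = z) (fun y => y ∈ H),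
      natCard_subtype_eq_add (fun y => (IsConj z y ∧ ¬ y = z) ∧ ¬ y ∈ H) (fun y => st y = r)]
    have d1 : Nat.card {y : G // IsConj z y ∧ y = z} = 1 := by
      rw [← c1]
      exact Nat.card_congr (Equiv.subtypeEquivRight fun y => and_congr_right fun hy => (e1 y hy).symm)
    have d2 : Nat.card {y : G // (IsConj z y ∧ ¬ y = z) ∧ y ∈ H} =
        Nat.card {y : G // IsConj z y ∧ y ∈ H ∧ y ≠ z} :=
      Nat.card_congr (Equiv.subtypeEquivRight fun y => by rw [and_assoc, and_comm (a := ¬ y = z)])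
    have hne : ∀ y, y ∉ H → y ≠ z := by rintro y hy rfl; exact hy hzH
    have d3 : Nat.card {y : G // ((IsConj z y ∧ ¬ y = z) ∧ ¬ y ∈ H) ∧ st y = r} =
        Nat.card {y : G // IsConj z y ∧ y ∉ H ∧ st y = r} :=
      Nat.card_congr (Equiv.subtypeEquivRight fun y =>
        ⟨fun h => ⟨h.1.1.1, h.1.2, h.2⟩, fun h => ⟨⟨⟨h.1, hne y h.2.1⟩, h.2.1⟩, h.2.2⟩⟩)
    have d4 : Nat.card {y : G // ((IsConj z y ∧ ¬ y = z) ∧ ¬ y ∈ H) ∧ ¬ st y = r} =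
        Nat.card {y : G // IsConj z y ∧ r * b * r * st y = r * b * r} := by
      refine Nat.card_congr (Equiv.subtypeEquivRight fun y => ⟨fun h => ⟨h.1.1.1, ?_⟩, fun h => ?_⟩)
      · rw [e4 y h.1.1.1]
        exact ⟨fun h' => h.1.1.2 h'.symm, (h2 y h.1.1.1 h.1.2).resolve_right h.2⟩
      · rw [e4 y h.1] at h
        refine ⟨⟨⟨h.1, fun h' => h.2.1 h'.symm⟩, fun hyH => ?_⟩, by rw [h.2.2]; omega⟩
        have h6 := h1 y h.1 hyH fun h' => h.2.1 h'.symm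
        have h7 : st y = r * r := h6
        rw [h.2.2] at h7
        have := Nat.mul_le_mul hr.le hr.le
        omega
    have h4' : Nat.card {y : G // IsConj z y ∧ y ∉ H ∧ st y = r} = M := h4
    rw [d1, d2, d3, d4, h3, h4']
    omega
  have hex : ∀ n, 0 < Nat.card {y : G // IsConj z y ∧ n * st y = r * b * r} →
      n ∈ subdegrees H := by
    intro n hn
    obtain ⟨⟨y, hy⟩⟩ := (Nat.card_pos_iff.1 hn).1
    rw [mem_subdegrees_centralizer]
    exact ⟨y, hy.1, by rw [← hH, hcard]; exact hy.2⟩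
  have hmul : ∀ n, subdegreeMult H n * n =
      Nat.card {y : G // IsConj z y ∧ n * st y = r * b * r} := by
    intro n
    rw [subdegreeMult_centralizer_mul, ← hH, hcard]
  refine ⟨?_, ?_, ?_, ?_, ?_, hsplit⟩
  · apply Set.Subset.antisymm
    · intro n hn
      rw [mem_subdegrees_centralizer, ← hH, hcard] at hn
      obtain ⟨y, hy, h⟩ := hn
      rw [hcard]
      simp only [Set.mem_insert_iff, Set.mem_singleton_iff]
      by_cases hyz : y = z
      · subst hyz
        left
        change n * st y = _ at h
        rw [hstz] at h
        exact Nat.eq_of_mul_eq_mul_right (Nat.mul_pos (Nat.mul_pos hr0 hb0) hr0)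
          (by rw [h, one_mul])
      · by_cases hyH : y ∈ H
        · right; right; right
          rw [h1 y hy hyH hyz] at h
          exact Nat.eq_of_mul_eq_mul_right (Nat.mul_pos hr0 hr0) (by rw [h]; ring)
        · rcases h2 y hy hyH with h' | h'
          · right; left; rw [h', mul_one] at h; exact h
          · right; right; left
            rw [h'] at h
            exact Nat.eq_of_mul_eq_mul_right hr0 h
    · rintro n (rfl | rfl | rfl | rfl)
      · exact hex _ (by rw [c1]; exact one_pos)
      -- By `hsplit`, the strict inequality `h5` leaves room for at least one regular point.
      · rw [hcard]; exact hex _ (by rw [c4]; omega)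
      · exact hex _ (by rw [c3]; exact hM)
      · exact hex _ (by rw [c2]; exact Nat.mul_pos (by omega) hb0)
  · have := hmul 1
    rw [c1, mul_one] at this
    exact this
  · have := hmul b
    rw [c2] at this
    exact Nat.eq_of_mul_eq_mul_right hb0 this
  · rw [hmul, c3]
  · rw [hmul, c4]

end Suborbits

/-! ### Double counting of commuting pairs -/

section DoubleCount

/-- A subgroup not contained in `T` maps onto the quotient `H/T`, which has prime order. -/
theorem natCard_inf_of_not_le {H : Type*} [Group H] [Finite H] {r : ℕ} (hr : r.Prime)
    {T : Subgroup H} [T.Normal] (hT : T.index = r) {Q : Subgroup H} (hQ : ¬ Q ≤ T) :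
    Nat.card Q = r * Nat.card (Q ⊓ T : Subgroup H) := by
  have h1 : T.relIndex Q = r := by
    have h2 := Subgroup.relIndex_dvd_index_of_normal T Q
    rw [hT] at h2
    refine ((Nat.dvd_prime hr).1 h2).resolve_left fun h => hQ ?_
    exact Subgroup.relIndex_eq_one.1 h
  have h3 := Subgroup.relIndex_mul_relIndex ⊥ (Q ⊓ T) Q bot_le inf_le_left
  rw [Subgroup.relIndex_bot_left, Subgroup.relIndex_bot_left, Subgroup.inf_relIndex_left, h1] at h3
  rw [← h3, mul_comm]

/-- A subgroup not contained in a normal subgroup of prime index meets all its cosets equally. -/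
theorem natCard_coset_inter {H : Type*} [Group H] [Finite H] {r : ℕ} (hr : r.Prime)
    {T : Subgroup H} [T.Normal] (hT : T.index = r) {Q : Subgroup H} (hQ : ¬ Q ≤ T) {φ : H} :
    Nat.card {x : H // x * φ⁻¹ ∈ T ∧ x ∈ Q} = Nat.card (Q ⊓ T : Subgroup H) := by
  have hcard : Nat.card (H ⧸ T) = r := hT
  have hp : Fact r.Prime := ⟨hr⟩
  obtain ⟨y, hyQ, hyT⟩ := SetLike.not_le_iff_exists.1 hQ
  have hy1 : (QuotientGroup.mk y : H ⧸ T) ≠ 1 := by rwa [Ne, QuotientGroup.eq_one_iff]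
  -- An element of `Q` outside `T` generates the quotient, so some power of it lies in the coset of
  -- `φ`; translation by this power identifies the part of `Q` in that coset with `Q ∩ T`.
  obtain ⟨n, hn⟩ := (mem_zpowers_of_prime_card hcard hy1 (g' := (φ : H ⧸ T)))
  have hn' : (QuotientGroup.mk (y ^ n) : H ⧸ T) = φ := hn
  have hyn : y ^ n ∈ Q := Q.zpow_mem hyQ n
  have hmem : y ^ n * φ⁻¹ ∈ T := by
    rw [← QuotientGroup.eq_one_iff, QuotientGroup.mk_mul, hn', QuotientGroup.mk_inv,
      mul_inv_cancel]
  refine Nat.card_congr ⟨fun x => ⟨x.1 * (y ^ n)⁻¹, Q.mul_mem x.2.2 (Q.inv_mem hyn), ?_⟩,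
    fun x => ⟨x.1 * y ^ n, ?_, Q.mul_mem x.2.1 hyn⟩, fun x => ?_, fun x => ?_⟩
  · have : x.1 * (y ^ n)⁻¹ = (x.1 * φ⁻¹) * (y ^ n * φ⁻¹)⁻¹ := by group
    rw [this]
    exact T.mul_mem x.2.1 (T.inv_mem hmem)
  · rw [mul_assoc]; exact T.mul_mem x.2.2 hmem
  · simp
  · simp

theorem natCard_coset_inter_of_le {H : Type*} [Group H]
    {T : Subgroup H} {Q : Subgroup H} (hQ : Q ≤ T) {φ : H} (hφ : φ ∉ T) :
    Nat.card {x : H // x * φ⁻¹ ∈ T ∧ x ∈ Q} = 0 := by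
  rw [Nat.card_eq_zero]
  left
  refine ⟨fun x => hφ ?_⟩
  have := T.mul_mem (T.inv_mem x.2.1) (hQ x.2.2)
  rw [mul_inv_rev, inv_inv, mul_assoc, inv_mul_cancel, mul_one] at this
  exact this

variable {G : Type} [Group G] [Finite G] {z : G} {r : ℕ}
  {T : Subgroup (Subgroup.centralizer {z})} [T.Normal]

/-- The elements of `H = C(z)` commuting with `y`, as a subgroup of `H`. -/
def centralizerIn (z y : G) : Subgroup (Subgroup.centralizer {z}) :=
  (Subgroup.centralizer {y}).subgroupOf (Subgroup.centralizer {z})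

omit [Finite G] in
theorem mem_centralizerIn {y : G} {x : Subgroup.centralizer {z}} :
    x ∈ centralizerIn z y ↔ (x : G) * y = y * x := by
  rw [centralizerIn, Subgroup.mem_subgroupOf, Subgroup.mem_centralizer_singleton_iff]

omit [Finite G] in
theorem natCard_centralizerIn (y : G) : Nat.card (centralizerIn z y) =
    Nat.card (Subgroup.centralizer {z} ⊓ Subgroup.centralizer {y} : Subgroup G) :=
  Nat.card_congr ⟨fun x => ⟨x.1.1, x.1.2, x.2⟩, fun x => ⟨⟨x.1, x.2.1⟩, x.2.2⟩,
    fun _ => rfl, fun _ => rfl⟩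

theorem natCard_centralizer_inf_of_mem (hr : r.Prime) (hT : T.index = r)
    {y : G} (hy : y ∈ Subgroup.centralizer {z}) (hyT : ⟨y, hy⟩ ∉ T)
    (hB : Nat.card (centralizerIn z y ⊓ T : Subgroup (Subgroup.centralizer {z})) = r) :
    Nat.card (Subgroup.centralizer {z} ⊓ Subgroup.centralizer {y} : Subgroup G) = r * r := by
  rw [← natCard_centralizerIn, natCard_inf_of_not_le hr hT (Q := centralizerIn z y), hB]
  intro h
  exact hyT (h (by rw [mem_centralizerIn]))

theorem natCard_centralizer_inf_of_notMem (hr : r.Prime) (hT : T.index = r) {y : G}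
    (hA : centralizerIn z y ⊓ T = ⊥) :
    Nat.card (Subgroup.centralizer {z} ⊓ Subgroup.centralizer {y} : Subgroup G) = 1 ∨
    Nat.card (Subgroup.centralizer {z} ⊓ Subgroup.centralizer {y} : Subgroup G) = r := by
  rw [← natCard_centralizerIn]
  by_cases h : centralizerIn z y ≤ T
  · left
    rw [inf_eq_left.2 h] at hA
    rw [hA, Subgroup.card_bot]
  · right
    rw [natCard_inf_of_not_le hr hT h, hA, Subgroup.card_bot, mul_one]

/-- Counting commuting pairs of an element of a coset of `T` and a conjugate of `z`. -/
theorem natCard_commuting_pairs (hr : r.Prime) (hT : T.index = r)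
    (hA : ∀ y, IsConj z y → y ∉ Subgroup.centralizer {z} → centralizerIn z y ⊓ T = ⊥)
    (hB : ∀ y, IsConj z y → ∀ hy : y ∈ Subgroup.centralizer {z}, y ≠ z → ⟨y, hy⟩ ∉ T)
    (hB' : ∀ y, IsConj z y → y ∈ Subgroup.centralizer {z} → y ≠ z →
      Nat.card (centralizerIn z y ⊓ T : Subgroup (Subgroup.centralizer {z})) = r)
    {φ : Subgroup.centralizer {z}} (hφ : φ ∉ T) :
    Nat.card {p : Subgroup.centralizer {z} × G // p.1 * φ⁻¹ ∈ T ∧ IsConj z p.2 ∧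
      (p.1 : G) * p.2 = p.2 * p.1} = Nat.card T +
      r * Nat.card {y : G // IsConj z y ∧ y ∈ Subgroup.centralizer {z} ∧ y ≠ z} +
      Nat.card {y : G // IsConj z y ∧ y ∉ Subgroup.centralizer {z} ∧
        Nat.card (Subgroup.centralizer {z} ⊓ Subgroup.centralizer {y} : Subgroup G) = r} := by
  classical
  have := Fintype.ofFinite G
  have hzH : z ∈ Subgroup.centralizer {z} := by rw [Subgroup.mem_centralizer_singleton_iff]
  have e : {p : Subgroup.centralizer {z} × G //
        p.1 * φ⁻¹ ∈ T ∧ IsConj z p.2 ∧ (p.1 : G) * p.2 = p.2 * p.1} ≃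
      Σ y : {y : G // IsConj z y},
        {x : Subgroup.centralizer {z} // x * φ⁻¹ ∈ T ∧ x ∈ centralizerIn z y.1} :=
    { toFun := fun p => ⟨⟨p.1.2, p.2.2.1⟩, ⟨p.1.1, p.2.1, mem_centralizerIn.2 p.2.2.2⟩⟩
      invFun := fun p => ⟨(p.2.1, p.1.1), p.2.2.1, p.1.2, mem_centralizerIn.1 p.2.2.2⟩
      left_inv := fun _ => rfl
      right_inv := fun _ => rfl }
  rw [Nat.card_congr e, Nat.card_sigma]
  -- The coset of `φ` contains `|C_H(y) ∩ T|` elements commuting with `y` if `C_H(y)` is not inside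
  -- `T`, and none otherwise. So `z` contributes `|T|`, every other point of `H` contributes `r`,
  -- and a point outside `H` contributes `1` exactly when `|C_H(y)| = r`.
  have key : ∀ y : {y : G // IsConj z y},
      Nat.card {x : Subgroup.centralizer {z} // x * φ⁻¹ ∈ T ∧ x ∈ centralizerIn z y.1} =
      (if y.1 = z then Nat.card T else 0) +
      r * (if y.1 ∈ Subgroup.centralizer {z} ∧ y.1 ≠ z then 1 else 0) +
      (if y.1 ∉ Subgroup.centralizer {z} ∧
        Nat.card (Subgroup.centralizer {z} ⊓ Subgroup.centralizer {y.1} : Subgroup G) = r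
        then 1 else 0) := by
    rintro ⟨y, hy⟩
    dsimp only
    by_cases hyz : y = z
    · subst hyz
      have htop : centralizerIn y y = ⊤ := by
        rw [eq_top_iff]
        intro x _
        rw [mem_centralizerIn]
        exact Subgroup.mem_centralizer_singleton_iff.1 x.2
      rw [natCard_coset_inter hr hT, htop, top_inf_eq]
      · simp [hzH]
      · rw [htop, top_le_iff]
        intro h
        rw [h, Subgroup.index_top] at hT
        exact hr.one_lt.ne hT
    · by_cases hyH : y ∈ Subgroup.centralizer {z}
      · rw [natCard_coset_inter hr hT, hB' y hy hyH hyz]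
        · simp [hyz, hyH]
        · intro h
          exact hB y hy hyH hyz (h (by rw [mem_centralizerIn]))
      · rw [← natCard_centralizerIn]
        by_cases hle : centralizerIn z y ≤ T
        · rw [natCard_coset_inter_of_le hle hφ]
          have h1 := hA y hy hyH
          rw [inf_eq_left.2 hle] at h1
          have h2 : ¬ (1 = r) := hr.one_lt.ne
          rw [h1, Subgroup.card_bot]
          simp [hyz, hyH, h2]
        · rw [natCard_coset_inter hr hT hle, natCard_inf_of_not_le hr hT hle, hA y hy hyH,
            Subgroup.card_bot]
          simp [hyz, hyH]
  rw [Finset.sum_congr rfl fun y _ => key y, Finset.sum_add_distrib, Finset.sum_add_distrib,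
    ← Finset.mul_sum, Finset.sum_ite, Finset.sum_boole, Finset.sum_boole]
  have c1 : (Finset.univ.filter fun y : {y : G // IsConj z y} => y.1 = z) =
      {⟨z, IsConj.refl z⟩} := by
    ext y
    simp [Subtype.ext_iff]
  have c2 : ∀ (P : G → Prop) [DecidablePred P],
      (Finset.univ.filter fun y : {y : G // IsConj z y} => P y.1).card =
      Nat.card {y : G // IsConj z y ∧ P y} := by
    intro P _
    rw [← Fintype.card_subtype, ← Nat.card_eq_fintype_card]
    exact Nat.card_congr (Equiv.subtypeSubtypeEquivSubtypeInter _ _)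
  rw [c1, c2 fun y => y ∈ Subgroup.centralizer {z} ∧ y ≠ z,
    c2 fun y => y ∉ Subgroup.centralizer {z} ∧
      Nat.card (Subgroup.centralizer {z} ⊓ Subgroup.centralizer {y} : Subgroup G) = r]
  simp

end DoubleCount

/-! ### Scalar models, and equidistribution of `r`-th powers -/

/-- The properties of `GL_r(q)` and `GU_r(q)`, realised as matrices over `F`, on which the suborbit
structure depends. Here `r * m` is the order of the group of scalars and `a` is the order of a
Singer cycle modulo scalars. -/
structure IsScalarModel {F Γ : Type} [Field F] [Group Γ] {r : ℕ}
    (M : Γ →* Matrix (Fin r) (Fin r) F) (m a : ℕ) : Prop where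
  prime : r.Prime
  odd : Odd r
  injective : Function.Injective M
  -- Consequently, among the `x` with `x^(r m) = 1`, the `r`-th powers in `F` are exactly those with
  -- `x^m = 1`. The hypothesis `x^m ≠ 1` below thus makes `X^r - x` irreducible.
  gcd_eq : Nat.gcd (Nat.card F - 1) (r * (r * m)) = r * m
  diag_mem : ∀ d : Fin r → F, (∀ i, d i ^ (r * m) = 1) → ∃ g, M g = Matrix.diagonal d
  diag_pow : ∀ g d, M g = Matrix.diagonal d → ∀ i, d i ^ (r * m) = 1
  perm_mem : ∀ e : Equiv.Perm (Fin r), ∃ g, M g = e.permMatrix F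
  diagonalizable : ∀ s, M s ^ r = 1 → ∃ g d, M (g * s * g⁻¹) = Matrix.diagonal d
  conj : ∀ s t, ∀ x : F, x ^ (r * m) = 1 → x ^ m ≠ 1 → M s ^ r = x • 1 → M t ^ r = x • 1 →
    ∃ g, g * s * g⁻¹ = t
  card_commutant : ∀ s, ∀ x : F, x ^ (r * m) = 1 → x ^ m ≠ 1 → M s ^ r = x • 1 →
    Nat.card {g // M g * M s = M s * M g} = a * (r * m)
  exists_not_diag : ∀ s d, M s = Matrix.diagonal d → (∀ c : F, M s ≠ c • 1) →
    ∃ g, ∀ d', M (g * s * g⁻¹) ≠ Matrix.diagonal d'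
  -- This bound serves to produce a regular suborbit; the bracket holds the leading terms of the
  -- number of nonregular points.
  card_ge : a * (r * m) * (r - 1) * ((r - 1) * a ^ 2 + a * (r * m) ^ (r - 1)) ≤ r * Nat.card Γ

/-- Collecting the factors `s` on the left moves `y` past `s` in `k(k-1)/2` places, each at the cost
of a factor `c`. -/
theorem mul_pow_of_mul_eq_smul {F A : Type*} [Field F] [Ring A] [Algebra F A] {s y : A} {c : F}
    (h : y * s = c • (s * y)) (k : ℕ) :
    (s * y) ^ k = c ^ (k * (k - 1) / 2) • (s ^ k * y ^ k) := by
  have h1 : ∀ k, y ^ k * s = c ^ k • (s * y ^ k) := by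
    intro k
    induction k with
    | zero => simp
    | succ k ih =>
      rw [pow_succ', mul_assoc, ih, mul_smul_comm, ← mul_assoc, h, smul_mul_assoc, smul_smul,
        mul_assoc, pow_succ]
  induction k with
  | zero => simp
  | succ k ih =>
    have e : (k + 1) * (k + 1 - 1) / 2 = k * (k - 1) / 2 + k := by
      rw [← Nat.triangle_succ]
    rw [pow_succ, ih, e, pow_add, smul_mul_assoc, ← mul_assoc, mul_assoc (s ^ k), h1,
      mul_smul_comm, smul_mul_assoc, smul_smul, pow_succ s, pow_succ y]
    simp only [mul_assoc]

theorem smul_one_inj {F : Type*} [Field F] {r : ℕ} [NeZero r] {x y : F}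
    (h : x • (1 : Matrix (Fin r) (Fin r) F) = y • 1) : x = y := by
  have := congrFun (congrFun h 0) 0
  simpa using this

theorem natCard_subtype_eq_sum {X F : Type*} [Finite X] [Field F] {r : ℕ} (hr : 0 < r)
    (P : F → X → Prop) (huniq : ∀ x c d, P c x → P d x → c = d) :
    Nat.card {x // ∃ c, c ^ r = 1 ∧ P c x} =
      ∑ c ∈ Polynomial.nthRootsFinset r (1 : F), Nat.card {x // P c x} := by
  have e : {x // ∃ c, c ^ r = 1 ∧ P c x} ≃
      Σ c : Polynomial.nthRootsFinset r (1 : F), {x // P c x} :=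
    (Equiv.ofBijective (fun p : Σ c : Polynomial.nthRootsFinset r (1 : F), {x // P c x} =>
      (⟨p.2.1, p.1.1, (Polynomial.mem_nthRootsFinset hr _).1 p.1.2, p.2.2⟩ :
        {x // ∃ c, c ^ r = 1 ∧ P c x})) ⟨by
        rintro ⟨⟨c, hc⟩, ⟨x, hx⟩⟩ ⟨⟨d, hd⟩, ⟨y, hy⟩⟩ h
        obtain rfl : x = y := congrArg Subtype.val h
        obtain rfl := huniq x c d hx hy
        rfl, by
        rintro ⟨x, c, hc, hx⟩
        exact ⟨⟨⟨c, (Polynomial.mem_nthRootsFinset hr _).2 hc⟩, ⟨x, hx⟩⟩, rfl⟩⟩).symm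
  rw [Nat.card_congr e, Nat.card_sigma]
  exact Finset.sum_coe_sort (Polynomial.nthRootsFinset r (1 : F)) fun c => Nat.card {x // P c x}

namespace IsScalarModel

variable {F Γ : Type} [Field F] [Group Γ] {r m a : ℕ}
  {M : Γ →* Matrix (Fin r) (Fin r) F} (hM : IsScalarModel M m a)

/-- The elements `g` with `g s = c s g`. -/
def Twist (M : Γ →* Matrix (Fin r) (Fin r) F) (s : Γ) (c : F) (g : Γ) : Prop :=
  M g * M s = c • (M s * M g)

/-- The elements whose `r`-th power is a scalar `x` with `x ^ m = w`. -/
def PowClass (M : Γ →* Matrix (Fin r) (Fin r) F) (m : ℕ) (w : F) (g : Γ) : Prop :=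
  ∃ x : F, M g ^ r = x • 1 ∧ x ^ m = w

theorem map_mul_map_inv (M : Γ →* Matrix (Fin r) (Fin r) F) (g : Γ) : M g * M g⁻¹ = 1 := by
  rw [← map_mul, mul_inv_cancel, map_one]

theorem map_inv_mul_map (M : Γ →* Matrix (Fin r) (Fin r) F) (g : Γ) : M g⁻¹ * M g = 1 := by
  rw [← map_mul, inv_mul_cancel, map_one]

theorem map_mul_left_cancel {g : Γ} {A B : Matrix (Fin r) (Fin r) F} (h : M g * A = M g * B) :
    A = B := by
  rw [← one_mul A, ← map_inv_mul_map M g, mul_assoc, h, ← mul_assoc, map_inv_mul_map, one_mul]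

theorem map_mul_right_cancel {g : Γ} {A B : Matrix (Fin r) (Fin r) F} (h : A * M g = B * M g) :
    A = B := by
  rw [← mul_one A, ← map_mul_map_inv M g, ← mul_assoc, h, mul_assoc, map_mul_map_inv, mul_one]

include hM

theorem neZero : NeZero r := ⟨hM.prime.ne_zero⟩

theorem scalar_mem {x : F} (hx : x ^ (r * m) = 1) : ∃ g, M g = x • 1 := by
  obtain ⟨g, hg⟩ := hM.diag_mem (fun _ => x) fun _ => hx
  exact ⟨g, by rw [hg, Matrix.smul_one_eq_diagonal]⟩

theorem scalar_pow {x : F} {g : Γ} (hg : M g = x • 1) : x ^ (r * m) = 1 :=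
  have := hM.neZero
  hM.diag_pow g (fun _ => x) (by rw [hg, Matrix.smul_one_eq_diagonal]) 0

theorem scalar_pow_of_pow {x : F} {g : Γ} (hg : M g ^ r = x • 1) : x ^ (r * m) = 1 :=
  hM.scalar_pow (g := g ^ r) (by rw [map_pow, hg])

theorem map_ne_zero (g : Γ) : M g ≠ 0 := by
  have := hM.neZero
  intro h
  have h1 := map_mul_map_inv M g
  rw [h, zero_mul] at h1
  exact zero_ne_one h1

theorem smul_map_inj {x y : F} {g : Γ} (h : x • M g = y • M g) : x = y := by
  have := hM.neZero
  refine smul_one_inj (r := r) (map_mul_right_cancel (M := M) (g := g) ?_)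
  rw [smul_mul_assoc, smul_mul_assoc, one_mul, h]

theorem twist_unique {s g : Γ} {c d : F} (h : Twist M s c g) (h' : Twist M s d g) : c = d := by
  rw [Twist] at h h'
  rw [h, ← map_mul] at h'
  exact hM.smul_map_inj h'

theorem rm_dvd : r * m ∣ Nat.card F - 1 := by
  have h := Nat.gcd_dvd_left (Nat.card F - 1) (r * (r * m))
  rwa [hM.gcd_eq] at h

theorem exists_primitive [Finite F] : ∃ ζ : F, IsPrimitiveRoot ζ r :=
  exists_isPrimitiveRoot_of_dvd ((Dvd.intro _ rfl).trans hM.rm_dvd)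

theorem m_pos : 0 < m := by
  have := hM.gcd_eq
  by_contra h
  have h0 : m = 0 := by omega
  subst h0
  simp only [mul_zero, Nat.gcd_zero_right] at this
  obtain ⟨g, hg⟩ := hM.diag_mem (fun _ => 0) fun _ => by simp
  exact hM.map_ne_zero g (by rw [hg]; exact Matrix.diagonal_zero)

/-- Every fibre of `y ↦ (y ^ r) ^ m` on the elements with `y s = c s y` has the same size, if some
`u` commuting with `s` has nontrivial norm. -/
theorem card_twist_powClass [Finite Γ] {s u : Γ} {c d w : F} (hu : M u * M s = M s * M u)
    (hpow : ∀ y, Twist M s c y → ∃ x : F, M y ^ r = x • 1)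
    (hnorm : ∀ y, Twist M s c y → M (u * y) ^ r = d • M y ^ r)
    (hd : d ^ m ≠ 1) (hd' : d ^ (r * m) = 1) (hw : w ^ r = 1) :
    r * Nat.card {y // Twist M s c y ∧ PowClass M m w y} = Nat.card {y // Twist M s c y} := by
  have := hM.neZero
  have hr := hM.prime
  have hr0 := hr.pos
  have hud : ∀ y, Twist M s c (u * y) ↔ Twist M s c y := by
    intro y
    rw [Twist, Twist, map_mul, mul_assoc, ← mul_assoc (M s), ← hu, mul_assoc, ← mul_smul_comm]
    exact ⟨fun h => map_mul_left_cancel h, fun h => by rw [h]⟩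
  have hω : (d ^ m) ^ r = 1 := by rw [← pow_mul, mul_comm, hd']
  have hd0 : d ≠ 0 := by
    rintro rfl
    rw [zero_pow (Nat.mul_pos hr0 hM.m_pos).ne'] at hd'
    exact zero_ne_one hd'
  -- Multiplication by `u` multiplies `(y^r)^m` by `d^m`; as this is a primitive `r`-th root of
  -- unity, it permutes all `r` fibres cyclically.
  have hprim : IsPrimitiveRoot (d ^ m) r := by
    have h1 : orderOf (d ^ m) = r := by
      have hp : Fact r.Prime := ⟨hr⟩
      exact orderOf_eq_prime hω hd
    rw [← h1]; exact IsPrimitiveRoot.orderOf _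
  have hstep : ∀ v : F, Nat.card {y // Twist M s c y ∧ PowClass M m v y} =
      Nat.card {y // Twist M s c y ∧ PowClass M m (d ^ m * v) y} := by
    intro v
    refine Nat.card_congr (Equiv.subtypeEquiv (Equiv.mulLeft u) fun y => ?_)
    simp only [Equiv.coe_mulLeft, hud]
    refine and_congr_right fun hy => ?_
    obtain ⟨x, hx⟩ := hpow y hy
    rw [PowClass, PowClass, hnorm y hy, hx]
    constructor
    · rintro ⟨x', hx', rfl⟩
      obtain rfl := smul_one_inj hx'
      exact ⟨d * x, by rw [smul_smul], by rw [mul_pow]⟩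
    · rintro ⟨x', hx', h⟩
      rw [smul_smul] at hx'
      obtain rfl := smul_one_inj hx'
      rw [mul_pow] at h
      exact ⟨x, rfl, mul_left_cancel₀ (pow_ne_zero _ hd0) h⟩
  have hall : ∀ k : ℕ, Nat.card {y // Twist M s c y ∧ PowClass M m w y} =
      Nat.card {y // Twist M s c y ∧ PowClass M m ((d ^ m) ^ k * w) y} := by
    intro k
    induction k with
    | zero => simp
    | succ k ih => rw [ih, hstep, pow_succ', mul_assoc]
  have hw0 : w ≠ 0 := by
    rintro rfl
    rw [zero_pow hr.ne_zero] at hw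
    exact zero_ne_one hw
  have hall' : ∀ v : F, v ^ r = 1 → Nat.card {y // Twist M s c y ∧ PowClass M m v y} =
      Nat.card {y // Twist M s c y ∧ PowClass M m w y} := by
    intro v hv
    obtain ⟨k, -, hk⟩ := hprim.eq_pow_of_pow_eq_one (ξ := v / w) (by rw [div_pow, hv, hw, div_one])
    rw [hall k, hk, div_mul_cancel₀ _ hw0]
  have hsum := natCard_subtype_eq_sum (F := F) hr0
    (fun v y => Twist M s c y ∧ PowClass M m v y) (by
      rintro y v v' ⟨-, x, hx, rfl⟩ ⟨-, x', hx', rfl⟩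
      rw [hx] at hx'
      rw [smul_one_inj hx'])
  rw [Finset.sum_congr rfl fun v hv => hall' v ((Polynomial.mem_nthRootsFinset hr0 _).1 hv),
    Finset.sum_const, hprim.card_nthRootsFinset, smul_eq_mul] at hsum
  rw [← hsum]
  refine Nat.card_congr (Equiv.subtypeEquivRight fun y => ?_)
  constructor
  · rintro ⟨v, -, hy, -⟩; exact hy
  · intro hy
    obtain ⟨x, hx⟩ := hpow y hy
    exact ⟨x ^ m, by rw [← pow_mul, mul_comm, hM.scalar_pow_of_pow hx], hy, x, hx, rfl⟩

-- When it is nonempty, the set of elements with twist `c` is a coset of the commutant of `s`.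
omit hM in
theorem card_twist {s : Γ} {c : F} (h : ∃ g, Twist M s c g) :
    Nat.card {y // Twist M s c y} = Nat.card {y // M y * M s = M s * M y} := by
  obtain ⟨g, hg⟩ := h
  refine (Nat.card_congr (Equiv.subtypeEquiv (Equiv.mulLeft g) fun y => ?_)).symm
  rw [Twist] at hg
  rw [Twist, Equiv.coe_mulLeft, map_mul]
  constructor
  · intro h
    rw [mul_assoc, h, ← mul_assoc, hg, smul_mul_assoc, mul_assoc]
  · intro h
    rw [← mul_assoc (M s), ← smul_mul_assoc, ← hg, mul_assoc, mul_assoc] at h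
    exact map_mul_left_cancel h

/-- Conjugation by `y` multiplies `s^r` by `c^r`, but it fixes the nonzero scalar `e`. -/
theorem twist_pow_eq_one {s y : Γ} {e c : F} (hs : M s ^ r = e • 1) (h : Twist M s c y) :
    c ^ r = 1 := by
  have := hM.neZero
  have he0 : e ≠ 0 := by
    rintro rfl
    rw [zero_smul, ← map_pow] at hs
    exact hM.map_ne_zero _ hs
  have h1 : SemiconjBy (M y) (M s) (c • M s) := by
    rw [SemiconjBy, smul_mul_assoc]; exact h
  have h2 := (h1.pow_right r).eq
  rw [smul_pow, hs, mul_smul_comm, mul_one, smul_smul, smul_mul_assoc, one_mul] at h2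
  have h3 := hM.smul_map_inj h2
  exact mul_right_cancel₀ he0 (by rw [one_mul]; exact h3.symm)

/-- Counting the elements commuting with `s` modulo scalars in a given class. -/
theorem card_commute_mod_scalars [Finite F] [Finite Γ] {s u : Γ} {d w e : F}
    (hs : M s ^ r = e • 1) (hB : ∀ c : F, c ^ r = 1 → ∃ g, Twist M s c g)
    (hu : M u * M s = M s * M u)
    (hpow : ∀ c y, c ^ r = 1 → c ≠ 1 → Twist M s c y → ∃ x : F, M y ^ r = x • 1)
    (hnorm : ∀ c y, c ^ r = 1 → c ≠ 1 → Twist M s c y → M (u * y) ^ r = d • M y ^ r)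
    (hd : d ^ m ≠ 1) (hd' : d ^ (r * m) = 1) (hw : w ^ r = 1) :
    r * Nat.card {y // (∃ c, Twist M s c y) ∧ PowClass M m w y} =
      r * Nat.card {y // M y * M s = M s * M y ∧ PowClass M m w y} +
      (r - 1) * Nat.card {y // M y * M s = M s * M y} := by
  classical
  have := hM.neZero
  have hr0 := hM.prime.pos
  obtain ⟨ζ, hζ⟩ := hM.exists_primitive
  have hcr := fun c y (h : Twist M s c y) => hM.twist_pow_eq_one hs h
  have hsum := natCard_subtype_eq_sum (F := F) hr0
    (fun c y => Twist M s c y ∧ PowClass M m w y) (by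
      rintro y c c' ⟨h, -⟩ ⟨h', -⟩
      exact hM.twist_unique h h')
  have e1 : Nat.card {y // (∃ c, Twist M s c y) ∧ PowClass M m w y} =
      Nat.card {y // ∃ c, c ^ r = 1 ∧ Twist M s c y ∧ PowClass M m w y} := by
    refine Nat.card_congr (Equiv.subtypeEquivRight fun y => ⟨?_, ?_⟩)
    · rintro ⟨⟨c, hc⟩, h⟩; exact ⟨c, hcr c y hc, hc, h⟩
    · rintro ⟨c, -, hc, h⟩; exact ⟨⟨c, hc⟩, h⟩
  have h1mem : (1 : F) ∈ Polynomial.nthRootsFinset r (1 : F) :=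
    (Polynomial.mem_nthRootsFinset hr0 _).2 (one_pow r)
  -- The twist `c = 1` is kept apart; by equidistribution each of the other `r - 1` twists
  -- contributes one `r`-th of the order of the commutant.
  rw [e1, hsum, ← Finset.add_sum_erase _ _ h1mem, mul_add, Finset.mul_sum]
  congr 1
  · congr 1
    refine Nat.card_congr (Equiv.subtypeEquivRight fun y => ?_)
    rw [Twist, one_smul]
  · rw [Finset.sum_congr rfl fun c hc => ?_, Finset.sum_const, Finset.card_erase_of_mem h1mem,
      hζ.card_nthRootsFinset, smul_eq_mul]
    have hc1 := Finset.ne_of_mem_erase hc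
    have hc2 := (Polynomial.mem_nthRootsFinset hr0 _).1 (Finset.mem_of_mem_erase hc)
    rw [hM.card_twist_powClass hu (fun y => hpow c y hc2 hc1) (fun y => hnorm c y hc2 hc1) hd hd' hw,
      card_twist (hB c hc2)]

end IsScalarModel

/-! ### Diagonal and monomial matrices -/

theorem IsPrimitiveRoot.exists_perm_pow_eq {F : Type*} [Field F] {r : ℕ} [NeZero r] {ζ : F}
    (hζ : IsPrimitiveRoot ζ r) {d : Fin r → F} (hd : Function.Injective d)
    (hdr : ∀ i, d i ^ r = 1) : ∃ σ : Equiv.Perm (Fin r), ∀ i, ζ ^ (σ i : ℕ) = d i := by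
  choose f hf hf' using fun i => hζ.eq_pow_of_pow_eq_one (hdr i)
  have hinj : Function.Injective fun i => (⟨f i, hf i⟩ : Fin r) := by
    intro i j h
    apply hd
    rw [← hf' i, ← hf' j, Fin.mk.inj h]
  exact ⟨Equiv.ofBijective _ (Finite.injective_iff_bijective.1 hinj), fun i => hf' i⟩

theorem IsPrimitiveRoot.injective_pow_fin {F : Type*} [Field F] {r : ℕ} {ζ : F}
    (hζ : IsPrimitiveRoot ζ r) : Function.Injective fun i : Fin r => ζ ^ (i : ℕ) :=
  fun i j h => Fin.ext (hζ.pow_inj i.2 j.2 h)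

theorem permMatrix_mul_diagonal {F : Type*} [Field F] {r : ℕ} (e : Equiv.Perm (Fin r))
    (d : Fin r → F) : e.permMatrix F * Matrix.diagonal d =
      Matrix.diagonal (fun i => d (e i)) * e.permMatrix F := by
  ext i j
  rw [Matrix.mul_diagonal, Matrix.diagonal_mul, Equiv.Perm.permMatrix, PEquiv.toMatrix_apply]
  by_cases h : j = e i
  · simp [h]
  · have : ¬ e i = j := fun h' => h h'.symm
    simp [this]

theorem eq_diagonal_of_commute {F : Type*} [Field F] {r : ℕ} {d : Fin r → F}
    (hd : Function.Injective d) {g : Matrix (Fin r) (Fin r) F}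
    (h : g * Matrix.diagonal d = Matrix.diagonal d * g) :
    g = Matrix.diagonal fun i => g i i := by
  ext i j
  by_cases hij : i = j
  · subst hij; simp
  · rw [Matrix.diagonal_apply_ne _ hij]
    have h1 := congrFun (congrFun h i) j
    rw [Matrix.mul_diagonal, Matrix.diagonal_mul, mul_comm] at h1
    by_contra h0
    exact hij (hd (mul_right_cancel₀ h0 h1).symm)

/-- An element of `M_r(F)` that permutes the eigenlines of a diagonal matrix cyclically. -/
theorem mul_diagonal_pow {F : Type*} [Field F] {r : ℕ} {y : Matrix (Fin r) (Fin r) F}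
    {σ : Equiv.Perm (Fin r)} (hy : ∀ i j, y i j ≠ 0 → j = σ i) (u : Fin r → F) (k : ℕ) :
    (Matrix.diagonal u * y) ^ k =
      Matrix.diagonal (fun i => ∏ l ∈ Finset.range k, u ((σ ^ l) i)) * y ^ k := by
  have h1 : ∀ v : Fin r → F, y * Matrix.diagonal v = Matrix.diagonal (fun i => v (σ i)) * y := by
    intro v
    ext i j
    rw [Matrix.mul_diagonal, Matrix.diagonal_mul, mul_comm]
    by_cases h : y i j = 0
    · simp [h]
    · rw [hy i j h]
  induction k with
  | zero => simp
  | succ k ih =>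
    rw [pow_succ', ih, mul_assoc, ← mul_assoc y, h1, mul_assoc, ← mul_assoc, pow_succ' y,
      Matrix.diagonal_mul_diagonal]
    congr 2
    funext i
    rw [Finset.prod_range_succ', mul_comm]
    rfl

/-- If `x = b^r`, the order of `b` divides both `|F| - 1` and `r (r m)`, hence `r m`, and then `x^m
= b^(r m) = 1`. -/
theorem pow_ne_of_gcd_eq {F : Type*} [Field F] [Finite F] {r m : ℕ} (hr : 0 < r) (hm : 0 < m)
    (hgcd : Nat.gcd (Nat.card F - 1) (r * (r * m)) = r * m) {x : F} (hx : x ^ (r * m) = 1)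
    (hx' : x ^ m ≠ 1) (b : F) : b ^ r ≠ x := by
  rintro rfl
  apply hx'
  have hb0 : b ≠ 0 := by
    rintro rfl
    rw [zero_pow hr.ne', zero_pow (Nat.mul_pos hr hm).ne'] at hx
    exact zero_ne_one hx
  rw [← pow_mul, ← orderOf_dvd_iff_pow_eq_one, ← hgcd]
  refine Nat.dvd_gcd ?_ ?_
  · rw [orderOf_dvd_iff_pow_eq_one]
    have := Fintype.ofFinite F
    rw [Nat.card_eq_fintype_card]
    exact FiniteField.pow_card_sub_one_eq_one b hb0
  · rw [orderOf_dvd_iff_pow_eq_one, pow_mul, hx]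

/-! ### Elements commuting up to scalars with an irreducible or a split element -/

namespace IsScalarModel

variable {F Γ : Type} [Field F] [Group Γ] {r m a : ℕ}
  {M : Γ →* Matrix (Fin r) (Fin r) F} (hM : IsScalarModel M m a)
include hM

theorem ne_pow [Finite F] {x : F} (hx : x ^ (r * m) = 1) (hx' : x ^ m ≠ 1) (b : F) : b ^ r ≠ x :=
  pow_ne_of_gcd_eq hM.prime.pos hM.m_pos hM.gcd_eq hx hx' b

/-- `s` and `c s` have the same `r`-th power and so are conjugate; the conjugating element realises
the Galois automorphism `s ↦ c s` of `F[s]`. -/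
theorem exists_twist {s : Γ} {x c : F} (hx : x ^ (r * m) = 1) (hx' : x ^ m ≠ 1)
    (hs : M s ^ r = x • 1) (hc : c ^ r = 1) : ∃ g, Twist M s c g := by
  obtain ⟨t, ht⟩ := hM.scalar_mem (x := c) (by rw [pow_mul, hc, one_pow])
  obtain ⟨g, hg⟩ := hM.conj s (t * s) x hx hx' hs (by
    rw [map_mul, ht, smul_mul_assoc, one_mul, smul_pow, hc, hs, one_smul])
  refine ⟨g, ?_⟩
  rw [Twist, ← map_mul, mul_inv_eq_iff_eq_mul.1 hg, map_mul, map_mul, ht, smul_mul_assoc, one_mul,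
    smul_mul_assoc]

/-- Elements commuting with both `s` and some `y` with `y s = c s y`, `c ≠ 1`, are scalar. -/
theorem eq_scalar_of_commute_twist [Finite F] {s y g : Γ} {x c : F} (hx : x ^ (r * m) = 1)
    (hx' : x ^ m ≠ 1) (hs : M s ^ r = x • 1) (hc : c ≠ 1) (hy : Twist M s c y)
    (hg : M g * M s = M s * M g) (hgy : M y * M g = M g * M y) : ∃ e : F, M g = e • 1 := by
  by_contra h
  push Not at h
  have h1 := commute_of_commute_commutant hM.prime (hM.ne_pow hx hx') hs hg h hgy
  refine hc (hM.twist_unique hy ?_)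
  rw [Twist, one_smul, h1]

/-- Because `c^r = 1`, the element `y^r` commutes with `s` as well as with `y`, and only scalars
commute with both. -/
theorem exists_pow_eq_scalar_of_twist [Finite F] {s y : Γ} {x c : F} (hx : x ^ (r * m) = 1)
    (hx' : x ^ m ≠ 1) (hs : M s ^ r = x • 1) (hcr : c ^ r = 1) (hc : c ≠ 1) (hy : Twist M s c y) :
    ∃ e : F, M y ^ r = e • 1 := by
  have h1 : SemiconjBy (M y) (M s) (c • M s) := by
    rw [SemiconjBy, smul_mul_assoc]; exact hy
  have h2 : ∀ k, M y ^ k * M s = c ^ k • (M s * M y ^ k) := by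
    intro k
    induction k with
    | zero => simp
    | succ k ih =>
      rw [pow_succ', mul_assoc, ih, mul_smul_comm, ← mul_assoc, h1.eq, smul_mul_assoc,
        smul_mul_assoc, smul_smul, mul_assoc, ← pow_succ]
  obtain ⟨e, he⟩ := hM.eq_scalar_of_commute_twist hx hx' hs hc hy (g := y ^ r)
    (by rw [map_pow, h2, hcr, one_smul]) (by rw [map_pow, ← pow_succ, ← pow_succ'])
  exact ⟨e, by rw [← map_pow, he]⟩

/-- The factor `c^(r(r-1)/2)` is trivial since `r` is odd. -/
theorem mul_pow_of_twist {s y : Γ} {x c : F} (hs : M s ^ r = x • 1) (hcr : c ^ r = 1)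
    (hy : Twist M s c y) : M (s * y) ^ r = x • M y ^ r := by
  rw [map_mul, mul_pow_of_mul_eq_smul hy, hs, smul_mul_assoc, one_mul]
  obtain ⟨k, hk⟩ := hM.odd
  have : r * (r - 1) / 2 = r * k := by
    rw [hk, Nat.add_sub_cancel, mul_left_comm, Nat.mul_div_cancel_left _ (by norm_num)]
  rw [this, pow_mul, hcr, one_pow, one_smul]

/-- Write `w = (x^m)^j`. The elements of `F[s]` in this class are the `ν s^j` with `ν^(r m) = 1`, so
modulo scalars each class has exactly one representative in the torus. -/
theorem card_commutant_powClass [Finite F] {s : Γ} {x w : F} (hx : x ^ (r * m) = 1)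
    (hx' : x ^ m ≠ 1) (hs : M s ^ r = x • 1) (hw : w ^ r = 1) :
    Nat.card {y // M y * M s = M s * M y ∧ PowClass M m w y} = r * m := by
  have := hM.neZero
  have hr := hM.prime
  have hp : Fact r.Prime := ⟨hr⟩
  obtain ⟨ζ, hζ⟩ := hM.exists_primitive
  have hω : (x ^ m) ^ r = 1 := by rw [← pow_mul, mul_comm, hx]
  have hprim : IsPrimitiveRoot (x ^ m) r := by
    rw [← orderOf_eq_prime hω hx']; exact IsPrimitiveRoot.orderOf _
  obtain ⟨j, -, rfl⟩ := hprim.eq_pow_of_pow_eq_one hw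
  have hx0 : x ≠ 0 := by
    rintro rfl
    exact hM.ne_pow hx hx' 0 (zero_pow hr.ne_zero)
  rw [← card_pow_eq_one_of_dvd (K := F) hM.rm_dvd]
  have hmem : ∀ ν : {ν : F // ν ^ (r * m) = 1}, ∃ g, M g = ν.1 • 1 := fun ν => hM.scalar_mem ν.2
  choose f hf using hmem
  have hf' : ∀ ν, M (f ν * s ^ j) = ν.1 • M (s ^ j) := fun ν => by
    rw [map_mul, hf, smul_mul_assoc, one_mul]
  have hmem' : ∀ ν, M (f ν * s ^ j) * M s = M s * M (f ν * s ^ j) ∧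
      PowClass M m ((x ^ m) ^ j) (f ν * s ^ j) := by
    refine fun ν => ⟨?_, ?_⟩
    · rw [hf', smul_mul_assoc, mul_smul_comm, map_pow, ← pow_succ, ← pow_succ']
    refine ⟨ν.1 ^ r * x ^ j, ?_, ?_⟩
    · rw [hf', smul_pow, map_pow, ← pow_mul, mul_comm j, pow_mul, hs, smul_pow, one_pow, smul_smul]
    · rw [mul_pow, ← pow_mul, ν.2, one_mul, ← pow_mul, ← pow_mul, mul_comm]
  refine (Nat.card_congr (Equiv.ofBijective (fun ν => ⟨f ν * s ^ j, hmem' ν⟩) ⟨?_, ?_⟩)).symm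
  · intro ν ν' h
    have h1 : f ν * s ^ j = f ν' * s ^ j := congrArg Subtype.val h
    have h2 := congrArg M h1
    rw [hf', hf'] at h2
    exact Subtype.ext (hM.smul_map_inj h2)
  · rintro ⟨y, hy, x', hyx, hx'w⟩
    have hx'1 : x' ^ (r * m) = 1 := hM.scalar_pow_of_pow hyx
    have h1 : (x' / x ^ j) ^ m = 1 := by
      rw [div_pow, hx'w, ← pow_mul, ← pow_mul, mul_comm m j]
      exact div_self (pow_ne_zero _ hx0)
    obtain ⟨t, ht⟩ := hM.rm_dvd
    obtain ⟨μ, hμ⟩ := exists_pow_eq_of_pow_eq_one (K := F) (d := r) (e := m * t)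
      (by rw [ht, mul_assoc]) (x := x' / x ^ j) (by rw [pow_mul, h1, one_pow])
    have hμ1 : μ ^ (r * m) = 1 := by rw [pow_mul, hμ, h1]
    have hμ0 : μ ≠ 0 := by
      rintro rfl
      rw [zero_pow (Nat.mul_pos hr.pos hM.m_pos).ne'] at hμ1
      exact zero_ne_one hμ1
    obtain ⟨i, -, hi⟩ := eq_smul_of_pow_eq hr (hM.ne_pow hx hx') hζ hs hy (j := j) hμ0
      (by rw [hyx, hμ, div_mul_cancel₀ _ (pow_ne_zero _ hx0)])
    refine ⟨⟨μ * ζ ^ i, ?_⟩, Subtype.ext (hM.injective ?_)⟩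
    · rw [mul_pow, hμ1, one_mul, ← pow_mul, mul_comm, pow_mul, pow_mul, hζ.pow_eq_one, one_pow,
        one_pow]
    · rw [hf', hi, map_pow]

/-- Counting elements of a class commuting modulo scalars with an irreducible element `s`. -/
theorem card_commute_irreducible [Finite F] [Finite Γ] {s : Γ} {x w : F} (hx : x ^ (r * m) = 1)
    (hx' : x ^ m ≠ 1) (hs : M s ^ r = x • 1) (hw : w ^ r = 1) :
    r * Nat.card {y // (∃ c, Twist M s c y) ∧ PowClass M m w y} =
      r * (r * m) + (r - 1) * (a * (r * m)) := by
  rw [hM.card_commute_mod_scalars hs (fun c hc => hM.exists_twist hx hx' hs hc) rfl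
    (fun c y hcr hc hy => hM.exists_pow_eq_scalar_of_twist hx hx' hs hcr hc hy)
    (fun c y hcr _ hy => hM.mul_pow_of_twist hs hcr hy) hx' hx hw,
    hM.card_commutant_powClass hx hx' hs hw, hM.card_commutant s x hx hx' hs]

section Split

variable {ζ : F} (hζ : IsPrimitiveRoot ζ r)
include hζ

/-- The eigenvalues of `s` are distinct and `y` permutes the eigenlines, so `y` is monomial, with
the permutation given by multiplication by `c` on the `r`-th roots of unity. -/
theorem exists_perm_of_twist_diagonal {s y : Γ} {c : F}
    (hs : M s = Matrix.diagonal fun i : Fin r => ζ ^ (i : ℕ)) (hcr : c ^ r = 1)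
    (hy : Twist M s c y) : ∃ σ : Equiv.Perm (Fin r),
      (∀ i, ζ ^ (σ i : ℕ) = c * ζ ^ (i : ℕ)) ∧ ∀ i j, M y i j ≠ 0 → j = σ i := by
  have := hM.neZero
  have hc0 : c ≠ 0 := by
    rintro rfl
    rw [zero_pow hM.prime.ne_zero] at hcr
    exact zero_ne_one hcr
  obtain ⟨σ, hσ⟩ := hζ.exists_perm_pow_eq (d := fun i => c * ζ ^ (i : ℕ))
    (fun i j h => hζ.injective_pow_fin (mul_left_cancel₀ hc0 h))
    (fun i => by rw [mul_pow, hcr, ← pow_mul, mul_comm (i : ℕ), pow_mul, hζ.pow_eq_one, one_pow,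
      one_mul])
  refine ⟨σ, hσ, fun i j hij => ?_⟩
  rw [Twist, hs] at hy
  have h1 := congrFun (congrFun hy i) j
  rw [Matrix.mul_diagonal, Matrix.smul_apply, Matrix.diagonal_mul, smul_eq_mul, mul_comm,
    ← mul_assoc] at h1
  apply hζ.injective_pow_fin
  dsimp only
  rw [hσ]
  exact mul_right_cancel₀ hij h1

theorem perm_orbit {σ : Equiv.Perm (Fin r)} {c : F} (hcr : c ^ r = 1) (hc : c ≠ 1)
    (hσ : ∀ i, ζ ^ (σ i : ℕ) = c * ζ ^ (i : ℕ)) (i : Fin r) :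
    Function.Bijective fun l : Fin r => (σ ^ (l : ℕ)) i := by
  have hp : Fact r.Prime := ⟨hM.prime⟩
  have hprim : IsPrimitiveRoot c r := by
    rw [← orderOf_eq_prime hcr hc]; exact IsPrimitiveRoot.orderOf _
  have h1 : ∀ l : ℕ, ζ ^ ((σ ^ l) i : ℕ) = c ^ l * ζ ^ (i : ℕ) := by
    intro l
    induction l with
    | zero => simp
    | succ l ih => rw [pow_succ', Equiv.Perm.mul_apply, hσ, ih, pow_succ']; ring
  rw [← Finite.injective_iff_bijective]
  intro k l h
  have h2 : ζ ^ ((σ ^ (k : ℕ)) i : ℕ) = ζ ^ ((σ ^ (l : ℕ)) i : ℕ) := by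
    have : (σ ^ (k : ℕ)) i = (σ ^ (l : ℕ)) i := h
    rw [this]
  rw [h1, h1] at h2
  exact hprim.injective_pow_fin (mul_right_cancel₀
    (pow_ne_zero _ (hζ.ne_zero hM.prime.ne_zero)) h2)

/-- Commuting with `s` makes `g` diagonal, and commuting with `y`, which moves the coordinates in a
single `r`-cycle, makes its entries equal. -/
theorem eq_scalar_of_commute_twist_diagonal {s y g : Γ} {c : F}
    (hs : M s = Matrix.diagonal fun i : Fin r => ζ ^ (i : ℕ)) (hcr : c ^ r = 1) (hc : c ≠ 1)
    (hy : Twist M s c y) (hg : M g * M s = M s * M g) (hgy : M y * M g = M g * M y) :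
    ∃ e : F, M g = e • 1 := by
  have := hM.neZero
  obtain ⟨σ, hσ, hyσ⟩ := hM.exists_perm_of_twist_diagonal hζ hs hcr hy
  rw [hs] at hg
  have hd := eq_diagonal_of_commute hζ.injective_pow_fin hg
  have hstep : ∀ i, M g (σ i) (σ i) = M g i i := by
    intro i
    have hne : M y i (σ i) ≠ 0 := by
      intro h0
      have h1 := congrFun (congrFun (map_mul_map_inv M y) i) i
      rw [Matrix.mul_apply, Matrix.one_apply_eq, Finset.sum_eq_zero] at h1
      · exact zero_ne_one h1
      · intro j _
        by_cases hj : M y i j = 0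
        · rw [hj, zero_mul]
        · rw [hyσ i j hj, h0, zero_mul]
    rw [hd] at hgy
    have h1 := congrFun (congrFun hgy i) (σ i)
    rw [Matrix.mul_diagonal, Matrix.diagonal_mul, mul_comm] at h1
    exact mul_right_cancel₀ hne h1
  have hpow : ∀ (l : ℕ), M g ((σ ^ l) 0) ((σ ^ l) 0) = M g 0 0 := by
    intro l
    induction l with
    | zero => simp
    | succ l ih => rw [pow_succ', Equiv.Perm.mul_apply, hstep, ih]
  refine ⟨M g 0 0, ?_⟩
  rw [Matrix.smul_one_eq_diagonal]
  conv_lhs => rw [hd]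
  congr 1
  funext i
  obtain ⟨l, rfl⟩ := (hM.perm_orbit hζ hcr hc hσ 0).2 i
  exact hpow l

theorem exists_twist_diagonal {s : Γ} {c : F}
    (hs : M s = Matrix.diagonal fun i : Fin r => ζ ^ (i : ℕ)) (hcr : c ^ r = 1) :
    ∃ g, Twist M s c g := by
  have := hM.neZero
  have hc0 : c ≠ 0 := by
    rintro rfl
    rw [zero_pow hM.prime.ne_zero] at hcr
    exact zero_ne_one hcr
  obtain ⟨σ, hσ⟩ := hζ.exists_perm_pow_eq (d := fun i => c * ζ ^ (i : ℕ))
    (fun i j h => hζ.injective_pow_fin (mul_left_cancel₀ hc0 h))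
    (fun i => by rw [mul_pow, hcr, ← pow_mul, mul_comm (i : ℕ), pow_mul, hζ.pow_eq_one, one_pow,
      one_mul])
  obtain ⟨g, hg⟩ := hM.perm_mem σ
  refine ⟨g, ?_⟩
  rw [Twist, hs, hg, permMatrix_mul_diagonal, ← smul_mul_assoc, ← Matrix.diagonal_smul]
  simp only [hσ]
  rfl

theorem card_commutant_diagonal [Finite F] {s : Γ}
    (hs : M s = Matrix.diagonal fun i : Fin r => ζ ^ (i : ℕ)) :
    Nat.card {y // M y * M s = M s * M y} = (r * m) ^ r := by
  have e : {y // M y * M s = M s * M y} ≃ (Fin r → {x : F // x ^ (r * m) = 1}) := by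
    refine Equiv.ofBijective (fun y i => ⟨M y.1 i i, ?_⟩) ⟨?_, ?_⟩
    · exact hM.diag_pow y.1 _ (eq_diagonal_of_commute hζ.injective_pow_fin (hs ▸ y.2)) i
    · intro y y' h
      apply Subtype.ext
      apply hM.injective
      rw [eq_diagonal_of_commute (g := M y.1) hζ.injective_pow_fin (hs ▸ y.2),
        eq_diagonal_of_commute (g := M y'.1) hζ.injective_pow_fin (hs ▸ y'.2)]
      congr 1
      funext i
      exact congrArg Subtype.val (congrFun h i)
    · intro d
      obtain ⟨g, hg⟩ := hM.diag_mem (fun i => (d i).1) fun i => (d i).2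
      refine ⟨⟨g, ?_⟩, ?_⟩
      · rw [hs, hg, Matrix.diagonal_mul_diagonal, Matrix.diagonal_mul_diagonal]
        congr 1
        funext i
        exact mul_comm _ _
      · funext i
        apply Subtype.ext
        simp [hg]
  rw [Nat.card_congr e, Nat.card_fun, card_pow_eq_one_of_dvd hM.rm_dvd, Nat.card_eq_fintype_card,
    Fintype.card_fin]

/-- Counting elements of a class commuting modulo scalars with `diag(1, ζ, …, ζ^(r-1))`. -/
theorem card_commute_diagonal [Finite F] [Finite Γ] {s : Γ} {w : F}
    (hs : M s = Matrix.diagonal fun i : Fin r => ζ ^ (i : ℕ)) (hw : w ^ r = 1) (hw1 : w ≠ 1) :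
    r * Nat.card {y // (∃ c, Twist M s c y) ∧ PowClass M m w y} =
      (r - 1) * (r * m) ^ r := by
  have := hM.neZero
  have hr := hM.prime
  have hsr : M s ^ r = (1 : F) • 1 := by
    rw [hs, Matrix.diagonal_pow, one_smul, ← Matrix.diagonal_one]
    congr 1
    funext i
    rw [Pi.pow_apply, ← pow_mul, mul_comm, pow_mul, hζ.pow_eq_one, one_pow]
  obtain ⟨η, hη⟩ := exists_isPrimitiveRoot_of_dvd (K := F) hM.rm_dvd
  have hη1 : η ^ m ≠ 1 := by
    refine hη.pow_ne_one_of_pos_of_lt hM.m_pos.ne' ?_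
    have := hM.m_pos
    have := hr.one_lt
    nlinarith
  -- Here `u = diag(η, 1, …, 1)` plays the role that `s` has in the irreducible case: as `y` is
  -- monomial along an `r`-cycle, `(u y)^r = det(u) y^r = η y^r`.
  obtain ⟨u, hu⟩ := hM.diag_mem (Function.update 1 0 η) (fun i => by
    by_cases hi : i = 0
    · subst hi; rw [Function.update_self, hη.pow_eq_one]
    · rw [Function.update_of_ne hi, Pi.one_apply, one_pow])
  have hprod : ∏ i, (Function.update (1 : Fin r → F) 0 η) i = η := by
    rw [Finset.prod_update_of_mem (Finset.mem_univ _)]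
    simp
  -- A diagonal element of `Γ` has entries killed by `r m`, so it belongs to class `1`, and `w ≠ 1`.
  have h0 : Nat.card {y // M y * M s = M s * M y ∧ PowClass M m w y} = 0 := by
    rw [Nat.card_eq_zero]
    left
    refine ⟨?_⟩
    rintro ⟨y, hy, x, hx, hxw⟩
    have hd := eq_diagonal_of_commute hζ.injective_pow_fin (hs ▸ hy)
    have h1 := hM.diag_pow y _ hd 0
    rw [hd, Matrix.diagonal_pow, Matrix.smul_one_eq_diagonal] at hx
    have h2 := congrFun (Matrix.diagonal_injective hx) 0
    rw [Pi.pow_apply] at h2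
    rw [← h2, ← pow_mul] at hxw
    exact hw1 (hxw.symm.trans h1)
  have key : ∀ c y, c ^ r = 1 → c ≠ 1 → Twist M s c y → ∃ x : F, M y ^ r = x • 1 := by
    intro c y hcr hc hy
    have h2 : ∀ k, M y ^ k * M s = c ^ k • (M s * M y ^ k) := by
      intro k
      induction k with
      | zero => simp
      | succ k ih =>
        have h1 : M y * M s = c • (M s * M y) := hy
        rw [pow_succ', mul_assoc, ih, mul_smul_comm, ← mul_assoc, h1, smul_mul_assoc,
          smul_smul, mul_assoc, ← pow_succ]
    obtain ⟨e, he⟩ := hM.eq_scalar_of_commute_twist_diagonal hζ hs hcr hc hy (g := y ^ r)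
      (by rw [map_pow, h2, hcr, one_smul]) (by rw [map_pow, ← pow_succ, ← pow_succ'])
    exact ⟨e, by rw [← map_pow, he]⟩
  rw [hM.card_commute_mod_scalars (u := u) (d := η) hsr
    (fun c hc => hM.exists_twist_diagonal hζ hs hc) ?_ key ?_ hη1 hη.pow_eq_one hw, h0,
    hM.card_commutant_diagonal hζ hs, mul_zero, zero_add]
  · rw [hs, hu, Matrix.diagonal_mul_diagonal, Matrix.diagonal_mul_diagonal]
    congr 1
    funext i
    exact mul_comm _ _
  · intro c y hcr hc hy
    obtain ⟨σ, hσ, hyσ⟩ := hM.exists_perm_of_twist_diagonal hζ hs hcr hy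
    rw [map_mul, hu, mul_diagonal_pow hyσ, ← smul_one_mul, Matrix.smul_one_eq_diagonal]
    congr 2
    funext i
    conv_rhs => rw [← hprod]
    rw [Finset.prod_range fun l => Function.update (1 : Fin r → F) 0 η ((σ ^ l) i)]
    exact Fintype.prod_bijective _ (hM.perm_orbit hζ hcr hc hσ i) _ _ fun _ => rfl

end Split

end IsScalarModel

/-! ### Conjugation invariance and reduction of split elements to a diagonal matrix -/

namespace IsScalarModel

variable {F Γ : Type} [Field F] [Group Γ] {r m a : ℕ}
  {M : Γ →* Matrix (Fin r) (Fin r) F} (hM : IsScalarModel M m a)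

theorem twist_conj_iff {s g y : Γ} {c : F} :
    Twist M (g * s * g⁻¹) c (g * y * g⁻¹) ↔ Twist M s c y := by
  rw [Twist, Twist, ← map_mul, ← map_mul, ← map_mul, ← map_mul,
    show g * y * g⁻¹ * (g * s * g⁻¹) = g * (y * s) * g⁻¹ by group,
    show g * s * g⁻¹ * (g * y * g⁻¹) = g * (s * y) * g⁻¹ by group, map_mul, map_mul, map_mul M (_ * _),
    map_mul M g (s * y), ← smul_mul_assoc, ← mul_smul_comm]
  exact ⟨fun h => map_mul_left_cancel (map_mul_right_cancel h), fun h => by rw [h]⟩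

theorem powClass_conj_iff {g y : Γ} {w : F} :
    PowClass M m w (g * y * g⁻¹) ↔ PowClass M m w y := by
  have h : ∀ (g y : Γ), PowClass M m w y → PowClass M m w (g * y * g⁻¹) := by
    rintro g y ⟨x, hx, hxw⟩
    refine ⟨x, ?_, hxw⟩
    rw [← map_pow] at hx ⊢
    rw [conj_pow, map_mul, map_mul, hx, mul_smul_comm, mul_one, smul_mul_assoc, map_mul_map_inv]
  refine ⟨fun h' => ?_, h g y⟩
  have := h g⁻¹ _ h'
  rwa [show g⁻¹ * (g * y * g⁻¹) * g⁻¹⁻¹ = y by group] at this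

include hM

theorem smul_map_pow {x : F} {g h : Γ} (hx : M g = x • M h) : x ^ (r * m) = 1 := by
  refine hM.scalar_pow (g := g * h⁻¹) ?_
  rw [map_mul, hx, smul_mul_assoc, map_mul_map_inv]

theorem ne_zero_of_pow {x : F} (hx : x ^ (r * m) = 1) : x ≠ 0 := by
  rintro rfl
  rw [zero_pow (Nat.mul_pos hM.prime.pos hM.m_pos).ne'] at hx
  exact zero_ne_one hx

theorem powClass_smul {x w : F} {g h : Γ} (hx : M g = x • M h) (hh : PowClass M m w h) :
    PowClass M m w g := by
  obtain ⟨y, hy, hyw⟩ := hh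
  refine ⟨x ^ r * y, by rw [hx, smul_pow, hy, smul_smul], ?_⟩
  rw [mul_pow, ← pow_mul, hM.smul_map_pow hx, one_mul, hyw]

omit hM in
theorem twist_smul {x c : F} {s s' y : Γ} (hx : M s = x • M s') (h : Twist M s' c y) :
    Twist M s c y := by
  rw [Twist] at h ⊢
  rw [hx, mul_smul_comm, h, smul_mul_assoc, smul_comm]

theorem exists_pow_eq [Finite F] {x : F} (hx : x ^ m = 1) : ∃ μ : F, μ ^ r = x ∧ μ ^ (r * m) = 1 := by
  obtain ⟨t, ht⟩ := hM.rm_dvd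
  obtain ⟨μ, hμ⟩ := exists_pow_eq_of_pow_eq_one (K := F) (d := r) (e := m * t)
    (by rw [ht, mul_assoc]) (x := x) (by rw [pow_mul, hx, one_pow])
  exact ⟨μ, hμ, by rw [pow_mul, hμ, hx]⟩

/-- If `s ^ r` is an `r`-th power and `z` permutes the eigenspaces of `s` transitively, then `s` is
conjugate to a scalar multiple of `diag(1, ζ, …, ζ^(r-1))`. -/
theorem exists_conj_eq_smul_diagonal [Finite F] {ζ c x : F} (hζ : IsPrimitiveRoot ζ r) {s z : Γ}
    (hs : M s ^ r = x • 1) (hx : x ^ m = 1) (hc : c ^ r = 1) (hc1 : c ≠ 1) (hz : Twist M s c z) :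
    ∃ g s₀ : Γ, ∃ μ : F, M s₀ = Matrix.diagonal (fun i : Fin r => ζ ^ (i : ℕ)) ∧
      M (g * s * g⁻¹) = μ • M s₀ := by
  have := hM.neZero
  have hp : Fact r.Prime := ⟨hM.prime⟩
  have hcp : IsPrimitiveRoot c r := by
    rw [← orderOf_eq_prime hc hc1]; exact IsPrimitiveRoot.orderOf _
  obtain ⟨μ, hμ, hμ1⟩ := hM.exists_pow_eq hx
  have hμ0 := hM.ne_zero_of_pow hμ1
  obtain ⟨k, hk⟩ := hM.scalar_mem (x := μ⁻¹) (by rw [inv_pow, hμ1, inv_one])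
  have hks : M (k * s) = μ⁻¹ • M s := by rw [map_mul, hk, smul_mul_assoc, one_mul]
  have hksr : M (k * s) ^ r = 1 := by
    rw [hks, smul_pow, hs, smul_smul, inv_pow, hμ, inv_mul_cancel₀ (hμ ▸ pow_ne_zero _ hμ0),
      one_smul]
  obtain ⟨g, d, hd⟩ := hM.diagonalizable (k * s) hksr
  have hdr : ∀ i, d i ^ r = 1 := by
    have h1 : M (g * (k * s) * g⁻¹) ^ r = 1 := by
      rw [← map_pow] at hksr ⊢
      rw [conj_pow, map_mul, map_mul, hksr, mul_one, map_mul_map_inv]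
    rw [hd, Matrix.diagonal_pow, ← Matrix.diagonal_one] at h1
    exact fun i => congrFun (Matrix.diagonal_injective h1) i
  have hz' : Twist M (g * (k * s) * g⁻¹) c (g * z * g⁻¹) :=
    twist_conj_iff.2 (twist_smul hks hz)
  set y := g * z * g⁻¹ with hy
  -- Row `i` of the invertible matrix `y` is nonzero, so `c d_i` is again an eigenvalue. Starting
  -- from `d 0`, all `c^l d_0` occur, so the eigenvalues are the `r`-th roots of unity, each once.
  have hnext : ∀ i, ∃ j, d j = c * d i := by
    intro i
    by_contra hne
    push Not at hne
    have h0 : ∀ j, M y i j = 0 := by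
      intro j
      by_contra hij
      rw [Twist, hd] at hz'
      have h1 := congrFun (congrFun hz' i) j
      rw [Matrix.mul_diagonal, Matrix.smul_apply, Matrix.diagonal_mul, smul_eq_mul, mul_comm,
        ← mul_assoc] at h1
      exact hne j (mul_right_cancel₀ hij h1)
    have h1 := congrFun (congrFun (map_mul_map_inv M y) i) i
    rw [Matrix.mul_apply, Matrix.one_apply_eq, Finset.sum_eq_zero] at h1
    · exact zero_ne_one h1
    · intro j _; rw [h0, zero_mul]
  have hd0 : d 0 ≠ 0 := by
    intro h0
    have := hdr 0
    rw [h0, zero_pow hM.prime.ne_zero] at this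
    exact zero_ne_one this
  have hall : ∀ l : ℕ, ∃ j, d j = c ^ l * d 0 := by
    intro l
    induction l with
    | zero => exact ⟨0, by simp⟩
    | succ l ih =>
      obtain ⟨j, hj⟩ := ih
      obtain ⟨j', hj'⟩ := hnext j
      exact ⟨j', by rw [hj', hj, pow_succ']; ring⟩
  choose f hf using hall
  have hfinj : Function.Injective fun l : Fin r => f l := by
    intro l l' h
    apply hcp.injective_pow_fin
    have h1 : d (f l) = d (f l') := by
      have : f l = f l' := h
      rw [this]
    rw [hf, hf] at h1
    exact mul_right_cancel₀ hd0 h1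
  have hdinj : Function.Injective d := by
    intro i j hij
    obtain ⟨l, rfl⟩ := (Finite.injective_iff_bijective.1 hfinj).2 i
    obtain ⟨l', rfl⟩ := (Finite.injective_iff_bijective.1 hfinj).2 j
    dsimp only at hij ⊢
    rw [hf, hf] at hij
    rw [hcp.injective_pow_fin (mul_right_cancel₀ hd0 hij)]
  obtain ⟨σ, hσ⟩ := hζ.exists_perm_pow_eq hdinj hdr
  obtain ⟨p, hp⟩ := hM.perm_mem σ.symm
  obtain ⟨s₀, hs₀⟩ := hM.diag_mem (fun i : Fin r => ζ ^ (i : ℕ)) fun i => by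
    rw [← pow_mul, mul_comm, mul_assoc, pow_mul, hζ.pow_eq_one, one_pow]
  refine ⟨p * g, s₀, μ, hs₀, ?_⟩
  have h1 : M (p * (g * (k * s) * g⁻¹) * p⁻¹) = M s₀ := by
    refine map_mul_right_cancel (M := M) (g := p) ?_
    rw [map_mul, map_mul, mul_assoc, map_inv_mul_map, mul_one, hd, hp, permMatrix_mul_diagonal, hs₀]
    congr 2
    funext i
    rw [← hσ, Equiv.apply_symm_apply]
  rw [← h1]
  have h2 : M (p * g * s * (p * g)⁻¹) = M (p * g) * M s * M (p * g)⁻¹ := by rw [map_mul, map_mul]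
  have h3 : M (p * (g * (k * s) * g⁻¹) * p⁻¹) = M (p * g) * M (k * s) * M (p * g)⁻¹ := by
    rw [← map_mul, ← map_mul]; congr 1; group
  rw [h2, h3, hks, mul_smul_comm, smul_mul_assoc, smul_smul, mul_inv_cancel₀ hμ0, one_smul]

theorem card_commute_split [Finite F] [Finite Γ] {c x w : F} {s z : Γ}
    (hs : M s ^ r = x • 1) (hx : x ^ m = 1) (hc : c ^ r = 1) (hc1 : c ≠ 1) (hz : Twist M s c z)
    (hw : w ^ r = 1) (hw1 : w ≠ 1) :
    r * Nat.card {y // (∃ c, Twist M s c y) ∧ PowClass M m w y} = (r - 1) * (r * m) ^ r := by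
  obtain ⟨ζ, hζ⟩ := hM.exists_primitive
  obtain ⟨g, s₀, μ, hs₀, hg⟩ := hM.exists_conj_eq_smul_diagonal hζ hs hx hc hc1 hz
  rw [← hM.card_commute_diagonal hζ hs₀ hw hw1]
  congr 1
  have hμ1 := hM.smul_map_pow hg
  have hμ0 := hM.ne_zero_of_pow hμ1
  have hg' : M s₀ = μ⁻¹ • M (g * s * g⁻¹) := by rw [hg, smul_smul, inv_mul_cancel₀ hμ0, one_smul]
  refine Nat.card_congr (Equiv.subtypeEquiv (MulAut.conj g).toEquiv fun y => ?_)
  change _ ↔ (∃ c, Twist M s₀ c (g * y * g⁻¹)) ∧ PowClass M m w (g * y * g⁻¹)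
  rw [powClass_conj_iff]
  refine and_congr_left' (exists_congr fun d => ?_)
  rw [← twist_conj_iff (g := g)]
  exact ⟨twist_smul hg', twist_smul hg⟩

end IsScalarModel

/-! ### Passage to the quotient by scalars; the torus in the centralizer -/

namespace IsScalarModel

variable {F Γ G : Type} [Field F] [Group Γ] [Group G] {r m a : ℕ}
  {M : Γ →* Matrix (Fin r) (Fin r) F} (hM : IsScalarModel M m a)
  {π : Γ →* G} (hπ : Function.Surjective π) (hker : ∀ g, π g = 1 ↔ ∃ x : F, M g = x • 1)

include hker

theorem proj_eq_iff {g h : Γ} : π g = π h ↔ ∃ x : F, M g = x • M h := by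
  rw [← mul_inv_eq_one, ← map_inv, ← map_mul, hker]
  refine exists_congr fun x => ?_
  rw [map_mul]
  constructor
  · intro h1
    rw [← mul_one (M g), ← map_inv_mul_map M h, ← mul_assoc, h1, smul_mul_assoc, one_mul]
  · intro h1
    rw [h1, smul_mul_assoc, map_mul_map_inv]

theorem proj_commute_iff {g h : Γ} : π g * π h = π h * π g ↔ ∃ c, Twist M h c g := by
  rw [← map_mul, ← map_mul, proj_eq_iff hker]
  simp only [Twist, map_mul]

include hM

theorem powClass_proj {g h : Γ} {w : F} (hgh : π g = π h) :
    PowClass M m w g ↔ PowClass M m w h := by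
  obtain ⟨x, hx⟩ := (proj_eq_iff hker).1 hgh
  obtain ⟨y, hy⟩ := (proj_eq_iff hker).1 hgh.symm
  exact ⟨hM.powClass_smul hy, hM.powClass_smul hx⟩

theorem natCard_ker [Finite F] : Nat.card {g // π g = 1} = r * m := by
  have := hM.neZero
  rw [← card_pow_eq_one_of_dvd (K := F) hM.rm_dvd]
  choose f hf using fun x : {x : F // x ^ (r * m) = 1} => hM.scalar_mem x.2
  refine (Nat.card_congr (Equiv.ofBijective (fun x => ⟨f x, (hker _).2 ⟨x.1, hf x⟩⟩)
    ⟨?_, ?_⟩)).symm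
  · intro x y h
    have h1 : f x = f y := congrArg Subtype.val h
    have h2 := hf x
    rw [h1, hf y] at h2
    exact Subtype.ext (smul_one_inj h2).symm
  · rintro ⟨g, hg⟩
    obtain ⟨x, hx⟩ := (hker g).1 hg
    exact ⟨⟨x, hM.scalar_pow hx⟩, Subtype.ext (hM.injective ((hf _).trans hx.symm))⟩

include hπ

theorem natCard_proj [Finite F] [Finite Γ] [Finite G] (P : G → Prop) :
    Nat.card {g // P (π g)} = Nat.card {y // P y} * (r * m) := by
  have := Fintype.ofFinite G
  have e : {g // P (π g)} ≃ Σ y : {y // P y}, {g // π g = y} :=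
    { toFun := fun g => ⟨⟨π g.1, g.2⟩, ⟨g.1, rfl⟩⟩
      invFun := fun p => ⟨p.2.1, by rw [p.2.2]; exact p.1.2⟩
      left_inv := fun _ => rfl
      right_inv := by rintro ⟨⟨y, hy⟩, ⟨g, hg⟩⟩; cases hg; rfl }
  have h1 : ∀ y : {y // P y}, Nat.card {g // π g = y} = r * m := by
    rintro ⟨y, hy⟩
    obtain ⟨g, rfl⟩ := hπ y
    rw [← natCard_ker hM hker]
    refine Nat.card_congr (Equiv.subtypeEquiv (Equiv.mulLeft g⁻¹) fun k => ?_)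
    rw [Equiv.coe_mulLeft, map_mul, map_inv, inv_mul_eq_one, eq_comm]
  have : Fintype {y // P y} := Fintype.ofFinite _
  rw [Nat.card_congr e, Nat.card_sigma, Finset.sum_congr rfl fun y _ => h1 y, Finset.sum_const,
    Finset.card_univ, smul_eq_mul, Nat.card_eq_fintype_card]

variable {s : Γ} {x : F} (hx : x ^ (r * m) = 1) (hx' : x ^ m ≠ 1) (hs : M s ^ r = x • 1)
include hx hx' hs

/-- If the `r`-th powers of `s` and `g` are scalars with equal `m`-th powers, their ratio is the
`r`-th power of a scalar of `Γ`; after rescaling `g` they coincide and `IsScalarModel.conj` applies.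
-/
theorem isConj_proj_iff [Finite F] {g : Γ} :
    IsConj (π s) (π g) ↔ PowClass M m (x ^ m) g := by
  have := hM.neZero
  constructor
  · intro h
    obtain ⟨c, hc⟩ := isConj_iff.1 h
    obtain ⟨k, rfl⟩ := hπ c
    rw [← map_mul, ← map_inv, ← map_mul] at hc
    rw [← powClass_proj hM hker hc, powClass_conj_iff]
    exact ⟨x, hs, rfl⟩
  · rintro ⟨y, hy, hyx⟩
    have hy0 := hM.ne_zero_of_pow (hM.scalar_pow_of_pow hy)
    obtain ⟨μ, hμ, hμ1⟩ := hM.exists_pow_eq (x := x / y)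
      (by rw [div_pow, hyx, div_self (pow_ne_zero _ (hM.ne_zero_of_pow hx))])
    obtain ⟨k, hk⟩ := hM.scalar_mem hμ1
    have hkg : M (k * g) = μ • M g := by rw [map_mul, hk, smul_mul_assoc, one_mul]
    obtain ⟨h, hh⟩ := hM.conj s (k * g) x hx hx' hs
      (by rw [hkg, smul_pow, hμ, hy, smul_smul, div_mul_cancel₀ _ hy0])
    have h1 : π (k * g) = π g := (proj_eq_iff hker).2 ⟨μ, hkg⟩
    rw [← h1, ← hh, isConj_iff]
    exact ⟨π h, by simp⟩

omit hπ in
theorem orderOf_proj [Finite F] : orderOf (π s) = r := by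
  have hp : Fact r.Prime := ⟨hM.prime⟩
  refine orderOf_eq_prime ?_ ?_
  · rw [← map_pow, hker]; exact ⟨x, by rw [map_pow, hs]⟩
  · have := hM.neZero
    rw [Ne, hker]
    rintro ⟨e, he⟩
    rw [he, smul_pow, one_pow] at hs
    exact hM.ne_pow hx hx' e (smul_one_inj hs)

/-- The preimage of the centralizer is the union, over the `r` roots of unity `c`, of the sets of
elements with twist `c`, each of size `a (r m)`. -/
theorem natCard_centralizer_proj [Finite F] [Finite Γ] [Finite G] :
    Nat.card (Subgroup.centralizer {π s}) = a * r := by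
  have hrm : 0 < r * m := Nat.mul_pos hM.prime.pos hM.m_pos
  obtain ⟨ζ, hζ⟩ := hM.exists_primitive
  have h1 := natCard_proj hM hπ hker fun y => y ∈ Subgroup.centralizer {π s}
  have h2 := natCard_subtype_eq_sum (F := F) hM.prime.pos (fun c y => Twist M s c y)
    fun y c d => hM.twist_unique
  have h3 : Nat.card {g // π g ∈ Subgroup.centralizer {π s}} =
      Nat.card {y // ∃ c, c ^ r = 1 ∧ Twist M s c y} := by
    refine Nat.card_congr (Equiv.subtypeEquivRight fun g => ?_)
    rw [Subgroup.mem_centralizer_singleton_iff, proj_commute_iff hker]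
    exact ⟨fun ⟨c, hc⟩ => ⟨c, hM.twist_pow_eq_one hs hc, hc⟩, fun ⟨c, _, hc⟩ => ⟨c, hc⟩⟩
  rw [h3, h2, Finset.sum_congr rfl fun c hc => (card_twist (hM.exists_twist hx hx' hs
    ((Polynomial.mem_nthRootsFinset hM.prime.pos _).1 hc))).trans (hM.card_commutant s x hx hx' hs),
    Finset.sum_const, hζ.card_nthRootsFinset, smul_eq_mul, ← mul_assoc] at h1
  rw [mul_comm a r]
  exact (Nat.eq_of_mul_eq_mul_right hrm h1).symm

omit hM hπ hker hx hx' hs in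
/-- The image of the commutant of `s`: a torus, normal in the centralizer of the image of `s`. -/
def torus (π : Γ →* G) (s : Γ) : Subgroup (Subgroup.centralizer {π s}) :=
  ((Subgroup.centralizer {s}).map π).subgroupOf (Subgroup.centralizer {π s})

omit hM hπ hker hx hx' hs in
theorem mem_torus {y : Subgroup.centralizer {π s}} :
    y ∈ torus π s ↔ ∃ g, g * s = s * g ∧ π g = y := by
  rw [torus, Subgroup.mem_subgroupOf, Subgroup.mem_map]
  simp only [Subgroup.mem_centralizer_singleton_iff]

omit hπ hx hx' hs in
theorem proj_mem_torus {g : Γ} (hg : π g ∈ Subgroup.centralizer {π s}) :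
    ⟨π g, hg⟩ ∈ torus π s ↔ M g * M s = M s * M g := by
  rw [mem_torus]
  constructor
  · rintro ⟨k, hk, hkg⟩
    obtain ⟨e, he⟩ := (proj_eq_iff hker).1 hkg.symm
    rw [he, smul_mul_assoc, mul_smul_comm, ← map_mul, hk, map_mul]
  · intro h
    exact ⟨g, hM.injective (by rw [map_mul, map_mul, h]), rfl⟩

omit hx hx' hs in
-- A lift of an element of the centralizer conjugates `s` to a scalar multiple of `s`, which has the
-- same commutant.
theorem torus_normal : (torus π s).Normal := by
  refine ⟨?_⟩
  rintro ⟨y, hy⟩ hyT ⟨k, hk⟩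
  obtain ⟨g, rfl⟩ := hπ y
  obtain ⟨k, rfl⟩ := hπ k
  rw [proj_mem_torus hM hker] at hyT
  have e : (⟨π k, hk⟩ * ⟨π g, hy⟩ * ⟨π k, hk⟩⁻¹ : Subgroup.centralizer {π s}) =
      ⟨π (k * g * k⁻¹), by
        rw [map_mul, map_mul, map_inv]
        exact Subgroup.mul_mem _ (Subgroup.mul_mem _ hk hy) (Subgroup.inv_mem _ hk)⟩ :=
    Subtype.ext (by simp)
  rw [e, proj_mem_torus hM hker]
  rw [Subgroup.mem_centralizer_singleton_iff, proj_commute_iff hker] at hk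
  obtain ⟨c, hc⟩ := hk
  have h1 : Twist M s 1 g := by rw [Twist, one_smul]; exact hyT
  have hc0 : c ≠ 0 := by
    rintro rfl
    rw [Twist, zero_smul, ← map_mul] at hc
    exact hM.map_ne_zero _ hc
  have h2 : Twist M (k * s * k⁻¹) 1 (k * g * k⁻¹) := twist_conj_iff.2 h1
  have h3 : M s = c⁻¹ • M (k * s * k⁻¹) := by
    rw [map_mul, map_mul, hc, smul_mul_assoc, mul_assoc, map_mul_map_inv, mul_one, smul_smul,
      inv_mul_cancel₀ hc0, one_smul]
  have h4 := twist_smul h3 h2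
  rwa [Twist, one_smul] at h4

theorem natCard_torus [Finite F] [Finite Γ] [Finite G] : Nat.card (torus π s) = a := by
  have hrm : 0 < r * m := Nat.mul_pos hM.prime.pos hM.m_pos
  have h1 := natCard_proj hM hπ hker fun y => ∃ h : y ∈ Subgroup.centralizer {π s},
    ⟨y, h⟩ ∈ torus π s
  have h2 : Nat.card {g // ∃ h : π g ∈ Subgroup.centralizer {π s}, ⟨π g, h⟩ ∈ torus π s} =
      a * (r * m) := by
    rw [← hM.card_commutant s x hx hx' hs]
    refine Nat.card_congr (Equiv.subtypeEquivRight fun g => ⟨fun ⟨h, h'⟩ =>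
      (proj_mem_torus hM hker h).1 h', fun h => ⟨?_, ?_⟩⟩)
    · rw [Subgroup.mem_centralizer_singleton_iff, proj_commute_iff hker]
      exact ⟨1, by rw [Twist, one_smul, h]⟩
    · rw [proj_mem_torus hM hker]; exact h
  rw [h2] at h1
  rw [Nat.eq_of_mul_eq_mul_right hrm h1]
  exact Nat.card_congr ⟨fun y => ⟨y.1.1, y.1.2, y.2⟩, fun y => ⟨⟨y.1, y.2.choose⟩, y.2.choose_spec⟩,
    fun _ => rfl, fun _ => rfl⟩

theorem index_torus [Finite F] [Finite Γ] [Finite G] : (torus π s).index = r := by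
  have h1 := (torus π s).index_mul_card
  rw [natCard_torus hM hπ hker hx hx' hs, natCard_centralizer_proj hM hπ hker hx hx' hs,
    mul_comm a r] at h1
  refine Nat.eq_of_mul_eq_mul_right ?_ h1
  rw [← natCard_torus hM hπ hker hx hx' hs]
  exact Nat.card_pos

/-- A nontrivial element of the torus lifts to a generator of `F[s]`. If `y` commutes with it, a
lift of `y` normalizes `F[s]` and sends `s` to some `ζ^i s`, so `y` centralizes `π s`. -/
theorem centralizerIn_inf_torus_eq_bot [Finite F] {y : G}
    (hy : y ∉ Subgroup.centralizer {π s}) : centralizerIn (π s) y ⊓ torus π s = ⊥ := by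
  rw [eq_bot_iff]
  rintro ⟨t, ht⟩ ⟨h1, h2⟩
  obtain ⟨g, rfl⟩ := hπ t
  obtain ⟨k, rfl⟩ := hπ y
  obtain ⟨ζ, hζ⟩ := hM.exists_primitive
  have h1' := mem_centralizerIn.1 h1
  have h2' := (proj_mem_torus hM hker ht).1 h2
  rw [Subgroup.mem_bot, Subtype.ext_iff]
  change π g = 1
  rw [hker]
  by_contra hne
  push Not at hne
  obtain ⟨c, hc⟩ := (proj_commute_iff hker).1 h1'.symm
  obtain ⟨i, -, hi⟩ := exists_commute_up_to_scalar hM.prime (hM.ne_pow hx hx') hζ hs h2' hne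
    (map_inv_mul_map M k) hc
  apply hy
  rw [Subgroup.mem_centralizer_singleton_iff, proj_commute_iff hker]
  exact ⟨_, hi⟩

theorem eq_of_mem_torus [Finite F] {y : G} (hy : IsConj (π s) y)
    (hy' : y ∈ Subgroup.centralizer {π s}) (hyT : ⟨y, hy'⟩ ∈ torus π s) : y = π s := by
  obtain ⟨g, rfl⟩ := hπ y
  obtain ⟨ζ, hζ⟩ := hM.exists_primitive
  obtain ⟨x', hx'g, hxx⟩ := (isConj_proj_iff hM hπ hker hx hx' hs).1 hy
  have hx0 := hM.ne_zero_of_pow hx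
  obtain ⟨μ, hμ, hμ1⟩ := hM.exists_pow_eq (x := x' / x)
    (by rw [div_pow, hxx, div_self (pow_ne_zero _ hx0)])
  obtain ⟨i, -, hi⟩ := eq_smul_of_pow_eq hM.prime (hM.ne_pow hx hx') hζ hs
    ((proj_mem_torus hM hker hy').1 hyT) (j := 1) (hM.ne_zero_of_pow hμ1)
    (by rw [hx'g, hμ, pow_one, div_mul_cancel₀ _ hx0])
  rw [proj_eq_iff hker]
  exact ⟨_, by rw [hi, pow_one]⟩

/-- The intersection is `⟨π s⟩`. A lift `k` of `y` has a twist `c ≠ 1`; if `g` commutes with `s` and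
`k g = d g k`, then `d = c^j` for some `j`, so `g s^(-j)` commutes with both `s` and `k` and is
scalar. -/
theorem natCard_centralizerIn_inf_torus [Finite F] [Finite G] {y : G}
    (hy : y ∈ Subgroup.centralizer {π s}) (hyT : ⟨y, hy⟩ ∉ torus π s) :
    Nat.card (centralizerIn (π s) y ⊓ torus π s : Subgroup (Subgroup.centralizer {π s})) = r := by
  obtain ⟨k, rfl⟩ := hπ y
  have hp : Fact r.Prime := ⟨hM.prime⟩
  have := hM.neZero
  have hmem : π s ∈ Subgroup.centralizer {π s} := by
    rw [Subgroup.mem_centralizer_singleton_iff]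
  rw [proj_mem_torus hM hker] at hyT
  have hy2 := hy
  rw [Subgroup.mem_centralizer_singleton_iff, proj_commute_iff hker] at hy2
  obtain ⟨c, hc⟩ := hy2
  have hcr := hM.twist_pow_eq_one hs hc
  have hc1 : c ≠ 1 := by
    rintro rfl
    rw [Twist, one_smul] at hc
    exact hyT hc
  have hcp : IsPrimitiveRoot c r := by
    rw [← orderOf_eq_prime hcr hc1]; exact IsPrimitiveRoot.orderOf _
  obtain ⟨e, he⟩ := hM.exists_pow_eq_scalar_of_twist hx hx' hs hcr hc1 hc
  have hz : (centralizerIn (π s) (π k) ⊓ torus π s : Subgroup (Subgroup.centralizer {π s})) =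
      Subgroup.zpowers ⟨π s, hmem⟩ := by
    apply le_antisymm
    · rintro ⟨t, ht⟩ ⟨h1, h2⟩
      obtain ⟨g, rfl⟩ := hπ t
      have h1' := mem_centralizerIn.1 h1
      have h2' := (proj_mem_torus hM hker ht).1 h2
      obtain ⟨d, hd⟩ := (proj_commute_iff hker).1 h1'.symm
      have hdr : d ^ r = 1 := by
        obtain ⟨d', hd'⟩ := (proj_commute_iff hker).1 h1'
        have hd'r := hM.twist_pow_eq_one he hd'
        have h3 : d * d' = 1 := by
          rw [Twist] at hd hd'
          refine (hM.smul_map_inj (x := 1) (y := d * d') (g := k * g) ?_).symm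
          rw [one_smul, map_mul, mul_smul, ← hd']
          exact hd
        have h4 : d ^ r * d' ^ r = 1 := by rw [← mul_pow, h3, one_pow]
        rwa [hd'r, mul_one] at h4
      obtain ⟨j, -, rfl⟩ := hcp.eq_pow_of_pow_eq_one hdr
      have hcj : ∀ j : ℕ, M k * M s ^ j = c ^ j • (M s ^ j * M k) := by
        intro j
        induction j with
        | zero => simp
        | succ j ih =>
          have h3 : M k * M s = c • (M s * M k) := hc
          rw [pow_succ, ← mul_assoc, ih, smul_mul_assoc, mul_assoc, h3, mul_smul_comm, smul_smul,
            ← mul_assoc, ← pow_succ]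
      set u := g * (s ^ j)⁻¹ with hu
      have hug : M g = M u * M s ^ j := by rw [← map_pow, ← map_mul, hu, inv_mul_cancel_right]
      have hus : M u * M s = M s * M u := by
        have h3 : Commute g s := hM.injective (by rw [map_mul, map_mul, h2'])
        have h4 : Commute u s := h3.mul_left ((Commute.refl s).pow_left j).inv_left
        rw [← map_mul, h4.eq, map_mul]
      have huk : M k * M u = M u * M k := by
        refine map_mul_right_cancel (M := M) (g := s ^ j) ?_
        have h3 : M k * M g = c ^ j • (M g * M k) := hd
        rw [map_pow, mul_assoc, ← hug, h3, mul_assoc, hcj, mul_smul_comm, ← mul_assoc, ← hug]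
      obtain ⟨e', he'⟩ := hM.eq_scalar_of_commute_twist hx hx' hs hc1 hc hus huk
      refine ⟨(j : ℤ), Subtype.ext ?_⟩
      have h3 : π g = π (s ^ j) := (proj_eq_iff hker).2
        ⟨e', by rw [hug, he', smul_mul_assoc, one_mul, map_pow]⟩
      change ((⟨π s, hmem⟩ : Subgroup.centralizer {π s}) ^ (j : ℤ) : Subgroup.centralizer {π s}).1 = π g
      rw [zpow_natCast, h3, map_pow]
      rfl
    · rw [Subgroup.zpowers_le]
      refine ⟨mem_centralizerIn.2 ?_, ?_⟩
      · exact ((Subgroup.mem_centralizer_singleton_iff).1 hy).symm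
      · exact (proj_mem_torus hM hker hmem).2 rfl
  rw [hz, Nat.card_zpowers, ← Subgroup.orderOf_coe]
  exact orderOf_proj hM hker hx hx' hs

end IsScalarModel

/-! ### Numerical inequalities for the suborbit counts -/

/-- This makes the subdegree `a` occur. For `N = 0` the left side of `h` is `r^3 b`, while `b ≥ 2`
and `X ≥ r^2` make the right side larger by at least `b r (2(r-1)^2 - 1)`. -/
theorem pos_of_suborbit_count {r b X N : ℕ} (hr : 2 < r) (hb : 1 < b) (hX : r ^ 2 ≤ X)
    (h : r * (r * b + r * ((r - 1) * b) + N) =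
      (r - 1) * b * X + (r - 1) * b * (r + (r - 1) * (r * b))) : 0 < N := by
  obtain ⟨u, rfl⟩ : ∃ u, r = u + 1 := ⟨r - 1, by omega⟩
  rw [Nat.add_sub_cancel] at h
  by_contra h0
  obtain rfl : N = 0 := by omega
  have h1 : u * b * (u + 1) ^ 2 ≤ u * b * X := Nat.mul_le_mul_left _ hX
  have h2 : u * b * (u * (u + 1) * 2) ≤ u * b * (u * (u + 1) * b) := by gcongr; omega
  have h3 : 0 < b * (u + 1) * (2 * u ^ 2 - 1 : ℤ) := by
    have : (1 : ℤ) < u := by omega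
    have h4 : (0 : ℤ) < 2 * u ^ 2 - 1 := by nlinarith
    positivity
  zify at h h1 h2
  nlinarith

/-- By `h`, the number `r^2 (1 + (r-1) b + N)` falls short of the left side of `hI` by exactly `r^2
(((r-1)^2 + 1) b - 1)`. -/
theorem lt_of_suborbit_count {r b X N I : ℕ} (hr : 2 < r) (hb : 1 < b)
    (h : r * (r * b + r * ((r - 1) * b) + N) =
      (r - 1) * b * X + (r - 1) * b * (r + (r - 1) * (r * b)))
    (hI : (r - 1) * ((r - 1) * (r * b) ^ 2 + r * b * X) ≤ r ^ 2 * I) :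
    1 + (r - 1) * b + N < I := by
  obtain ⟨u, rfl⟩ : ∃ u, r = u + 1 := ⟨r - 1, by omega⟩
  rw [Nat.add_sub_cancel] at *
  by_contra h0
  have h1 : (u + 1) ^ 2 * I ≤ (u + 1) ^ 2 * (1 + u * b + N) := Nat.mul_le_mul_left _ (by omega)
  have h3 : 0 < ((u + 1 : ℤ)) ^ 2 * ((u ^ 2 + 1) * b - 1) := by
    have : (1 : ℤ) < b := by omega
    have h4 : (0 : ℤ) < (u ^ 2 + 1) * b - 1 := by nlinarith [sq_nonneg (u : ℤ)]
    positivity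
  have h5 : ((u + 1 : ℤ)) * ((u + 1) * ((u + 1) * b + (u + 1) * (u * b) + N)) =
      (u + 1) * (u * b * X + u * b * (u + 1 + u * ((u + 1) * b))) := by
    congr 1; exact_mod_cast h
  zify at hI h1
  linarith

/-! ### Suborbits of the centralizer of an irreducible element -/

namespace IsScalarModel

variable {F Γ G : Type} [Field F] [Group Γ] [Group G] {r m a : ℕ}
  {M : Γ →* Matrix (Fin r) (Fin r) F} (hM : IsScalarModel M m a)
  {π : Γ →* G} (hπ : Function.Surjective π) (hker : ∀ g, π g = 1 ↔ ∃ x : F, M g = x • 1)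
  {s : Γ} {x : F} (hx : x ^ (r * m) = 1) (hx' : x ^ m ≠ 1) (hs : M s ^ r = x • 1)
  [Finite F] [Finite Γ] [Finite G]

include hM hker

omit [Finite F] [Finite Γ] [Finite G] in
theorem mul_inv_mem_torus_iff {k k₀ : Γ} {c : F} (hk₀ : Twist M s c k₀)
    (hk : π k ∈ Subgroup.centralizer {π s}) (hk₀' : π k₀ ∈ Subgroup.centralizer {π s}) :
    (⟨π k, hk⟩ * ⟨π k₀, hk₀'⟩⁻¹ : Subgroup.centralizer {π s}) ∈ torus π s ↔ Twist M s c k := by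
  have e : (⟨π k, hk⟩ * ⟨π k₀, hk₀'⟩⁻¹ : Subgroup.centralizer {π s}) =
      ⟨π (k * k₀⁻¹), by
        rw [map_mul, map_inv]; exact Subgroup.mul_mem _ hk (Subgroup.inv_mem _ hk₀')⟩ :=
    Subtype.ext (by simp)
  rw [e, proj_mem_torus hM hker]
  have h0 : M k₀ * M s = c • (M s * M k₀) := hk₀
  set u := k * k₀⁻¹ with hu
  have hk : M k = M u * M k₀ := by rw [← map_mul, hu, inv_mul_cancel_right]
  rw [Twist, hk, mul_assoc, h0, mul_smul_comm, ← mul_assoc, ← mul_assoc]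
  have hc0 : c ≠ 0 := by
    rintro rfl
    rw [zero_smul, ← map_mul] at h0
    exact hM.map_ne_zero _ h0
  constructor
  · intro h; rw [h]
  · intro h
    exact map_mul_right_cancel (M := M) (g := k₀) (smul_right_injective _ hc0 h)

include hπ hx hx' hs

theorem natCard_conj_commute {k : Γ} :
    Nat.card {y // IsConj (π s) y ∧ π k * y = y * π k} * (r * m) =
      Nat.card {g // (∃ c, Twist M k c g) ∧ PowClass M m (x ^ m) g} := by
  rw [← natCard_proj hM hπ hker fun y => IsConj (π s) y ∧ π k * y = y * π k]
  refine Nat.card_congr (Equiv.subtypeEquivRight fun g => ?_)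
  rw [isConj_proj_iff hM hπ hker hx hx' hs, and_comm, eq_comm, proj_commute_iff hker]

/-- Counting commuting pairs of an element of a nontrivial coset of the torus and a conjugate
of `π s`. -/
theorem natCard_pairs {k₀ : Γ} {c : F} (hcr : c ^ r = 1) (hc1 : c ≠ 1) (hk₀ : Twist M s c k₀)
    (hφ : π k₀ ∈ Subgroup.centralizer {π s}) :
    r * (r * Nat.card {p : Subgroup.centralizer {π s} × G // p.1 * ⟨π k₀, hφ⟩⁻¹ ∈ torus π s ∧
      IsConj (π s) p.2 ∧ (p.1 : G) * p.2 = p.2 * p.1}) =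
      a * ((r - 1) * (r * m) ^ (r - 1)) + (r - 1) * a * (r + (r - 1) * a) := by
  classical
  have := hM.neZero
  have hr0 := hM.prime.pos
  have hrm : 0 < r * m := Nat.mul_pos hr0 hM.m_pos
  have hω : (x ^ m) ^ r = 1 := by rw [← pow_mul, mul_comm, hx]
  set Cos : G → Prop := fun y => ∃ k, π k = y ∧ Twist M s c k with hCos
  have hCosπ : ∀ k, Cos (π k) ↔ Twist M s c k := by
    refine fun k => ⟨?_, fun h => ⟨k, rfl, h⟩⟩
    rintro ⟨k', hk', h⟩
    obtain ⟨e, he⟩ := (proj_eq_iff hker).1 hk'.symm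
    rw [Twist] at h ⊢
    rw [he, smul_mul_assoc, h, mul_smul_comm, smul_comm]
  have hCosH : ∀ k, Twist M s c k → π k ∈ Subgroup.centralizer {π s} := fun k hk => by
    rw [Subgroup.mem_centralizer_singleton_iff, proj_commute_iff hker]; exact ⟨c, hk⟩
  have hCosH' : ∀ y, Cos y → y ∈ Subgroup.centralizer {π s} := by
    rintro _ ⟨k, rfl, hk⟩; exact hCosH k hk
  have hCosT : ∀ y (hy : y ∈ Subgroup.centralizer {π s}),
      (⟨y, hy⟩ * ⟨π k₀, hφ⟩⁻¹ : Subgroup.centralizer {π s}) ∈ torus π s ↔ Cos y := by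
    intro y hy
    obtain ⟨k, rfl⟩ := hπ y
    rw [hCosπ, mul_inv_mem_torus_iff hM hker hk₀]
  set C1 : G → Prop := fun y => ∃ k, π k = y ∧ PowClass M m 1 k with hC1
  have hC1π : ∀ k, C1 (π k) ↔ PowClass M m 1 k := by
    refine fun k => ⟨?_, fun h => ⟨k, rfl, h⟩⟩
    rintro ⟨k', hk', h⟩
    exact (powClass_proj hM hker hk').1 h
  have e : {p : Subgroup.centralizer {π s} × G // p.1 * ⟨π k₀, hφ⟩⁻¹ ∈ torus π s ∧
      IsConj (π s) p.2 ∧ (p.1 : G) * p.2 = p.2 * p.1} ≃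
      Σ y : {y : G // Cos y}, {y' // IsConj (π s) y' ∧ y.1 * y' = y' * y.1} :=
    { toFun := fun p => ⟨⟨p.1.1, (hCosT _ p.1.1.2).1 p.2.1⟩, ⟨p.1.2, p.2.2⟩⟩
      invFun := fun p => ⟨(⟨p.1.1, hCosH' _ p.1.2⟩, p.2.1), (hCosT _ _).2 p.1.2, p.2.2⟩
      left_inv := fun _ => rfl
      right_inv := fun _ => rfl }
  -- If `k` is of class `1` it is split, with `s` permuting its eigenspaces; otherwise `k` is itself
  -- irreducible. The two counts of commuting conjugates apply accordingly.
  have hN : ∀ y : {y : G // Cos y},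
      r * Nat.card {y' // IsConj (π s) y' ∧ y.1 * y' = y' * y.1} =
      if C1 y.1 then (r - 1) * (r * m) ^ (r - 1) else r + (r - 1) * a := by
    rintro ⟨y, hy⟩
    obtain ⟨k, rfl⟩ := hπ y
    rw [hCosπ] at hy
    dsimp only
    refine Nat.eq_of_mul_eq_mul_right hrm ?_
    rw [mul_assoc, natCard_conj_commute hM hπ hker hx hx' hs, hC1π]
    obtain ⟨e, he⟩ := hM.exists_pow_eq_scalar_of_twist hx hx' hs hcr hc1 hy
    have he1 := hM.scalar_pow_of_pow he
    have hiff : PowClass M m 1 k ↔ e ^ m = 1 := by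
      constructor
      · rintro ⟨e', he', h⟩
        rw [he] at he'
        rw [smul_one_inj he', h]
      · exact fun h => ⟨e, he, h⟩
    by_cases h1 : e ^ m = 1
    · rw [if_pos (hiff.2 h1)]
      have hsk : Twist M k c⁻¹ s := by
        rw [Twist] at hy ⊢
        rw [hy, smul_smul, inv_mul_cancel₀, one_smul]
        rintro rfl
        rw [zero_pow hM.prime.ne_zero] at hcr
        exact zero_ne_one hcr
      rw [hM.card_commute_split he h1 (c := c⁻¹) (by rw [inv_pow, hcr, inv_one])
        (by rwa [Ne, inv_eq_one]) hsk hω hx', mul_assoc, ← pow_succ, Nat.sub_add_cancel hr0]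
    · rw [if_neg fun h => h1 (hiff.1 h), hM.card_commute_irreducible he1 h1 he hω]
      ring
  have hcCos : Nat.card {y // Cos y} = a := by
    refine Nat.eq_of_mul_eq_mul_right hrm ?_
    rw [← natCard_proj hM hπ hker Cos, ← hM.card_commutant s x hx hx' hs,
      ← card_twist (M := M) (s := s) (c := c) ⟨k₀, hk₀⟩]
    exact Nat.card_congr (Equiv.subtypeEquivRight fun k => hCosπ k)
  -- By equidistribution of `r`-th powers on the coset, one `r`-th of its elements are of class `1`.
  have hcC1 : r * Nat.card {y // Cos y ∧ C1 y} = a := by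
    refine Nat.eq_of_mul_eq_mul_right hrm ?_
    rw [mul_assoc, ← natCard_proj hM hπ hker fun y => Cos y ∧ C1 y,
      ← hM.card_commutant s x hx hx' hs, ← card_twist (M := M) (s := s) (c := c) ⟨k₀, hk₀⟩,
      ← hM.card_twist_powClass (u := s) (d := x) (w := 1) rfl
        (fun y => hM.exists_pow_eq_scalar_of_twist hx hx' hs hcr hc1)
        (fun y => hM.mul_pow_of_twist hs hcr) hx' hx (one_pow r)]
    congr 1
    exact Nat.card_congr (Equiv.subtypeEquivRight fun k => by rw [hCosπ, hC1π])
  have hsplit := natCard_subtype_eq_add Cos C1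
  have hcnC1 : r * Nat.card {y // Cos y ∧ ¬ C1 y} = (r - 1) * a := by
    rw [hcCos] at hsplit
    have h2 : r * a = a + r * Nat.card {y // Cos y ∧ ¬ C1 y} := by
      conv_lhs => rw [hsplit]
      rw [mul_add, hcC1]
    rw [Nat.sub_mul, one_mul, h2]
    omega
  have := Fintype.ofFinite {y // Cos y}
  have hcf : ∀ (P : G → Prop) [DecidablePred P],
      (Finset.univ.filter fun y : {y : G // Cos y} => P y.1).card =
      Nat.card {y : G // Cos y ∧ P y} := by
    intro P _
    rw [← Fintype.card_subtype, ← Nat.card_eq_fintype_card]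
    exact Nat.card_congr (Equiv.subtypeSubtypeEquivSubtypeInter _ _)
  rw [Nat.card_congr e, Nat.card_sigma, Finset.mul_sum, Finset.sum_congr rfl fun y _ => hN y,
    Finset.sum_ite, Finset.sum_const, Finset.sum_const, hcf C1, hcf fun y => ¬ C1 y, smul_eq_mul,
    smul_eq_mul, mul_add, ← mul_assoc r, hcC1, ← mul_assoc r, hcnC1]

omit hker in
/-- The suborbits of the centralizer of an irreducible element of order `r` modulo scalars. -/
theorem subdegrees_centralizer (hker : ∀ g, π g = 1 ↔ ∃ x : F, M g = x • 1) {b : ℕ}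
    (hab : a = r * b) (hb : 1 < b) : ∃ N : ℕ,
    r * (r * b + r * ((r - 1) * b) + N) =
      (r - 1) * b * (r * m) ^ (r - 1) + (r - 1) * b * (r + (r - 1) * (r * b)) ∧
    subdegrees (Subgroup.centralizer {π s}) =
      {1, Nat.card (Subgroup.centralizer {π s}), r * b, b} ∧
    subdegreeMult (Subgroup.centralizer {π s}) 1 = 1 ∧
    subdegreeMult (Subgroup.centralizer {π s}) b = r - 1 ∧
    subdegreeMult (Subgroup.centralizer {π s}) (r * b) * (r * b) = N ∧
    subdegreeMult (Subgroup.centralizer {π s}) (r * b * r) * (r * b * r) =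
      saxlVal (Subgroup.centralizer {π s}) ∧
    saxlVal (Subgroup.centralizer {π s}) + (1 + (r - 1) * b + N) =
      (Subgroup.centralizer {π s}).index := by
  have := hM.neZero
  have hr := hM.prime
  have hr0 := hr.pos
  have hr2 : 2 < r := by
    have h1 := hr.two_le
    rcases h1.lt_or_eq with h | h
    · exact h
    · have := hM.odd; rw [← h] at this; exact absurd this (by decide)
  have hrm : 0 < r * m := Nat.mul_pos hr0 hM.m_pos
  have hω : (x ^ m) ^ r = 1 := by rw [← pow_mul, mul_comm, hx]
  obtain ⟨ζ, hζ⟩ := hM.exists_primitive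
  have hζ1 : ζ ≠ 1 := hζ.ne_one hr.one_lt
  obtain ⟨k₀, hk₀⟩ := hM.exists_twist hx hx' hs hζ.pow_eq_one
  have hk₀H : π k₀ ∈ Subgroup.centralizer {π s} := by
    rw [Subgroup.mem_centralizer_singleton_iff, proj_commute_iff hker]; exact ⟨ζ, hk₀⟩
  have hk₀T : ⟨π k₀, hk₀H⟩ ∉ torus π s := by
    rw [proj_mem_torus hM hker]
    intro h
    refine hζ1 (hM.twist_unique hk₀ ?_)
    rw [Twist, one_smul, h]
  have hnorm : (torus π s).Normal := torus_normal hM hπ hker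
  have hindex := index_torus hM hπ hker hx hx' hs
  have hA := fun y (hy : y ∉ Subgroup.centralizer {π s}) =>
    centralizerIn_inf_torus_eq_bot hM hπ hker hx hx' hs hy
  have hB : ∀ y, IsConj (π s) y → ∀ hy : y ∈ Subgroup.centralizer {π s}, y ≠ π s →
      ⟨y, hy⟩ ∉ torus π s := fun y hy hyH hne hyT =>
    hne (eq_of_mem_torus hM hπ hker hx hx' hs hy hyH hyT)
  have hB' := fun y (hy : IsConj (π s) y) (hyH : y ∈ Subgroup.centralizer {π s}) (hne : y ≠ π s) =>
    natCard_centralizerIn_inf_torus hM hπ hker hx hx' hs hyH (hB y hy hyH hne)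
  have hpairs := natCard_pairs hM hπ hker hx hx' hs hζ.pow_eq_one hζ1 hk₀ hk₀H
  rw [natCard_commuting_pairs hr hindex (fun y _ => hA y) hB hB' hk₀T,
    natCard_torus hM hπ hker hx hx' hs] at hpairs
  have h3 : Nat.card {y : G // IsConj (π s) y ∧ y ∈ Subgroup.centralizer {π s} ∧ y ≠ π s} =
      (r - 1) * b := by
    -- The conjugates of `π s` inside its centralizer are given by the irreducible count, applied to
    -- `s` itself.
    have h1 : Nat.card {y // IsConj (π s) y ∧ π s * y = y * π s} = 1 + (r - 1) * b := by
      refine Nat.eq_of_mul_eq_mul_left hr0 (Nat.eq_of_mul_eq_mul_right hrm ?_)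
      rw [mul_assoc, natCard_conj_commute hM hπ hker hx hx' hs,
        hM.card_commute_irreducible hx hx' hs hω, hab]
      ring
    rw [natCard_subtype_eq_add _ fun y => y = π s] at h1
    have h2 : Nat.card {y // (IsConj (π s) y ∧ π s * y = y * π s) ∧ y = π s} = 1 := by
      rw [Nat.card_eq_one_iff_unique]
      exact ⟨⟨fun u v => Subtype.ext (u.2.2.trans v.2.2.symm)⟩, ⟨⟨π s, ⟨IsConj.refl _, rfl⟩, rfl⟩⟩⟩
    rw [h2] at h1
    rw [← Nat.add_left_cancel h1]
    refine Nat.card_congr (Equiv.subtypeEquivRight fun y => ?_)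
    rw [and_assoc, Subgroup.mem_centralizer_singleton_iff, eq_comm (a := y * π s)]
  rw [h3] at hpairs
  set N := Nat.card {y : G // IsConj (π s) y ∧ y ∉ Subgroup.centralizer {π s} ∧
    Nat.card (Subgroup.centralizer {π s} ⊓ Subgroup.centralizer {y} : Subgroup G) = r} with hN
  have hNeq : r * (r * b + r * ((r - 1) * b) + N) =
      (r - 1) * b * (r * m) ^ (r - 1) + (r - 1) * b * (r + (r - 1) * (r * b)) := by
    refine Nat.eq_of_mul_eq_mul_left hr0 ?_
    rw [← hab, hpairs, hab]
    ring
  have hcardH := natCard_centralizer_proj hM hπ hker hx hx' hs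
  have hΓ : Nat.card Γ = (Subgroup.centralizer {π s}).index * (a * r) * (r * m) := by
    rw [← hcardH, Subgroup.index_mul_card]
    have := natCard_proj hM hπ hker fun _ => True
    rw [Nat.card_congr (Equiv.subtypeUnivEquiv fun _ => trivial),
      Nat.card_congr (Equiv.subtypeUnivEquiv fun _ => trivial)] at this
    exact this
  have hnr : r ≤ r * m := Nat.le_mul_of_pos_right r hM.m_pos
  have hpow : r ^ 2 ≤ (r * m) ^ (r - 1) :=
    (Nat.pow_le_pow_left hnr 2).trans (Nat.pow_le_pow_right hrm (by omega))
  have hge := hM.card_ge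
  rw [hΓ, hab] at hge
  have hge' : (r - 1) * ((r - 1) * (r * b) ^ 2 + r * b * (r * m) ^ (r - 1)) ≤
      r ^ 2 * (Subgroup.centralizer {π s}).index := by
    refine Nat.le_of_mul_le_mul_left ?_ (Nat.mul_pos (Nat.mul_pos hr0 (by omega : 0 < b)) hrm)
    refine le_trans (le_of_eq ?_) (hge.trans (le_of_eq ?_)) <;> ring
  have hNpos := pos_of_suborbit_count hr2 hb hpow hNeq
  have hlt := lt_of_suborbit_count hr2 hb hNeq hge'
  refine ⟨N, hNeq, subdegrees_of_centralizer_counts (π s) hr2 hb hNpos (by rw [hcardH, hab]) ?_ ?_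
    h3 rfl hlt⟩
  · intro y hy hyH hne
    exact natCard_centralizer_inf_of_mem hr hindex hyH (hB y hy hyH hne) (hB' y hy hyH hne)
  · intro y _ hyH
    exact natCard_centralizer_inf_of_notMem hr hindex (hA y hyH)

end IsScalarModel

/-! ### Maximal subgroups of shape `ℤ_a : ℤ_r` are centralizers -/

theorem IsCyclic.mem_zpowers_of_pow_eq_one {N : Type*} [Group N] [Finite N] [IsCyclic N] {r : ℕ}
    (hr : 0 < r) {n n' : N} (hn : orderOf n = r) (hn' : n' ^ r = 1) : n' ∈ Subgroup.zpowers n := by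
  classical
  have := Fintype.ofFinite N
  have h1 : (Finset.univ.filter fun y : N => y ∈ Subgroup.zpowers n) ⊆
      Finset.univ.filter fun y : N => y ^ r = 1 := by
    intro y hy
    rw [Finset.mem_filter] at hy ⊢
    obtain ⟨k, hk⟩ := hy.2
    refine ⟨Finset.mem_univ _, ?_⟩
    have hk' : n ^ k = y := hk
    rw [← hk', ← zpow_natCast, ← zpow_mul, mul_comm, zpow_mul, zpow_natCast, ← hn, pow_orderOf_eq_one,
      one_zpow]
  have h2 : (Finset.univ.filter fun y : N => y ∈ Subgroup.zpowers n).card = r := by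
    rw [← Fintype.card_subtype, ← Nat.card_eq_fintype_card]
    exact (Nat.card_zpowers n).trans hn
  have h3 := Finset.eq_of_subset_of_card_le h1 (by rw [h2]; exact IsCyclic.card_pow_eq_one_le hr)
  have h4 : n' ∈ Finset.univ.filter fun y : N => y ^ r = 1 := by simp [hn']
  rw [← h3] at h4
  exact (Finset.mem_filter.1 h4).2

theorem IsCyclicByCyclic.natCard {H : Type} [Group H] {a r : ℕ} (h : IsCyclicByCyclic H a r) :
    Nat.card H = a * r := by
  obtain ⟨φ, ⟨e⟩⟩ := h
  rw [Nat.card_congr e.toEquiv, SemidirectProduct.card, Nat.card_congr Multiplicative.toAdd,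
    Nat.card_congr Multiplicative.toAdd, Nat.card_zmod, Nat.card_zmod]

/-- A group of shape `ℤ_a : ℤ_r` with `r ∣ a` has a normal subgroup of order `r` in its cyclic
normal subgroup. -/
theorem IsCyclicByCyclic.exists_normal {H : Type} [Group H] {b r : ℕ} (hb : 0 < b) (hr : 0 < r)
    (h : IsCyclicByCyclic H (r * b) r) :
    ∃ z : H, orderOf z = r ∧ ∀ y, y * z * y⁻¹ ∈ Subgroup.zpowers z := by
  obtain ⟨φ, ⟨e⟩⟩ := h
  have : NeZero (r * b) := ⟨(Nat.mul_pos hr hb).ne'⟩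
  have h1 : orderOf (Multiplicative.ofAdd (1 : ZMod (r * b))) = r * b := by
    rw [orderOf_ofAdd_eq_addOrderOf, ZMod.addOrderOf_one]
  set n := Multiplicative.ofAdd (1 : ZMod (r * b)) ^ b with hn
  have hn1 : orderOf n = r := by
    rw [hn, orderOf_pow_of_dvd hb.ne' (by rw [h1]; exact Dvd.intro_left r rfl), h1,
      Nat.mul_div_cancel _ hb]
  refine ⟨e.symm (SemidirectProduct.inl n), ?_, ?_⟩
  · rw [e.symm.orderOf_eq, orderOf_injective _ SemidirectProduct.inl_injective, hn1]
  · intro y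
    obtain ⟨p, rfl⟩ := e.symm.surjective y
    have h2 : p * SemidirectProduct.inl n * p⁻¹ ∈
        (SemidirectProduct.inl : _ →* Multiplicative (ZMod (r * b)) ⋊[φ]
          Multiplicative (ZMod r)).range := by
      rw [SemidirectProduct.range_inl_eq_ker_rightHom, MonoidHom.mem_ker]
      simp
    obtain ⟨n', hn'⟩ := h2
    have h3 : n' ^ r = 1 := by
      apply SemidirectProduct.inl_injective (φ := φ)
      have hnr : n ^ r = 1 := orderOf_dvd_iff_pow_eq_one.1 (by rw [hn1])
      rw [map_pow, hn', conj_pow, ← map_pow, hnr, map_one, mul_one, mul_inv_cancel]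
    obtain ⟨k, hk⟩ := IsCyclic.mem_zpowers_of_pow_eq_one hr hn1 h3
    refine ⟨k, ?_⟩
    have hk' : n ^ k = n' := hk
    change e.symm _ ^ k = _
    rw [← map_inv, ← map_mul, ← map_mul, ← hn', ← map_zpow, ← map_zpow, hk']

namespace IsScalarModel

variable {F Γ G : Type} [Field F] [Group Γ] [Group G] {r m a : ℕ}
  {M : Γ →* Matrix (Fin r) (Fin r) F} (hM : IsScalarModel M m a)
  {π : Γ →* G} (hπ : Function.Surjective π) (hker : ∀ g, π g = 1 ↔ ∃ x : F, M g = x • 1)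

include hM hker

theorem two_dvd_natCard_of_perm [Finite G] {N : Subgroup G} {e : Equiv.Perm (Fin r)} (he : e ≠ 1)
    (hee : e * e = 1) {p g : Γ} (hp : M p = e.permMatrix F) (hN : π (g * p * g⁻¹) ∈ N) :
    2 ∣ Nat.card N := by
  have hpp : p * p = 1 := by
    apply hM.injective
    rw [map_mul, hp, ← Matrix.permMatrix_mul, hee, map_one, Matrix.permMatrix_one]
  have hp1 : π p ≠ 1 := by
    rw [Ne, hker]
    rintro ⟨x, hx⟩
    obtain ⟨i, hi⟩ : ∃ i, e i ≠ i := by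
      by_contra h
      push Not at h
      exact he (Equiv.ext h)
    rw [hp] at hx
    have h1 := congrFun (congrFun hx i) (e i)
    rw [Equiv.Perm.permMatrix, PEquiv.toMatrix_apply, Matrix.smul_apply,
      Matrix.one_apply_ne hi.symm, smul_zero] at h1
    simp at h1
  have h2 : orderOf (⟨π (g * p * g⁻¹), hN⟩ : N) = 2 := by
    have : Fact (Nat.Prime 2) := ⟨Nat.prime_two⟩
    refine orderOf_eq_prime (Subtype.ext ?_) fun h => hp1 ?_
    · change π (g * p * g⁻¹) ^ 2 = 1
      rw [← map_pow, conj_pow, pow_two, hpp, mul_one, mul_inv_cancel, map_one]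
    · have h3 : π (g * p * g⁻¹) = 1 := congrArg Subtype.val h
      rw [map_mul, map_mul, map_inv] at h3
      exact conj_eq_one_iff.1 h3
  rw [← h2]
  exact orderOf_dvd_natCard _

-- If the entries `d i` are distinct, they are all the `r`-th roots of unity, and the permutation
-- inverting them conjugates `s` to its inverse; if two agree, the transposition of these
-- coordinates commutes with `s`.
omit hker in
theorem exists_perm_involution_normalizing [Finite F] {s : Γ} {d : Fin r → F}
    (hs : M s = Matrix.diagonal d) (hdr : ∀ i, d i ^ r = 1) :
    ∃ (e : Equiv.Perm (Fin r)) (p : Γ), e ≠ 1 ∧ e * e = 1 ∧ M p = e.permMatrix F ∧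
      p * s * p⁻¹ ∈ Subgroup.zpowers s := by
  have := hM.neZero
  have hr1 := hM.prime.one_lt
  have key : ∀ (e : Equiv.Perm (Fin r)) (p : Γ), M p = e.permMatrix F →
      M (p * s) = Matrix.diagonal (fun i => d (e i)) * M p := fun e p hp => by
    rw [map_mul, hp, hs, permMatrix_mul_diagonal]
  by_cases hd : Function.Injective d
  · obtain ⟨ζ, hζ⟩ := hM.exists_primitive
    obtain ⟨σ, hσ⟩ := hζ.exists_perm_pow_eq hd hdr
    obtain ⟨τ, hτ⟩ := hζ.exists_perm_pow_eq (d := fun i => (d i)⁻¹)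
      (fun i j h => hd (inv_injective h)) (fun i => by rw [inv_pow, hdr, inv_one])
    have hde : ∀ i, d ((σ.symm * τ) i) = (d i)⁻¹ := by
      intro i
      rw [← hσ, Equiv.Perm.mul_apply, Equiv.apply_symm_apply, hτ]
    obtain ⟨p, hp⟩ := hM.perm_mem (σ.symm * τ)
    refine ⟨σ.symm * τ, p, ?_, ?_, hp, ?_⟩
    · intro h1
      have h2 : ∀ i, d i = 1 := by
        intro i
        have h3 := hde i
        rw [h1, Equiv.Perm.one_apply] at h3
        have h0 : d i ≠ 0 := by
          intro h0
          have := hdr i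
          rw [h0, zero_pow hM.prime.ne_zero] at this
          exact zero_ne_one this
        have h4 : d i ^ 2 = 1 := by
          nth_rewrite 1 [pow_two, h3]
          exact inv_mul_cancel₀ h0
        obtain ⟨k, hk⟩ := hM.odd
        have h5 := hdr i
        rw [hk, pow_succ, pow_mul, h4, one_pow, one_mul] at h5
        exact h5
      have h6 : (⟨0, by omega⟩ : Fin r) = ⟨1, hr1⟩ := hd (by rw [h2, h2])
      simp at h6
    · ext i
      rw [Equiv.Perm.mul_apply, Equiv.Perm.one_apply]
      congr 1
      apply hd
      rw [hde, hde, inv_inv]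
    · have h1 : p * s * p⁻¹ = s⁻¹ := by
        rw [mul_inv_eq_iff_eq_mul]
        apply hM.injective
        rw [key _ p hp, map_mul]
        congr 1
        refine map_mul_right_cancel (M := M) (g := s) ?_
        rw [map_inv_mul_map, hs, Matrix.diagonal_mul_diagonal, ← Matrix.diagonal_one]
        congr 1
        funext i
        rw [hde, inv_mul_cancel₀]
        intro h0
        have := hdr i
        rw [h0, zero_pow hM.prime.ne_zero] at this
        exact zero_ne_one this
      rw [h1]
      exact Subgroup.inv_mem _ (Subgroup.mem_zpowers s)
  · rw [Function.Injective] at hd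
    push Not at hd
    obtain ⟨i, j, hij, hne⟩ := hd
    obtain ⟨p, hp⟩ := hM.perm_mem (Equiv.swap i j)
    refine ⟨Equiv.swap i j, p, ?_, Equiv.swap_mul_self i j, hp, ?_⟩
    · intro h
      have h1 := Equiv.swap_apply_left i j
      rw [h] at h1
      exact hne h1
    · have h1 : p * s * p⁻¹ = s := by
        rw [mul_inv_eq_iff_eq_mul]
        apply hM.injective
        rw [key _ p hp, map_mul, hs]
        congr 2
        funext l
        rw [Equiv.swap_apply_def]
        split_ifs with h h'
        · rw [h, hij]
        · rw [h', hij]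
        · rfl
      rw [h1]
      exact Subgroup.mem_zpowers s

include hπ

/-- A maximal subgroup of shape `ℤ_a : ℤ_r` is the centralizer of an irreducible element. -/
theorem exists_eq_centralizer [Finite F] [Finite Γ] [Finite G] {b : ℕ} (hb : 0 < b)
    (hab : a = r * b) (hodd : Odd a) {H : Subgroup G} (hmax : IsCoatom H)
    (hH : IsCyclicByCyclic H a r) : ∃ (s : Γ) (x : F), x ^ (r * m) = 1 ∧ x ^ m ≠ 1 ∧
      M s ^ r = x • 1 ∧ H = Subgroup.centralizer {π s} := by
  have := hM.neZero
  have hr := hM.prime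
  have hcard := hH.natCard
  have hH' := hH
  rw [hab] at hH'
  obtain ⟨z, hz, hznorm⟩ := hH'.exists_normal hb hr.pos
  obtain ⟨s, hs⟩ := hπ z
  have hzr : orderOf (π s) = r := by rw [hs, Subgroup.orderOf_coe, hz]
  have hnorm : ∀ y ∈ H, y * π s * y⁻¹ ∈ Subgroup.zpowers (π s) := by
    intro y hy
    obtain ⟨k, hk⟩ := hznorm ⟨y, hy⟩
    refine ⟨k, ?_⟩
    rw [hs]
    exact congrArg Subtype.val hk
  have h1 : π (s ^ r) = 1 := by rw [map_pow, ← hzr, pow_orderOf_eq_one]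
  obtain ⟨x, hx⟩ := (hker _).1 h1
  rw [map_pow] at hx
  have hx1 := hM.scalar_pow_of_pow hx
  have hx0 := hM.ne_zero_of_pow hx1
  by_cases hxm : x ^ m = 1
  -- If `x^m = 1`, a scalar multiple of `s` is diagonalizable. The normalizer of `⟨π s⟩` contains
  -- `H`, so it is `G` or `H`. It is not `G`, as the diagonal `t` has a nondiagonal conjugate; it is
  -- not `H`, as it contains an involution while `|H| = a r` is odd.
  · exfalso
    obtain ⟨μ, hμ, hμ1⟩ := hM.exists_pow_eq hxm
    have hμ0 := hM.ne_zero_of_pow hμ1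
    obtain ⟨k, hk⟩ := hM.scalar_mem (x := μ⁻¹) (by rw [inv_pow, hμ1, inv_one])
    have hks : M (k * s) = μ⁻¹ • M s := by rw [map_mul, hk, smul_mul_assoc, one_mul]
    have hksr : M (k * s) ^ r = 1 := by
      rw [hks, smul_pow, hx, smul_smul, inv_pow, hμ, inv_mul_cancel₀ hx0, one_smul]
    have hπk : π (k * s) = π s := (proj_eq_iff hker).2 ⟨_, hks⟩
    obtain ⟨g, d, hd⟩ := hM.diagonalizable (k * s) hksr
    have hdr : ∀ i, d i ^ r = 1 := by
      have h1 : M (g * (k * s) * g⁻¹) ^ r = 1 := by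
        rw [← map_pow] at hksr ⊢
        rw [conj_pow, map_mul, map_mul, hksr, mul_one, map_mul_map_inv]
      rw [hd, Matrix.diagonal_pow, ← Matrix.diagonal_one] at h1
      exact fun i => congrFun (Matrix.diagonal_injective h1) i
    set t := g * (k * s) * g⁻¹ with ht
    have hst : π s = (π g)⁻¹ * π t * π g := by
      rw [ht, map_mul, map_mul, hπk, map_inv]; group
    set N := Subgroup.normalizer (Subgroup.zpowers (π s) : Set G) with hN
    have hmemN : ∀ y, y * π s * y⁻¹ ∈ Subgroup.zpowers (π s) → y ∈ N := by
      intro y hy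
      rw [hN, Subgroup.mem_normalizer_iff_map_conj_eq]
      have h2 : (Subgroup.zpowers (π s)).map (MulAut.conj y).toMonoidHom ≤
          Subgroup.zpowers (π s) := by
        rw [MonoidHom.map_zpowers, Subgroup.zpowers_le]
        exact hy
      exact Subgroup.eq_of_le_of_card_ge h2 (by
        rw [Subgroup.card_map_of_injective (MulAut.conj y).injective])
    have hHN : H ≤ N := fun y hy => hmemN y (hnorm y hy)
    rcases hmax.le_iff.1 hHN with hN1 | hN1
    · have hnsc : ∀ c : F, M t ≠ c • 1 := by
        intro c hc
        have h2 : π t = 1 := (hker t).2 ⟨c, hc⟩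
        rw [hst, h2, mul_one, inv_mul_cancel, orderOf_one] at hzr
        exact hr.one_lt.ne hzr
      obtain ⟨h, hh⟩ := hM.exists_not_diag t d hd hnsc
      have h2 : π (g⁻¹ * h * g) ∈ N := by rw [hN1]; trivial
      rw [hN, Subgroup.mem_normalizer_iff] at h2
      obtain ⟨j, hj⟩ := (h2 (π s)).1 (Subgroup.mem_zpowers _)
      have hj' : π s ^ j = π (g⁻¹ * h * g) * π s * (π (g⁻¹ * h * g))⁻¹ := hj
      have h3 : π (h * t * h⁻¹) = π (t ^ j) := by
        have h4 : π (t ^ j) = π g * π s ^ j * (π g)⁻¹ := by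
          rw [← conj_zpow, hst, map_zpow]; group
        rw [h4, hj', hst]
        simp only [map_mul, map_inv]
        group
      obtain ⟨c, hc⟩ := (proj_eq_iff hker).1 h3
      have h5 : ∃ d', M (t ^ j) = Matrix.diagonal d' := by
        have hpow : ∀ n : ℕ, M (t ^ n) = Matrix.diagonal (d ^ n) := fun n => by
          rw [map_pow, hd, Matrix.diagonal_pow]
        obtain ⟨n, hn⟩ : ∃ n : ℕ, t ^ n = t ^ j :=
          (mem_powers_iff_mem_zpowers (x := t) (y := t ^ j)).2 ⟨j, rfl⟩
        exact ⟨_, by rw [← hn, hpow]⟩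
      obtain ⟨d', hd'⟩ := h5
      exact hh (c • d') (by rw [hc, hd', Matrix.diagonal_smul])
    · obtain ⟨e, p, he, hee, hp, hps⟩ := exists_perm_involution_normalizing hM hd hdr
      have h2 : π (g⁻¹ * p * g⁻¹⁻¹) ∈ H := by
        rw [← hN1]
        apply hmemN
        obtain ⟨j, hj⟩ := hps
        have hj' : t ^ j = p * t * p⁻¹ := hj
        refine ⟨j, ?_⟩
        change π s ^ j = _
        have h4 : π s ^ j = (π g)⁻¹ * π (t ^ j) * π g := by
          rw [map_zpow, hst]
          have := conj_zpow (i := j) (a := (π g)⁻¹) (b := π t)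
          rw [inv_inv] at this
          exact this
        rw [h4, hj', hst]
        simp only [map_mul, map_inv]
        group
      have h3 := two_dvd_natCard_of_perm hM hker he hee hp h2
      rw [hcard] at h3
      exact (Nat.not_even_iff_odd.2 (hodd.mul hM.odd)) (even_iff_two_dvd.2 h3)
  -- Normalizing `⟨π s⟩` already means centralizing it: from `k s k⁻¹ = e s^j`, taking `r`-th and
  -- then `m`-th powers gives `x^m = (x^m)^j`, so `j ≡ 1` modulo `r`. Equality of orders then gives
  -- `H = C_G(π s)`.
  · refine ⟨s, x, hx1, hxm, hx, ?_⟩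
    refine Subgroup.eq_of_le_of_card_ge ?_ ?_
    · intro y hy
      rw [Subgroup.mem_centralizer_singleton_iff]
      obtain ⟨k, rfl⟩ := hπ y
      obtain ⟨j, hj⟩ := (mem_powers_iff_mem_zpowers).2 (hnorm _ hy)
      have hj' : π s ^ j = π k * π s * (π k)⁻¹ := hj
      have h2 : π (k * s * k⁻¹) = π (s ^ j) := by
        rw [map_pow, hj', map_mul, map_mul, map_inv]
      obtain ⟨e, he⟩ := (proj_eq_iff hker).1 h2
      have hp : Fact r.Prime := ⟨hr⟩
      have h3 : M (k * s * k⁻¹) ^ r = x • 1 := by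
        rw [← map_pow] at hx ⊢
        rw [conj_pow, map_mul, map_mul, hx, mul_smul_comm, mul_one, smul_mul_assoc, map_mul_map_inv]
      rw [he, smul_pow, map_pow, ← pow_mul, mul_comm j, pow_mul, hx, smul_pow, one_pow,
        smul_smul] at h3
      have h4 := congrArg (· ^ m) (smul_one_inj h3)
      rw [mul_pow, ← pow_mul, hM.smul_map_pow he, one_mul, ← pow_mul, mul_comm j, pow_mul] at h4
      have h5 : orderOf (x ^ m) = r :=
        orderOf_eq_prime (by rw [← pow_mul, mul_comm, hx1]) hxm
      have h6 : (x ^ m) ^ j = (x ^ m) ^ 1 := by rw [h4, pow_one]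
      rw [(isOfFinOrder_iff_pow_eq_one.2 ⟨r, hr.pos, by rw [← pow_mul, mul_comm, hx1]⟩).pow_eq_pow_iff_modEq,
        h5, ← hzr, ← pow_eq_pow_iff_modEq, pow_one] at h6
      rw [h6] at hj'
      exact (eq_mul_inv_iff_mul_eq.1 hj').symm
    · rw [natCard_centralizer_proj hM hπ hker hx1 hxm hx, hcard]

/-- If `a = r`, then `|H| = r^2`. The centralizer of the image of `diag(1, ζ, …, ζ^(r-1))` has order
`r (r m)^(r-1)`, so `r^3` divides `|G|`, and a Sylow `r`-subgroup containing `H` is larger, hence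
all of `G`. But `G` contains the image of a transposition, of order `2`. -/
theorem one_lt_of_isCoatom [Finite F] [Finite Γ] [Finite G] {b : ℕ} (hb : 0 < b)
    (hab : a = r * b) {H : Subgroup G} (hmax : IsCoatom H)
    (hH : IsCyclicByCyclic H a r) : 1 < b := by
  by_contra hb1
  obtain rfl : b = 1 := by omega
  rw [mul_one] at hab
  have := hM.neZero
  have hr := hM.prime
  have hp : Fact r.Prime := ⟨hr⟩
  have hr2 : 2 < r := by
    have h1 := hr.two_le
    rcases h1.lt_or_eq with h | h
    · exact h
    · have := hM.odd; rw [← h] at this; exact absurd this (by decide)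
  have hrm : 0 < r * m := Nat.mul_pos hr.pos hM.m_pos
  have hcard := hH.natCard
  rw [hab] at hcard
  obtain ⟨ζ, hζ⟩ := hM.exists_primitive
  obtain ⟨s, hs⟩ := hM.diag_mem (fun i : Fin r => ζ ^ (i : ℕ)) fun i => by
    rw [← pow_mul, mul_comm, mul_assoc, pow_mul, hζ.pow_eq_one, one_pow]
  have hsr : M s ^ r = (1 : F) • 1 := by
    rw [hs, Matrix.diagonal_pow, one_smul, ← Matrix.diagonal_one]
    congr 1
    funext i
    rw [Pi.pow_apply, ← pow_mul, mul_comm, pow_mul, hζ.pow_eq_one, one_pow]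
  have h1 := natCard_proj hM hπ hker fun y => y ∈ Subgroup.centralizer {π s}
  have h2 := natCard_subtype_eq_sum (F := F) hr.pos (fun c y => Twist M s c y)
    fun y c d => hM.twist_unique
  have h3 : Nat.card {g // π g ∈ Subgroup.centralizer {π s}} =
      Nat.card {y // ∃ c, c ^ r = 1 ∧ Twist M s c y} := by
    refine Nat.card_congr (Equiv.subtypeEquivRight fun g => ?_)
    rw [Subgroup.mem_centralizer_singleton_iff, proj_commute_iff hker]
    exact ⟨fun ⟨c, hc⟩ => ⟨c, hM.twist_pow_eq_one hsr hc, hc⟩, fun ⟨c, _, hc⟩ => ⟨c, hc⟩⟩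
  rw [h3, h2, Finset.sum_congr rfl fun c hc => (card_twist (hM.exists_twist_diagonal hζ hs
    ((Polynomial.mem_nthRootsFinset hr.pos _).1 hc))).trans (hM.card_commutant_diagonal hζ hs),
    Finset.sum_const, hζ.card_nthRootsFinset, smul_eq_mul] at h1
  have h4 : r * (r * m) ^ (r - 1) = Nat.card (Subgroup.centralizer {π s}) := by
    refine Nat.eq_of_mul_eq_mul_right hrm ?_
    rw [mul_assoc, ← pow_succ, Nat.sub_add_cancel hr.pos]
    exact h1
  have h5 : r ^ 3 ∣ Nat.card G := by
    refine dvd_trans ?_ (Subgroup.card_subgroup_dvd_card (Subgroup.centralizer {π s}))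
    rw [← h4, pow_succ']
    exact mul_dvd_mul_left r ((pow_dvd_pow_of_dvd (Dvd.intro m rfl) 2).trans
      (pow_dvd_pow _ (by omega)))
  have hHp : IsPGroup r H := IsPGroup.of_card (n := 2) (by rw [hcard, pow_two])
  obtain ⟨P, hP⟩ := hHp.exists_le_sylow
  have h6 : r ^ 3 ∣ Nat.card P := P.pow_dvd_card_of_pow_dvd_card h5
  have hPtop : (P : Subgroup G) = ⊤ := by
    rcases hmax.le_iff.1 hP with h | h
    · exact h
    · exfalso
      have h7 : Nat.card P = r * r := by
        rw [← hcard]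
        rw [h]
      rw [h7] at h6
      have := Nat.le_of_dvd (Nat.mul_pos hr.pos hr.pos) h6
      nlinarith
  obtain ⟨n, hn⟩ := IsPGroup.iff_card.1 P.2
  obtain ⟨p, hp⟩ := hM.perm_mem (Equiv.swap ⟨0, hr.pos⟩ ⟨1, hr.one_lt⟩)
  have h8 := two_dvd_natCard_of_perm hM hker (N := (P : Subgroup G)) (g := 1) (p := p) (fun h => by
    have h1 := Equiv.swap_apply_left (⟨0, hr.pos⟩ : Fin r) ⟨1, hr.one_lt⟩
    rw [h] at h1
    simp at h1) (Equiv.swap_mul_self _ _) hp (by rw [hPtop]; trivial)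
  rw [hn] at h8
  exact (Nat.not_even_iff_odd.2 hM.odd.pow) (even_iff_two_dvd.2 h8)

end IsScalarModel

/-! ### Eigenvectors, and the general linear group as a scalar model -/

/-- Eigenspace decomposition of a vector under an operator of order dividing `r`. -/
theorem exists_sum_eigenvectors {F V : Type*} [Field F] [AddCommGroup V] [Module F V] {r : ℕ}
    [NeZero r] {ζ : F} (hζ : IsPrimitiveRoot ζ r) {f : Module.End F V} (hf : f ^ r = 1) (v : V) :
    ∃ w : ℕ → V, (∀ j, f (w j) = ζ ^ j • w j) ∧ ∑ j ∈ Finset.range r, w j = v ∧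
      ∀ W : Submodule F V, (∀ x ∈ W, f x ∈ W) → v ∈ W → ∀ j, w j ∈ W := by
  have hr0 : (r : F) ≠ 0 := hζ.neZero'.out
  have hζ0 : ζ ≠ 0 := hζ.ne_zero (NeZero.ne r)
  -- The projection to the `ζ^j`-eigenspace is an average over the powers of `f`; `r` is invertible
  -- in `F` since a primitive `r`-th root of unity exists. Being a polynomial in `f`, it preserves
  -- invariant subspaces.
  refine ⟨fun j => (r : F)⁻¹ • ∑ i ∈ Finset.range r, (ζ⁻¹ ^ j) ^ i • (f ^ i) v, fun j => ?_, ?_, ?_⟩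
  · rw [map_smul, map_sum, smul_comm]
    congr 1
    have h1 := Finset.sum_range_succ' (fun i => (ζ⁻¹ ^ j) ^ i • (f ^ i) v) r
    rw [Finset.sum_range_succ, hf, ← pow_mul ζ⁻¹ j r, mul_comm j r, pow_mul, hζ.inv.pow_eq_one,
      one_pow, pow_zero, pow_zero, add_left_inj] at h1
    rw [h1, Finset.smul_sum]
    refine Finset.sum_congr rfl fun i _ => ?_
    rw [map_smul, smul_smul, pow_succ' (ζ⁻¹ ^ j), ← mul_assoc, inv_pow, mul_inv_cancel₀ (pow_ne_zero _ hζ0),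
      one_mul, pow_succ' f]
    rfl
  · rw [← Finset.smul_sum, Finset.sum_comm]
    have h1 : ∀ i ∈ Finset.range r, i ≠ 0 →
        ∑ j ∈ Finset.range r, (ζ⁻¹ ^ j) ^ i • (f ^ i) v = 0 := by
      intro i hi hi0
      rw [← Finset.sum_smul]
      have h2 : ∑ j ∈ Finset.range r, (ζ⁻¹ ^ i) ^ j = 0 := by
        have h3 := mul_geom_sum (ζ⁻¹ ^ i) r
        rw [← pow_mul, mul_comm i r, pow_mul, hζ.inv.pow_eq_one, one_pow, sub_self] at h3
        refine (mul_eq_zero.1 h3).resolve_left ?_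
        exact sub_ne_zero.2 <| hζ.inv.pow_ne_one_of_pos_of_lt hi0 (Finset.mem_range.1 hi)
      rw [← zero_smul F ((f ^ i) v), ← h2]
      congr 1
      exact Finset.sum_congr rfl fun j _ => by rw [← pow_mul, ← pow_mul, mul_comm]
    rw [Finset.sum_eq_single_of_mem 0 (Finset.mem_range.2 (NeZero.pos r)) h1]
    simp [← Nat.cast_smul_eq_nsmul F, smul_smul, hr0]
  · intro W hW hv j
    have h1 : ∀ i, (f ^ i) v ∈ W := by
      intro i
      induction i with
      | zero => exact hv
      | succ i ih => rw [pow_succ']; exact hW _ ih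
    exact W.smul_mem _ (W.sum_mem fun i _ => W.smul_mem _ (h1 i))

theorem Matrix.exists_conj_eq_diagonal_of_pow_eq_one {F : Type*} [Field F] {r : ℕ} [NeZero r]
    {ζ : F} (hζ : IsPrimitiveRoot ζ r) (s : GL (Fin r) F) (hs : s ^ r = 1) :
    ∃ (g : GL (Fin r) F) (d : Fin r → F), (↑(g * s * g⁻¹) : Matrix (Fin r) (Fin r) F) =
      Matrix.diagonal d := by
  have hf : Matrix.toLin' (s : Matrix (Fin r) (Fin r) F) ^ r = 1 := by
    rw [← Matrix.toLin'_pow, ← Units.val_pow_eq_pow_val, hs, Units.val_one, Matrix.toLin'_one]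
    rfl
  let S : Set (Fin r → F) := {v | ∃ c : F, Matrix.toLin' (s : Matrix (Fin r) (Fin r) F) v = c • v}
  have hS : ⊤ ≤ Submodule.span F S := by
    intro v _
    obtain ⟨w, hw, rfl, -⟩ := exists_sum_eigenvectors hζ hf v
    exact Submodule.sum_mem _ fun j _ => Submodule.subset_span ⟨_, hw j⟩
  let B := Module.Basis.ofSpan hS
  have hB : ∀ i, B i ∈ S := fun i => Module.Basis.ofSpan_subset hS ⟨i, rfl⟩
  have := Module.Finite.finite_basis B
  let e := Finite.equivFinOfCardEq ((Module.finrank_eq_nat_card_basis B).symm.trans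
    (Module.finrank_fin_fun F))
  let B' := B.reindex e
  choose c hc using fun i => hB (e.symm i)
  have hB' : ∀ i, Matrix.toLin' (s : Matrix (Fin r) (Fin r) F) (B' i) = c i • B' i := by
    intro i
    rw [Module.Basis.reindex_apply]
    exact hc i
  let b := Pi.basisFun F (Fin r)
  let P : GL (Fin r) F := ⟨b.toMatrix B', B'.toMatrix b, Module.Basis.toMatrix_mul_toMatrix_flip _ _,
    Module.Basis.toMatrix_mul_toMatrix_flip _ _⟩
  refine ⟨P⁻¹, c, ?_⟩
  have h1 : (s : Matrix (Fin r) (Fin r) F) * P = P * Matrix.diagonal c := by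
    ext i j
    have h2 := congrFun (hB' j) i
    rw [Matrix.toLin'_apply, Pi.smul_apply, smul_eq_mul] at h2
    rw [Matrix.mul_diagonal, mul_comm]
    exact h2
  rw [inv_inv, Units.val_mul, Units.val_mul, mul_assoc, h1, ← mul_assoc, Units.inv_mul, one_mul]

theorem natCard_adjoinRoot_X_pow_sub_C {F : Type*} [Field F] [Finite F] {r : ℕ} (hr : r.Prime)
    (x : F) : Nat.card (AdjoinRoot (Polynomial.X ^ r - Polynomial.C x)) = Nat.card F ^ r := by
  have h0 : (Polynomial.X ^ r - Polynomial.C x : Polynomial F) ≠ 0 :=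
    Polynomial.X_pow_sub_C_ne_zero hr.pos x
  have : Module.Finite F (AdjoinRoot (Polynomial.X ^ r - Polynomial.C x)) :=
    (AdjoinRoot.powerBasis h0).finite
  rw [Module.natCard_eq_pow_finrank (K := F), finrank_adjoinRoot_X_pow_sub_C hr]

theorem Matrix.natCard_commutant_GL {F : Type*} [Field F] [Finite F] {r : ℕ} (hr : r.Prime) {x : F}
    (hx : ∀ b : F, b ^ r ≠ x) {s : Matrix (Fin r) (Fin r) F} (hs : s ^ r = x • 1) :
    Nat.card {g : GL (Fin r) F // (g : Matrix (Fin r) (Fin r) F) * s = s * g} =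
      Nat.card F ^ r - 1 := by
  have : Fact (Irreducible (Polynomial.X ^ r - Polynomial.C x : Polynomial F)) :=
    ⟨X_pow_sub_C_irreducible_of_prime hr hx⟩
  have : NeZero r := ⟨hr.ne_zero⟩
  rw [← natCard_adjoinRoot_X_pow_sub_C hr x, ← Nat.card_units]
  have hcomm : ∀ u, adjoinRootToMatrix s hs u * s = s * adjoinRootToMatrix s hs u := by
    intro u
    have h1 := congrArg (adjoinRootToMatrix s hs) (mul_comm u (AdjoinRoot.root _))
    rwa [map_mul, map_mul, adjoinRootToMatrix_root] at h1
  refine (Nat.card_congr (Equiv.ofBijective (fun u => (⟨Units.map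
    (adjoinRootToMatrix s hs : _ →* Matrix (Fin r) (Fin r) F) u, hcomm u⟩ :
      {g : GL (Fin r) F // (g : Matrix (Fin r) (Fin r) F) * s = s * g})) ⟨?_, ?_⟩)).symm
  · intro u v h
    exact Units.ext (adjoinRootToMatrix_injective hr hx s hs
      (congrArg (fun g => (g.1 : Matrix (Fin r) (Fin r) F)) h))
  · rintro ⟨g, hg⟩
    obtain ⟨l, hl⟩ := exists_adjoinRootToMatrix_eq hr hx s hs hg
    have hl0 : l ≠ 0 := by
      rintro rfl
      rw [map_zero] at hl
      exact g.ne_zero hl.symm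
    exact ⟨Units.mk0 l hl0, Subtype.ext (Units.ext hl)⟩

/-- In the order of `GL_r(q)` the factor `q^r - 1` equals `a (r m)`, and each of the other `r - 1`
factors is at least `q^(r-1) (q-1)`. Against this, the estimate `a ≤ 2 q^(r-1)` suffices. -/
theorem GL_card_bound {r m a q : ℕ} (hr : 3 ≤ r) (hm : 0 < m) (hq : q = r * m + 1)
    (ha : a * (r * m) = q ^ r - 1) :
    (r - 1) * ((r - 1) * a ^ 2 + a * (r * m) ^ (r - 1)) ≤ r * (q ^ (r - 1) * (r * m)) ^ (r - 1) := by
  have hn : r ≤ r * m := Nat.le_mul_of_pos_right r hm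
  set n := r * m with hn'
  set Q := q ^ (r - 1) with hQ
  set N := n ^ (r - 1) with hN
  have hq1 : 0 < q ^ r := pow_pos (by omega) r
  have hqr : q ^ r = Q * q := by rw [hQ, ← pow_succ]; congr 1; omega
  have ha2 : a ≤ 2 * Q := by
    have h1 : a * n ≤ 2 * Q * n := by
      have h2 : Q * q ≤ Q * (2 * n) := Nat.mul_le_mul_left _ (by omega)
      rw [ha, hqr]
      calc Q * q - 1 ≤ Q * (2 * n) := by omega
        _ = _ := by ring
    exact Nat.le_of_mul_le_mul_right h1 (by omega)
  obtain ⟨t, rfl⟩ : ∃ t, r = t + 1 := ⟨r - 1, by omega⟩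
  rw [Nat.add_sub_cancel] at *
  have hN2 : (t + 1) ^ 2 ≤ N := (Nat.pow_le_pow_left hn 2).trans
    (Nat.pow_le_pow_right (by omega) (by omega))
  have hQ2 : 2 * t ≤ Q := by
    have h1 : (t + 1) ^ 2 ≤ Q := (Nat.pow_le_pow_left (by omega) 2).trans
      (Nat.pow_le_pow_right (by omega) (by omega))
    nlinarith
  have hQt : Q ^ 2 ≤ Q ^ t := Nat.pow_le_pow_right (by omega) (by omega)
  rw [mul_pow, ← hN]
  have h1 : a ^ 2 ≤ 4 * Q ^ 2 := (Nat.pow_le_pow_left ha2 2).trans (by rw [mul_pow]; norm_num)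
  have h2 : 4 * t ≤ (t + 1) ^ 2 := by nlinarith [sq_nonneg ((t : ℤ) - 1)]
  calc t * (t * a ^ 2 + a * N) ≤ t * (t * (4 * Q ^ 2) + 2 * Q * N) := by gcongr
    _ = t * Q ^ 2 * (4 * t) + (2 * t) * Q * N := by ring
    _ ≤ t * Q ^ 2 * N + Q * Q * N := by gcongr; exact h2.trans hN2
    _ = (t + 1) * (Q ^ 2 * N) := by ring
    _ ≤ (t + 1) * (Q ^ t * N) := by gcongr

/-- General linear groups over finite fields are scalar models. -/
theorem isScalarModel_GL {F : Type} [Field F] [Finite F] {r m a : ℕ} (hr : r.Prime) (hodd : Odd r)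
    (hm : r * m = Nat.card F - 1) (ha : a * (r * m) = Nat.card F ^ r - 1) :
    IsScalarModel (Units.coeHom _ : GL (Fin r) F →* Matrix (Fin r) (Fin r) F) m a := by
  have := Fintype.ofFinite F
  have hF := Finite.one_lt_card (α := F)
  have hm0 : 0 < m := Nat.pos_of_ne_zero (by rintro rfl; omega)
  have hgcd : Nat.gcd (Nat.card F - 1) (r * (r * m)) = r * m := by
    rw [hm]; exact Nat.gcd_eq_left (Dvd.intro_left r rfl)
  have : NeZero r := ⟨hr.ne_zero⟩
  have hcard : ∀ y : F, y ≠ 0 → y ^ (r * m) = 1 := by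
    intro y hy
    rw [hm, Nat.card_eq_fintype_card]
    exact FiniteField.pow_card_sub_one_eq_one y hy
  refine
    { prime := hr
      odd := hodd
      injective := fun g h hgh => Units.ext hgh
      gcd_eq := hgcd
      diag_mem := ?_
      diag_pow := ?_
      perm_mem := ?_
      diagonalizable := ?_
      conj := ?_
      card_commutant := ?_
      exists_not_diag := ?_
      card_ge := ?_ }
  · intro d hd
    have h1 : ∀ i, d i ≠ 0 := fun i h => by
      have := hd i
      rw [h, zero_pow (Nat.mul_pos hr.pos hm0).ne'] at this
      exact zero_ne_one this
    refine ⟨Matrix.GeneralLinearGroup.mkOfDetNeZero (Matrix.diagonal d) ?_, rfl⟩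
    rw [Matrix.det_diagonal]
    exact Finset.prod_ne_zero_iff.2 fun i _ => h1 i
  · intro g d hg i
    apply hcard
    have h1 := (Matrix.isUnits_det_units g).ne_zero
    change (g : Matrix (Fin r) (Fin r) F) = _ at hg
    rw [hg, Matrix.det_diagonal] at h1
    exact Finset.prod_ne_zero_iff.1 h1 i (Finset.mem_univ i)
  · intro e
    refine ⟨Matrix.GeneralLinearGroup.mkOfDetNeZero (e.permMatrix F) ?_, rfl⟩
    rw [Matrix.det_permutation]
    rcases Int.units_eq_one_or (Equiv.Perm.sign e) with h | h <;> rw [h] <;> simp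
  · intro s hs
    obtain ⟨ζ, hζ⟩ := exists_isPrimitiveRoot_of_dvd (K := F) (d := r) (hm ▸ Dvd.intro m rfl)
    exact Matrix.exists_conj_eq_diagonal_of_pow_eq_one hζ s (Units.ext (by simpa using hs))
  · intro s t x hx hx' hs ht
    obtain ⟨g, g', h1, h2, h3⟩ := exists_conj_of_pow_eq hr
      (pow_ne_of_gcd_eq hr.pos hm0 hgcd hx hx') hs ht
    refine ⟨⟨g, g', h1, h2⟩, ?_⟩
    rw [mul_inv_eq_iff_eq_mul]
    exact Units.ext h3
  · intro s x hx hx' hs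
    rw [ha]
    exact Matrix.natCard_commutant_GL hr (pow_ne_of_gcd_eq hr.pos hm0 hgcd hx hx') hs
  · intro s d hs hns
    obtain ⟨i, j, hij⟩ : ∃ i j, d i ≠ d j := by
      by_contra! h
      refine hns (d 0) ?_
      rw [hs, Matrix.smul_one_eq_diagonal]
      exact congrArg _ (funext fun i => h i 0)
    have hne : i ≠ j := fun h => hij (by rw [h])
    let g := Matrix.GeneralLinearGroup.mkOfDetNeZero (Matrix.transvection i j (1 : F))
      (by rw [Matrix.det_transvection_of_ne _ _ hne]; exact one_ne_zero)
    refine ⟨g, fun d' h => ?_⟩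
    have h2 : Matrix.transvection i j (1 : F) * Matrix.diagonal d =
        Matrix.diagonal d' * Matrix.transvection i j (1 : F) := by
      rw [← hs]
      exact (Units.mul_inv_eq_iff_eq_mul g).1 h
    have h3 := congrFun (congrFun h2 i) i
    have h4 := congrFun (congrFun h2 i) j
    rw [Matrix.mul_diagonal, Matrix.diagonal_mul] at h3 h4
    simp [Matrix.transvection, hne, hne.symm] at h3 h4
    exact hij (h3.trans h4.symm)
  · rw [Matrix.card_GL_field, ← Nat.card_eq_fintype_card]
    have h3 : 3 ≤ r := by
      obtain ⟨k, hk⟩ := hodd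
      have := hr.one_lt
      omega
    obtain ⟨t, rfl⟩ : ∃ t, r = t + 1 := ⟨r - 1, by omega⟩
    have hb := GL_card_bound h3 hm0 (q := Nat.card F) (by omega) ha
    rw [Fin.prod_univ_succ, Fin.val_zero, pow_zero, ← ha, Nat.add_sub_cancel, mul_assoc,
      mul_left_comm (t + 1)]
    rw [Nat.add_sub_cancel] at hb
    refine Nat.mul_le_mul_left _ (hb.trans (Nat.mul_le_mul_left _ ?_))
    rw [← Fin.prod_const]
    refine Finset.prod_le_prod' fun i _ => ?_
    rw [hm, Nat.mul_sub, mul_one, ← pow_succ]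
    refine Nat.sub_le_sub_left (Nat.pow_le_pow_right (by omega) ?_) _
    rw [Fin.val_succ]
    exact i.2

/-! ### Hermitian forms and unitary diagonalization -/

section Hermitian

variable {F : Type*} [Field F] [StarRing F] {q : ℕ} (hstar : ∀ x : F, star x = x ^ q)

include hstar

theorem mul_star_eq_pow (x : F) : x * star x = x ^ (q + 1) := by
  rw [hstar, pow_succ']

variable [Finite F] (hF : Nat.card F = q ^ 2)

include hF

omit [StarRing F] hstar in
theorem one_lt_of_natCard_eq_sq : 1 < q := by
  by_contra h
  have h1 := Finite.one_lt_card (α := F)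
  have : q ^ 2 ≤ 1 ^ 2 := Nat.pow_le_pow_left (by omega) 2
  omega

omit [Field F] [Finite F] [StarRing F] hstar in
theorem natCard_sub_one_eq : Nat.card F - 1 = (q + 1) * (q - 1) := by
  rw [hF, ← Nat.sq_sub_sq, one_pow]

/-- Surjectivity of the norm: a nonzero `c` fixed by `star` satisfies `c^(q-1) = 1`, so it is a
`(q+1)`-th power. -/
theorem exists_mul_star_eq {c : F} (hc : star c = c) : ∃ y, y * star y = c := by
  by_cases h0 : c = 0
  · exact ⟨0, by simp [h0]⟩
  obtain ⟨y, hy⟩ := exists_pow_eq_of_pow_eq_one (natCard_sub_one_eq hF).symm (x := c) (by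
    refine mul_left_cancel₀ h0 ?_
    have := one_lt_of_natCard_eq_sq hF
    rw [← pow_succ', Nat.sub_add_cancel this.le, mul_one, ← hstar, hc])
  exact ⟨y, by rw [mul_star_eq_pow hstar, hy]⟩

/-- A generator `g` of the multiplicative group with `g + g^q = 0` would have order dividing
`2(q-1)`, which is less than `q^2 - 1`. -/
theorem exists_add_star_ne_zero : ∃ c : F, c + star c ≠ 0 := by
  obtain ⟨g, hg⟩ := exists_isPrimitiveRoot_of_dvd (K := F) (dvd_refl (Nat.card F - 1))
  have hq := one_lt_of_natCard_eq_sq hF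
  refine ⟨g, fun h => ?_⟩
  have hg0 : g ≠ 0 := hg.ne_zero (by have := Finite.one_lt_card (α := F); omega)
  have h1 : g ^ (q - 1) = -1 := by
    refine mul_left_cancel₀ hg0 ?_
    rw [← pow_succ', Nat.sub_add_cancel hq.le, ← hstar]
    linear_combination h
  have h2 : g ^ (2 * (q - 1)) = 1 := by rw [mul_comm, pow_mul, h1]; norm_num
  have h3 := hg.dvd_of_pow_eq_one _ h2
  rw [natCard_sub_one_eq hF] at h3
  have h4 := Nat.le_of_dvd (by norm_num) (Nat.dvd_of_mul_dvd_mul_right (by omega) h3)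
  omega

theorem exists_star_ne : ∃ c : F, star c ≠ c := by
  obtain ⟨g, hg⟩ := exists_isPrimitiveRoot_of_dvd (K := F) (dvd_refl (Nat.card F - 1))
  have hq := one_lt_of_natCard_eq_sq hF
  refine ⟨g, fun h => ?_⟩
  have hg0 : g ≠ 0 := hg.ne_zero (by have := Finite.one_lt_card (α := F); omega)
  have h1 : g ^ (q - 1) = 1 := by
    refine mul_left_cancel₀ hg0 ?_
    rw [← pow_succ', Nat.sub_add_cancel hq.le, ← hstar, h, mul_one]
  have h3 := hg.dvd_of_pow_eq_one _ h1
  rw [natCard_sub_one_eq hF] at h3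
  have h4 := Nat.le_of_dvd (by omega) h3
  rw [add_mul] at h4
  nlinarith [Nat.sub_pos_of_lt hq]

/-- Polarization: if every vector of `E` were isotropic, the form at `c x + β y` with `β = ⟨x, y⟩`
would give `(c + c*) β β* = 0`. A nonisotropic vector is then normalized by surjectivity of the
norm. -/
theorem exists_dotProduct_star_self_eq_one {ι : Type*} [Fintype ι] {E : Submodule F (ι → F)}
    {x y : ι → F} (hx : x ∈ E) (hy : y ∈ E) (hxy : x ⬝ᵥ star y ≠ 0) :
    ∃ u ∈ E, u ⬝ᵥ star u = 1 := by
  obtain ⟨u, hu, hu0⟩ : ∃ u ∈ E, u ⬝ᵥ star u ≠ 0 := by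
    by_contra! h
    obtain ⟨c, hc⟩ := exists_add_star_ne_zero hstar hF
    set β := x ⬝ᵥ star y with hβ
    have h1 := h (c • x + β • y) (E.add_mem (E.smul_mem _ hx) (E.smul_mem _ hy))
    rw [star_add, star_smul, star_smul, add_dotProduct, dotProduct_add, dotProduct_add,
      smul_dotProduct, smul_dotProduct, smul_dotProduct, smul_dotProduct, dotProduct_smul,
      dotProduct_smul, dotProduct_smul, dotProduct_smul, h x hx, h y hy,
      Matrix.dotProduct_star y x, ← hβ] at h1
    simp only [smul_eq_mul, mul_zero, zero_add, add_zero] at h1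
    have h2 : (c + star c) * (β * star β) = 0 := by linear_combination h1
    rcases mul_eq_zero.1 h2 with h3 | h3
    · exact hc h3
    · rcases mul_eq_zero.1 h3 with h4 | h4
      · exact hxy h4
      · exact hxy (star_eq_zero.1 h4)
  obtain ⟨y, hy⟩ := exists_mul_star_eq hstar hF (Matrix.dotProduct_star u u).symm
  have hy0 : y ≠ 0 := by
    rintro rfl
    rw [zero_mul] at hy
    exact hu0 hy.symm
  have hy1 : star y ≠ 0 := fun h => hy0 (star_eq_zero.1 h)
  refine ⟨y⁻¹ • u, E.smul_mem _ hu, ?_⟩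
  rw [star_smul, smul_dotProduct, dotProduct_smul, ← hy, star_inv₀, smul_eq_mul, smul_eq_mul]
  field_simp

end Hermitian

section Diagonalization

variable {F : Type*} [Field F] [StarRing F] {r : ℕ} {s : Matrix (Fin r) (Fin r) F}

theorem Matrix.mulVec_dotProduct_star_mulVec (hs : sᴴ * s = 1) (v w : Fin r → F) :
    (s *ᵥ v) ⬝ᵥ star (s *ᵥ w) = v ⬝ᵥ star w := by
  rw [Matrix.star_mulVec, dotProduct_comm, Matrix.dotProduct_mulVec, Matrix.vecMul_vecMul, hs,
    Matrix.vecMul_one, dotProduct_comm]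

/-- A finite set of orthonormal eigenvectors of `s`. -/
def Matrix.IsEigenframe (s : Matrix (Fin r) (Fin r) F) (S : Finset (Fin r → F)) : Prop :=
  (∀ v ∈ S, ∃ c : F, s *ᵥ v = c • v) ∧
    (∀ v ∈ S, v ⬝ᵥ star v = 1) ∧ ∀ v ∈ S, ∀ w ∈ S, v ≠ w → v ⬝ᵥ star w = 0

/-- The orthogonal complement of the frame is `s`-invariant and contains two nonorthogonal vectors.
Some of their eigencomponents are nonorthogonal too; as `s` preserves the form, these share an
eigenvalue, and their eigenspace in the complement contains a unit vector. -/
theorem Matrix.IsEigenframe.exists_extend [Finite F] [NeZero r] {q : ℕ}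
    (hstar : ∀ x : F, star x = x ^ q) (hF : Nat.card F = q ^ 2) {ζ : F}
    (hζ : IsPrimitiveRoot ζ r) (hζs : ζ * star ζ = 1) (hs : sᴴ * s = 1) (hsr : s ^ r = 1)
    {S : Finset (Fin r → F)} (hS : s.IsEigenframe S) (hcard : S.card < r) :
    ∃ u, (∃ c : F, s *ᵥ u = c • u) ∧ (∀ v ∈ S, u ⬝ᵥ star v = 0) ∧ u ⬝ᵥ star u = 1 := by
  let L : (Fin r → F) →ₗ[F] (S → F) :=
    { toFun := fun w v => w ⬝ᵥ star v.1
      map_add' := fun x y => funext fun v => add_dotProduct _ _ _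
      map_smul' := fun c x => funext fun v => smul_dotProduct _ _ _ }
  have hL : ∀ w, w ∈ LinearMap.ker L ↔ ∀ v ∈ S, w ⬝ᵥ star v = 0 := fun w =>
    ⟨fun h v hv => congrFun (LinearMap.mem_ker.1 h) ⟨v, hv⟩,
      fun h => LinearMap.mem_ker.2 (funext fun v => h v.1 v.2)⟩
  have hker : LinearMap.ker L ≠ ⊥ := LinearMap.ker_ne_bot_of_finrank_lt (by simpa using hcard)
  obtain ⟨w, hw, hw0⟩ := Submodule.exists_mem_ne_zero_of_ne_bot hker
  obtain ⟨i, hi⟩ := Function.ne_iff.1 hw0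
  have hinv : ∀ x ∈ LinearMap.ker L, Matrix.toLin' s x ∈ LinearMap.ker L := by
    intro x hx
    rw [hL] at hx ⊢
    intro v hv
    obtain ⟨c, hc⟩ := hS.1 v hv
    have h1 := Matrix.mulVec_dotProduct_star_mulVec hs x v
    have h2 := Matrix.mulVec_dotProduct_star_mulVec hs v v
    rw [hc, star_smul, dotProduct_smul, hx v hv, smul_eq_mul] at h1
    rw [hc, star_smul, dotProduct_smul, smul_dotProduct, hS.2.1 v hv, smul_eq_mul]
      at h2
    exact (mul_eq_zero.1 h1).resolve_left (left_ne_zero_of_mul_eq_one h2)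
  let y₀ : Fin r → F := Pi.single i 1
  -- The projection of the `i`-th coordinate vector to the complement, which pairs with `w` to `w i
  -- ≠ 0`.
  let y := y₀ - ∑ v ∈ S, (y₀ ⬝ᵥ star v) • v
  have hy : y ∈ LinearMap.ker L := by
    rw [hL]
    intro v hv
    rw [sub_dotProduct, sum_dotProduct, Finset.sum_eq_single_of_mem v hv, smul_dotProduct,
      hS.2.1 v hv, smul_eq_mul, mul_one, sub_self]
    intro b hb hne
    rw [smul_dotProduct, hS.2.2 b hb v hv hne, smul_zero]
  have hwy : w ⬝ᵥ star y ≠ 0 := by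
    rw [star_sub, star_sum, dotProduct_sub, dotProduct_sum, Finset.sum_eq_zero, sub_zero]
    · simpa [y₀] using hi
    · intro v hv
      rw [star_smul, dotProduct_smul, (hL w).1 hw v hv, smul_zero]
  have hf : Matrix.toLin' s ^ r = 1 := by
    rw [← Matrix.toLin'_pow, hsr, Matrix.toLin'_one]
    rfl
  obtain ⟨w', hw1, hw2, hw3⟩ := exists_sum_eigenvectors hζ hf w
  obtain ⟨y', hy1, hy2, hy3⟩ := exists_sum_eigenvectors hζ hf y
  obtain ⟨j, l, hjl⟩ : ∃ j l, w' j ⬝ᵥ star (y' l) ≠ 0 := by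
    by_contra! h
    apply hwy
    rw [← hw2, ← hy2, star_sum, sum_dotProduct]
    refine Finset.sum_eq_zero fun j _ => ?_
    rw [dotProduct_sum]
    exact Finset.sum_eq_zero fun l _ => h j l
  have hζjl : ζ ^ l = ζ ^ j := by
    have h1 := Matrix.mulVec_dotProduct_star_mulVec hs (w' j) (y' l)
    rw [← Matrix.toLin'_apply, ← Matrix.toLin'_apply, hw1, hy1, star_smul, smul_dotProduct,
      dotProduct_smul, smul_smul, smul_eq_mul, star_pow] at h1
    have h2 := mul_right_cancel₀ hjl (h1.trans (one_mul _).symm)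
    have h3 : ζ ^ l * star ζ ^ l = 1 := by rw [← mul_pow, hζs, one_pow]
    exact mul_right_cancel₀ (right_ne_zero_of_mul_eq_one h3) (h3.trans h2.symm)
  obtain ⟨u, hu, hu1⟩ := exists_dotProduct_star_self_eq_one hstar hF
    (E := LinearMap.ker L ⊓ Module.End.eigenspace (Matrix.toLin' s) (ζ ^ j))
    ⟨hw3 _ hinv hw j, Module.End.mem_eigenspace_iff.2 (hw1 j)⟩
    ⟨hy3 _ hinv hy l, Module.End.mem_eigenspace_iff.2 (by rw [hy1, hζjl])⟩ hjl
  exact ⟨u, ⟨_, Module.End.mem_eigenspace_iff.1 hu.2⟩, (hL u).1 hu.1, hu1⟩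

/-- Unitary matrices of order `r ∣ q + 1` over the field with `q ^ 2` elements are unitarily
diagonalizable. -/
theorem Matrix.exists_unitary_conj_eq_diagonal [Finite F] [NeZero r] {q : ℕ}
    (hstar : ∀ x : F, star x = x ^ q) (hF : Nat.card F = q ^ 2) {ζ : F}
    (hζ : IsPrimitiveRoot ζ r) (hζs : ζ * star ζ = 1) (hs : sᴴ * s = 1) (hsr : s ^ r = 1) :
    ∃ (P : Matrix (Fin r) (Fin r) F) (d : Fin r → F), P * Pᴴ = 1 ∧ P * s * Pᴴ = diagonal d := by
  classical
  have key : ∀ n ≤ r, ∃ S : Finset (Fin r → F), s.IsEigenframe S ∧ S.card = n := by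
    intro n
    induction n with
    | zero => exact fun _ => ⟨∅, ⟨by simp, by simp, by simp⟩, rfl⟩
    | succ n ih =>
      intro hn
      obtain ⟨S, hS, rfl⟩ := ih (by omega)
      obtain ⟨u, hu, hu0, hu1⟩ := hS.exists_extend hstar hF hζ hζs hs hsr hn
      have hus : u ∉ S := fun h => one_ne_zero (hu1.symm.trans (hu0 u h))
      refine ⟨insert u S, ⟨?_, ?_, ?_⟩, Finset.card_insert_of_notMem hus⟩
      · rintro v hv
        rcases Finset.mem_insert.1 hv with rfl | hv
        exacts [hu, hS.1 v hv]
      · intro v hv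
        rcases Finset.mem_insert.1 hv with rfl | hv
        exacts [hu1, hS.2.1 v hv]
      · intro v hv w hw hne
        rcases Finset.mem_insert.1 hv with rfl | hv' <;>
          rcases Finset.mem_insert.1 hw with rfl | hw'
        · exact absurd rfl hne
        · exact hu0 w hw'
        · rw [dotProduct_star, hu0 v hv', star_zero]
        · exact hS.2.2 v hv' w hw' hne
  obtain ⟨S, hS, hcard⟩ := key r le_rfl
  let e : Fin r ≃ S := (S.equivFinOfCardEq hcard).symm
  choose c hc using fun i => hS.1 (e i).1 (e i).2
  let B : Matrix (Fin r) (Fin r) F := of fun i j => (e j).1 i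
  have hB : Bᴴ * B = 1 := by
    ext i j
    have h1 : (Bᴴ * B) i j = (e j).1 ⬝ᵥ star (e i).1 := dotProduct_comm _ _
    rw [h1]
    rcases eq_or_ne i j with rfl | hne
    · rw [hS.2.1 _ (e i).2, one_apply_eq]
    · rw [hS.2.2 _ (e j).2 _ (e i).2 fun h => hne (e.injective (Subtype.ext h)).symm,
        one_apply_ne hne]
  have hsB : s * B = B * diagonal c := by
    ext i j
    rw [mul_diagonal, mul_comm]
    exact congrFun (hc j) i
  refine ⟨Bᴴ, c, ?_, ?_⟩
  · rw [conjTranspose_conjTranspose, hB]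
  · rw [conjTranspose_conjTranspose, mul_assoc, hsB, ← mul_assoc, hB, one_mul]

end Diagonalization

/-! ### Unitary elements of the commutant and unitary conjugacy -/

section UnitaryCommutant

variable {F : Type*} [Field F] [StarRing F] {p k r : ℕ} [Fact p.Prime] [CharP F p]
  (hstar : ∀ x : F, star x = x ^ p ^ k) {x : F} {s : Matrix (Fin r) (Fin r) F}
  (hsr : s ^ r = x • 1)

include hstar hsr

/-- On the commutant of `s`, the conjugate transpose is a Frobenius power. -/
theorem conjTranspose_adjoinRootToMatrix [Finite F] (hF : Nat.card F = (p ^ k) ^ 2) (hodd : Odd r)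
    (hs : s * sᴴ = 1) (hroot : AdjoinRoot.root (Polynomial.X ^ r - Polynomial.C x) ^
      ((p ^ k) ^ r + 1) = 1) (l : AdjoinRoot (Polynomial.X ^ r - Polynomial.C x)) :
    (adjoinRootToMatrix s hsr l)ᴴ = adjoinRootToMatrix s hsr (l ^ (p ^ k) ^ r) := by
  have : Nontrivial (AdjoinRoot (Polynomial.X ^ r - Polynomial.C x)) :=
    AdjoinRoot.nontrivial _ (by
      rw [Polynomial.degree_X_pow_sub_C hodd.pos]
      exact_mod_cast hodd.pos.ne')
  have : CharP (AdjoinRoot (Polynomial.X ^ r - Polynomial.C x)) p :=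
    charP_of_injective_algebraMap (algebraMap F _).injective p
  have hF' := Fintype.ofFinite F
  have hmul : ∀ l l', (adjoinRootToMatrix s hsr l)ᴴ = adjoinRootToMatrix s hsr (l ^ (p ^ k) ^ r) →
      (adjoinRootToMatrix s hsr l')ᴴ = adjoinRootToMatrix s hsr (l' ^ (p ^ k) ^ r) →
      (adjoinRootToMatrix s hsr (l * l'))ᴴ =
        adjoinRootToMatrix s hsr ((l * l') ^ (p ^ k) ^ r) := by
    intro l l' h h'
    rw [mul_comm l l', map_mul, Matrix.conjTranspose_mul, h, h', ← map_mul, mul_pow, mul_comm]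
  -- Since `r` is odd, `q^r` is `q` times a power of `q^2`, and raising to the power `q^2` is
  -- trivial on `F`.
  have hconst : ∀ c : F, c ^ (p ^ k) ^ r = star c := by
    intro c
    obtain ⟨t, ht⟩ := hodd
    have h1 : ∀ t : ℕ, c ^ ((p ^ k) ^ 2) ^ t = c := by
      intro t
      rw [← hF, Nat.card_eq_fintype_card]
      exact FiniteField.pow_card_pow t c
    rw [hstar, ht, pow_succ, pow_mul (p ^ k), pow_mul, h1]
  obtain ⟨P, rfl⟩ := AdjoinRoot.exists_aeval_root _ l
  induction P using Polynomial.induction_on' with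
  | add P Q hP hQ =>
    rw [map_add, map_add, Matrix.conjTranspose_add, hP, hQ, ← map_add, ← pow_mul, ← add_pow_char_pow]
  | monomial n c =>
    rw [Polynomial.aeval_monomial]
    apply hmul
    · rw [← map_pow, hconst, AlgHom.commutes, AlgHom.commutes, Algebra.algebraMap_eq_smul_one,
        Algebra.algebraMap_eq_smul_one, Matrix.conjTranspose_smul, Matrix.conjTranspose_one]
    · induction n with
      | zero => rw [pow_zero, one_pow, map_one, Matrix.conjTranspose_one]
      | succ n ih =>
        rw [pow_succ]
        refine hmul _ _ ih ?_
        rw [adjoinRootToMatrix_root]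
        -- On the generator both sides are the inverse of `s`: one by unitarity, the other by
        -- `hroot`.
        have h1 : s * adjoinRootToMatrix s hsr (AdjoinRoot.root _ ^ (p ^ k) ^ r) = 1 := by
          nth_rewrite 1 [← adjoinRootToMatrix_root s hsr]
          rw [← map_mul, ← pow_succ', hroot, map_one]
        exact Matrix.inv_eq_right_inv hs ▸ Matrix.inv_eq_right_inv h1

end UnitaryCommutant

section UnitaryModel

variable {F : Type*} [Field F] [StarRing F] {p k r : ℕ} [Fact p.Prime] [CharP F p]
  (hstar : ∀ x : F, star x = x ^ p ^ k)

omit [StarRing F] in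
theorem AdjoinRoot.root_X_pow_sub_C_pow {m a : ℕ} {x : F} (hx : x ^ (r * m) = 1) (hra : r ∣ a) :
    AdjoinRoot.root (Polynomial.X ^ r - Polynomial.C x) ^ (a * (r * m)) = 1 := by
  have h1 : AdjoinRoot.root (Polynomial.X ^ r - Polynomial.C x) ^ r = algebraMap F _ x := by
    have h2 := AdjoinRoot.eval₂_root (Polynomial.X ^ r - Polynomial.C x)
    rw [Polynomial.eval₂_sub, Polynomial.eval₂_pow, Polynomial.eval₂_X, Polynomial.eval₂_C,
      sub_eq_zero] at h2
    exact h2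
  obtain ⟨b, rfl⟩ := hra
  rw [mul_assoc, pow_mul, h1, ← map_pow, mul_comm b, pow_mul, hx, one_pow, map_one]

include hstar

/-- On `F[s]`, a field with `q^(2r)` elements, unitarity of `l` reads `l^(q^r + 1) = 1`. -/
theorem natCard_unitary_commutant [Finite F] (hF : Nat.card F = (p ^ k) ^ 2) (hr : r.Prime)
    (hodd : Odd r) {x : F} (hx : ∀ b : F, b ^ r ≠ x) {s : Matrix (Fin r) (Fin r) F}
    (hsr : s ^ r = x • 1) (hs : s * sᴴ = 1)
    (hroot : AdjoinRoot.root (Polynomial.X ^ r - Polynomial.C x) ^ ((p ^ k) ^ r + 1) = 1) :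
    Nat.card {g : Matrix (Fin r) (Fin r) F // g * gᴴ = 1 ∧ g * s = s * g} = (p ^ k) ^ r + 1 := by
  have : Fact (Irreducible (Polynomial.X ^ r - Polynomial.C x : Polynomial F)) :=
    ⟨X_pow_sub_C_irreducible_of_prime hr hx⟩
  have : NeZero r := ⟨hr.ne_zero⟩
  have hcard := natCard_adjoinRoot_X_pow_sub_C hr x
  have : Finite (AdjoinRoot (Polynomial.X ^ r - Polynomial.C x)) :=
    Nat.finite_of_card_ne_zero (by rw [hcard]; exact pow_ne_zero _ Nat.card_pos.ne')
  have hstar' := conjTranspose_adjoinRootToMatrix hstar hsr hF hodd hs hroot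
  have hcomm : ∀ u, adjoinRootToMatrix s hsr u * s = s * adjoinRootToMatrix s hsr u := by
    intro u
    have h1 := congrArg (adjoinRootToMatrix s hsr) (mul_comm u (AdjoinRoot.root _))
    rwa [map_mul, map_mul, adjoinRootToMatrix_root] at h1
  rw [← card_pow_eq_one_of_dvd (K := AdjoinRoot (Polynomial.X ^ r - Polynomial.C x))
    (d := (p ^ k) ^ r + 1) ⟨(p ^ k) ^ r - 1, by
      rw [hcard, hF, ← Nat.sq_sub_sq, ← pow_mul, mul_comm 2 r, pow_mul, one_pow]⟩]
  have hiff : ∀ l, adjoinRootToMatrix s hsr l * (adjoinRootToMatrix s hsr l)ᴴ = 1 ↔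
      l ^ ((p ^ k) ^ r + 1) = 1 := by
    intro l
    rw [hstar', ← map_mul, ← pow_succ']
    exact ⟨fun h => adjoinRootToMatrix_injective hr hx s hsr (h.trans (map_one _).symm),
      fun h => by rw [h, map_one]⟩
  refine (Nat.card_congr (Equiv.ofBijective (fun u => (⟨adjoinRootToMatrix s hsr u.1,
    (hiff _).2 u.2, hcomm _⟩ : {g : Matrix (Fin r) (Fin r) F // g * gᴴ = 1 ∧ g * s = s * g}))
    ⟨?_, ?_⟩)).symm
  · intro u v h
    exact Subtype.ext (adjoinRootToMatrix_injective hr hx s hsr (congrArg Subtype.val h))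
  · rintro ⟨g, hg1, hg2⟩
    obtain ⟨l, rfl⟩ := exists_adjoinRootToMatrix_eq hr hx s hsr hg2
    exact ⟨⟨l, (hiff l).1 hg1⟩, rfl⟩

/-- Two unitary matrices with the same `r`-th power `x`, not an `r`-th power in `F`, are conjugate
by a unitary matrix. -/
theorem exists_unitary_conj_of_pow_eq [Finite F] (hF : Nat.card F = (p ^ k) ^ 2) (hr : r.Prime)
    (hodd : Odd r) {x : F} (hx : ∀ b : F, b ^ r ≠ x) {s t : Matrix (Fin r) (Fin r) F}
    (hsr : s ^ r = x • 1) (htr : t ^ r = x • 1) (hs : s * sᴴ = 1) (ht : t * tᴴ = 1)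
    (hroot : AdjoinRoot.root (Polynomial.X ^ r - Polynomial.C x) ^ ((p ^ k) ^ r + 1) = 1) :
    ∃ u : Matrix (Fin r) (Fin r) F, uᴴ * u = 1 ∧ u * s = t * u := by
  have : Fact (Irreducible (Polynomial.X ^ r - Polynomial.C x : Polynomial F)) :=
    ⟨X_pow_sub_C_irreducible_of_prime hr hx⟩
  have : NeZero r := ⟨hr.ne_zero⟩
  have hcard := natCard_adjoinRoot_X_pow_sub_C hr x
  have : Finite (AdjoinRoot (Polynomial.X ^ r - Polynomial.C x)) :=
    Nat.finite_of_card_ne_zero (by rw [hcard]; exact pow_ne_zero _ Nat.card_pos.ne')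
  have hstar' := conjTranspose_adjoinRootToMatrix hstar hsr hF hodd hs hroot
  have hinj := adjoinRootToMatrix_injective hr hx s hsr
  obtain ⟨g, g', hgg', hg'g, hg⟩ := exists_conj_of_pow_eq hr hx hsr htr
  have hs' : sᴴ * s = 1 := mul_eq_one_comm.1 hs
  have ht' : tᴴ * t = 1 := mul_eq_one_comm.1 ht
  have h1 : tᴴ * g = g * sᴴ := by
    calc tᴴ * g = tᴴ * (g * s) * sᴴ := by rw [mul_assoc, mul_assoc, hs, mul_one]
      _ = g * sᴴ := by rw [hg, ← mul_assoc, ht', one_mul]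
  have h2 : gᴴ * t = s * gᴴ := by
    have := congrArg Matrix.conjTranspose h1
    simpa using this
  -- `gᴴ g` lies in `F[s]` and is Hermitian, i.e. fixed by the `q^r`-th power map. It is thus a norm
  -- `y^(q^r + 1)`, and `g y⁻¹` is unitary.
  have hh : gᴴ * g * s = s * (gᴴ * g) := by
    rw [mul_assoc, hg, ← mul_assoc, h2, mul_assoc]
  obtain ⟨l, hl⟩ := exists_adjoinRootToMatrix_eq hr hx s hsr hh
  have hl0 : l ≠ 0 := by
    rintro rfl
    rw [map_zero] at hl
    have h3 : g'ᴴ * (gᴴ * g) * g' = 1 := by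
      rw [← mul_assoc, ← Matrix.conjTranspose_mul, hgg', Matrix.conjTranspose_one, one_mul, hgg']
    rw [← hl, mul_zero, zero_mul] at h3
    exact zero_ne_one h3
  have hq : 0 < (p ^ k) ^ r := pow_pos (pow_pos (Fact.out : p.Prime).pos k) r
  have hlq : l ^ ((p ^ k) ^ r - 1) = 1 := by
    refine mul_left_cancel₀ hl0 ?_
    rw [← pow_succ', Nat.sub_add_cancel hq, mul_one]
    apply hinj
    rw [← hstar', hl, Matrix.conjTranspose_mul, Matrix.conjTranspose_conjTranspose]
  obtain ⟨y, hy⟩ := exists_pow_eq_of_pow_eq_one (d := (p ^ k) ^ r + 1) (by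
    rw [hcard, hF, ← Nat.sq_sub_sq, ← pow_mul, mul_comm r 2, pow_mul, one_pow]) hlq
  have hy0 : y ≠ 0 := by
    rintro rfl
    rw [zero_pow (Nat.succ_ne_zero _)] at hy
    exact hl0 hy.symm
  refine ⟨g * adjoinRootToMatrix s hsr y⁻¹, ?_, ?_⟩
  · rw [Matrix.conjTranspose_mul, mul_assoc, ← mul_assoc gᴴ, ← hl, hstar', ← map_mul, ← map_mul,
      ← map_one (adjoinRootToMatrix s hsr), ← hy]
    congr 1
    rw [inv_pow, pow_succ, mul_inv_cancel_right₀ hy0, inv_mul_cancel₀ (pow_ne_zero _ hy0)]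
  · have h3 := congrArg (adjoinRootToMatrix s hsr) (mul_comm y⁻¹ (AdjoinRoot.root _))
    rw [map_mul, map_mul, adjoinRootToMatrix_root] at h3
    rw [mul_assoc, h3, ← mul_assoc, hg, mul_assoc]

omit [Fact p.Prime] [CharP F p] in
/-- A nonscalar diagonal matrix has a nondiagonal unitary conjugate. -/
theorem exists_unitary_conj_ne_diagonal [Finite F] (hF : Nat.card F = (p ^ k) ^ 2) (hr : 3 ≤ r)
    {d : Fin r → F} {i j : Fin r} (hij : d i ≠ d j) :
    ∃ R : Matrix (Fin r) (Fin r) F, R * Rᴴ = 1 ∧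
      ∀ d', R * Matrix.diagonal d ≠ Matrix.diagonal d' * R := by
  have hne : i ≠ j := fun h => hij (by rw [h])
  have hq := one_lt_of_natCard_eq_sq hF
  obtain ⟨l, hli, hlj⟩ : ∃ l, l ≠ i ∧ l ≠ j := by
    obtain ⟨l, hl⟩ : ∃ l, l ∉ ({i, j} : Finset (Fin r)) := by
      by_contra! h
      have h1 := Finset.card_le_card (fun l _ => h l : Finset.univ ⊆ ({i, j} : Finset (Fin r)))
      rw [Finset.card_univ, Fintype.card_fin] at h1
      have := h1.trans Finset.card_le_two
      omega
    rw [Finset.mem_insert, Finset.mem_singleton, not_or] at hl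
    exact ⟨l, hl⟩
  obtain ⟨w, hw⟩ := exists_mul_star_eq hstar hF (c := -1) (by rw [star_neg, star_one])
  obtain ⟨α, hα⟩ := exists_isPrimitiveRoot_of_dvd (K := F) (d := p ^ k + 1)
    (natCard_sub_one_eq hF ▸ Dvd.intro _ rfl)
  have hα1 : α * star α = 1 := by rw [mul_star_eq_pow hstar, hα.pow_eq_one]
  have hαne : α ≠ 1 := hα.ne_one (by omega)
  -- With `w w* = -1` the vector `v` has norm `1 + 1 - 1 = 1`, so `1 + (α - 1) P` is a unitary
  -- reflection. Its entries at `(i, i)` and `(i, j)` are nonzero, which forces `d i = d j` if the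
  -- conjugate is diagonal.
  let v : Fin r → F := Pi.single i 1 + Pi.single j 1 + Pi.single l w
  have hvi : v i = 1 := by simp [v, hne, hli]
  have hvj : v j = 1 := by simp [v, hne, hlj]
  have hvv : star v ⬝ᵥ v = 1 := by
    simp [v, hne, hne.symm, hli, hlj, hli.symm, hlj.symm, mul_comm, hw]
  set P := Matrix.vecMulVec v (star v) with hP
  have hPP : P * P = P := by rw [hP, Matrix.vecMulVec_mul_vecMulVec, hvv, one_smul]
  have hPH : Pᴴ = P := by rw [hP, Matrix.conjTranspose_vecMulVec, star_star]
  refine ⟨1 + (α - 1) • P, ?_, fun d' h => ?_⟩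
  · rw [Matrix.conjTranspose_add, Matrix.conjTranspose_one, Matrix.conjTranspose_smul, hPH, mul_add,
      add_mul, add_mul, one_mul, mul_one, one_mul, smul_mul_smul_comm, hPP, add_assoc, ← add_smul,
      ← add_smul]
    have : α - 1 + (star (α - 1) + (α - 1) * star (α - 1)) = 0 := by
      rw [star_sub, star_one]
      linear_combination hα1
    rw [this, zero_smul, add_zero]
  · have h1 := congrFun (congrFun h i) i
    have h2 := congrFun (congrFun h i) j
    rw [Matrix.mul_diagonal, Matrix.diagonal_mul] at h1 h2
    simp only [Matrix.add_apply, Matrix.smul_apply, hP, Matrix.vecMulVec_apply, Pi.star_apply, hvi,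
      hvj, star_one, Matrix.one_apply_eq, Matrix.one_apply_ne hne, smul_eq_mul, mul_one, zero_add,
      add_sub_cancel] at h1 h2
    have hα0 : α ≠ 0 := left_ne_zero_of_mul_eq_one hα1
    have h3 : d i = d' i := mul_left_cancel₀ hα0 (h1.trans (mul_comm _ _))
    have h4 : d j = d' i := mul_left_cancel₀ (sub_ne_zero.2 hαne) (h2.trans (mul_comm _ _))
    exact hij (h3.trans h4.symm)

end UnitaryModel

/-! ### A lower bound for the order of the unitary group -/

/-- Hermitian matrices form at most half of the space of all matrices. -/
theorem natCard_conjTranspose_eq_self_sq_le {F : Type*} [Field F] [StarRing F] [Finite F] {r : ℕ}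
    {c : F} (hc : star c ≠ c) :
    Nat.card {A : Matrix (Fin r) (Fin r) F // Aᴴ = A} ^ 2 ≤ Nat.card F ^ r ^ 2 := by
  have h1 : Nat.card (Matrix (Fin r) (Fin r) F) = Nat.card F ^ r ^ 2 := by
    change Nat.card (Fin r → Fin r → F) = _
    rw [Nat.card_fun, Nat.card_fun, Nat.card_fin, ← pow_mul, pow_two]
  rw [pow_two, ← Nat.card_prod, ← h1]
  -- For Hermitian `A` and `B`, the conjugate transpose of `A + c B` is `A + c* B`; since `c* ≠ c`,
  -- both are recovered.
  refine Nat.card_le_card_of_injective (fun p => p.1.1 + c • p.2.1) ?_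
  rintro ⟨⟨A, hA⟩, ⟨B, hB⟩⟩ ⟨⟨A', hA'⟩, ⟨B', hB'⟩⟩ h
  dsimp only at h
  have h2 := congrArg Matrix.conjTranspose h
  rw [Matrix.conjTranspose_add, Matrix.conjTranspose_add, Matrix.conjTranspose_smul,
    Matrix.conjTranspose_smul, hA, hB, hA', hB'] at h2
  have h3 : (star c - c) • (B - B') = 0 := by
    rw [sub_smul, smul_sub, smul_sub, sub_eq_zero]
    have h4 := congrArg₂ (· - ·) h2 h
    simp only [add_sub_add_left_eq_sub] at h4
    rw [sub_eq_sub_iff_sub_eq_sub]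
    exact h4
  have h5 : B = B' := sub_eq_zero.1 ((smul_eq_zero.1 h3).resolve_left (sub_ne_zero.2 hc))
  subst h5
  obtain rfl := add_right_cancel h
  rfl

/-- The map `g ↦ g gᴴ` takes Hermitian values, and left translation embeds each fibre in the unitary
group. -/
theorem natCard_GL_le_mul_natCard_unitary {F : Type*} [Field F] [StarRing F] [Finite F] {r : ℕ} :
    Nat.card (GL (Fin r) F) ≤ Nat.card {g : Matrix (Fin r) (Fin r) F // g * gᴴ = 1} *
      Nat.card {A : Matrix (Fin r) (Fin r) F // Aᴴ = A} := by
  classical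
  have := Fintype.ofFinite F
  have h0 : ∀ g : GL (Fin r) F, ((g : Matrix (Fin r) (Fin r) F) *
      (g : Matrix (Fin r) (Fin r) F)ᴴ)ᴴ = g * (g : Matrix (Fin r) (Fin r) F)ᴴ := by
    intro g
    rw [Matrix.conjTranspose_mul, Matrix.conjTranspose_conjTranspose]
  let f : GL (Fin r) F → {A : Matrix (Fin r) (Fin r) F // Aᴴ = A} := fun g => ⟨_, h0 g⟩
  simp only [Nat.card_eq_fintype_card]
  refine Finset.card_le_mul_card_image_of_maps_to (f := f) (fun _ _ => Finset.mem_univ _) _ ?_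
  intro A _
  rcases Finset.eq_empty_or_nonempty (Finset.univ.filter fun g => f g = A) with h | ⟨g₀, hg₀⟩
  · rw [h]; exact Nat.zero_le _
  have hA : ∀ g ∈ Finset.univ.filter fun g => f g = A,
      (g : Matrix (Fin r) (Fin r) F) * (g : Matrix (Fin r) (Fin r) F)ᴴ = A.1 := fun g hg =>
    congrArg Subtype.val (Finset.mem_filter.1 hg).2
  rw [← Fintype.card_coe]
  have h1 : ∀ g : Finset.univ.filter fun g => f g = A,
      ((↑(g₀⁻¹ * g.1) : Matrix (Fin r) (Fin r) F)) *
        (↑(g₀⁻¹ * g.1) : Matrix (Fin r) (Fin r) F)ᴴ = 1 := by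
    intro g
    have h3 : (g₀ : Matrix (Fin r) (Fin r) F)ᴴ * (↑g₀⁻¹ : Matrix (Fin r) (Fin r) F)ᴴ = 1 := by
      rw [← Matrix.conjTranspose_mul, Units.inv_mul, Matrix.conjTranspose_one]
    rw [Units.val_mul, Matrix.conjTranspose_mul, mul_assoc, ← mul_assoc g.1.val,
      hA g.1 g.2, ← hA g₀ hg₀, mul_assoc, h3, mul_one, Units.inv_mul]
  refine Fintype.card_le_of_injective (fun g => ⟨_, h1 g⟩) fun g g' h => ?_
  exact Subtype.ext (mul_left_cancel (Units.ext (congrArg Subtype.val h)))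

/-- The inequality `∏ (1 - t_i) ≥ 1 - ∑ t_i` for `t_i = Q^i / X`, cleared of denominators. -/
theorem mul_prod_sub_pow_ge (X Q : ℤ) (k : ℕ) (hX : 0 ≤ X) (hQ : 0 ≤ Q)
    (hk : ∀ i < k, Q ^ i ≤ X) :
    X ^ k * (X - ∑ i ∈ Finset.range k, Q ^ i) ≤ X * ∏ i ∈ Finset.range k, (X - Q ^ i) := by
  induction k with
  | zero => simp
  | succ k ih =>
    have h1 := ih fun i hi => hk i (by omega)
    have h2 := mul_le_mul_of_nonneg_right h1 (sub_nonneg.2 (hk k (by omega)))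
    rw [Finset.sum_range_succ, Finset.prod_range_succ]
    have h3 : 0 ≤ X ^ k * ((∑ i ∈ Finset.range k, Q ^ i) * Q ^ k) :=
      mul_nonneg (pow_nonneg hX k) (mul_nonneg (Finset.sum_nonneg fun i _ => pow_nonneg hQ i)
        (pow_nonneg hQ k))
    rw [pow_succ]
    linarith

theorem two_mul_pow_le_prod_sub_pow {Q : ℕ} (hQ : 4 ≤ Q) (r : ℕ) :
    2 * Q ^ r ^ 2 ≤ 3 * ∏ i : Fin r, (Q ^ r - Q ^ (i : ℕ)) := by
  have hle : ∀ i < r, Q ^ i ≤ Q ^ r := fun i hi => Nat.pow_le_pow_right (by omega) hi.le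
  have h1 := mul_prod_sub_pow_ge ((Q : ℤ) ^ r) Q r (by positivity) (by positivity)
    (fun i hi => by exact_mod_cast hle i hi)
  have h2 := mul_geom_sum (Q : ℤ) r
  have h3 : (0 : ℤ) ≤ ∑ i ∈ Finset.range r, (Q : ℤ) ^ i := Finset.sum_nonneg fun i _ => by positivity
  have hX : (0 : ℤ) < (Q : ℤ) ^ r := by positivity
  have h4 : 3 * ∑ i ∈ Finset.range r, (Q : ℤ) ^ i ≤ (Q : ℤ) ^ r - 1 := by
    rw [← h2]
    refine mul_le_mul_of_nonneg_right ?_ h3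
    have : (4 : ℤ) ≤ Q := by exact_mod_cast hQ
    linarith
  have h5 : (2 : ℤ) * (Q : ℤ) ^ r ^ 2 ≤ 3 * ∏ i ∈ Finset.range r, ((Q : ℤ) ^ r - (Q : ℤ) ^ i) := by
    refine le_of_mul_le_mul_left ?_ hX
    have h6 : 0 ≤ ((Q : ℤ) ^ r) ^ r := by positivity
    rw [pow_two r, pow_mul]
    nlinarith
  rw [Finset.prod_range] at h5
  have h7 : ((∏ i : Fin r, (Q ^ r - Q ^ (i : ℕ)) : ℕ) : ℤ) =
      ∏ i : Fin r, ((Q : ℤ) ^ r - (Q : ℤ) ^ (i : ℕ)) := by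
    rw [Nat.cast_prod]
    refine Finset.prod_congr rfl fun i _ => ?_
    rw [Nat.cast_sub (hle i i.2)]
    push_cast; rfl
  rw [← h7] at h5
  exact_mod_cast h5

theorem two_mul_pow_le_natCard_unitary {F : Type*} [Field F] [StarRing F] [Finite F] {q r : ℕ}
    (hstar : ∀ x : F, star x = x ^ q) (hF : Nat.card F = q ^ 2) :
    2 * q ^ r ^ 2 ≤ 3 * Nat.card {g : Matrix (Fin r) (Fin r) F // g * gᴴ = 1} := by
  have := Fintype.ofFinite F
  have hq := one_lt_of_natCard_eq_sq hF
  obtain ⟨c, hc⟩ := exists_star_ne hstar hF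
  have h1 := natCard_conjTranspose_eq_self_sq_le (r := r) hc
  rw [hF, ← pow_mul, mul_comm, pow_mul] at h1
  have h2 : Nat.card {A : Matrix (Fin r) (Fin r) F // Aᴴ = A} ≤ q ^ r ^ 2 :=
    (Nat.pow_le_pow_iff_left two_ne_zero).1 h1
  have h3 := two_mul_pow_le_prod_sub_pow (Q := q ^ 2) (by nlinarith) r
  rw [← hF, Nat.card_eq_fintype_card, ← Matrix.card_GL_field, ← Nat.card_eq_fintype_card, hF,
    pow_right_comm, pow_two (q ^ r ^ 2)] at h3
  have h4 := (natCard_GL_le_mul_natCard_unitary (F := F) (r := r)).trans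
    (Nat.mul_le_mul_left _ h2)
  refine Nat.le_of_mul_le_mul_right ?_ (pow_pos (by omega : 0 < q) (r ^ 2))
  rw [mul_assoc, mul_assoc]
  exact h3.trans (Nat.mul_le_mul_left 3 h4)

/-- From `a ≤ q^(r-1)` and `r - 1 ≤ q`, comparing exponents of `q` suffices for `r ≥ 5`. For `r = 3`
there is less room: `q = 2` is a direct check, and otherwise `q ≥ 5` because `3 ∣ q + 1`. -/
theorem GU_card_bound {q r m a : ℕ} (hr : 3 ≤ r) (hodd : Odd r) (hq1 : 1 < q) (hm : r * m = q + 1)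
    (ha : a * (r * m) = q ^ r + 1) :
    3 * (a * (r * m) * (r - 1) * ((r - 1) * a ^ 2 + a * (r * m) ^ (r - 1))) ≤
      2 * r * q ^ r ^ 2 := by
  have hmpos : 0 < m := Nat.pos_of_ne_zero (by rintro rfl; omega)
  have hrq : r - 1 ≤ q := by
    have := Nat.le_mul_of_pos_right r hmpos
    omega
  have haq : a ≤ q ^ (r - 1) := by
    have h1 : a * (q + 1) ≤ q ^ (r - 1) * (q + 1) := by
      rw [← hm, ha, hm, mul_add, ← pow_succ, Nat.sub_add_cancel (by omega), mul_one]
      exact Nat.add_le_add_left (Nat.one_le_pow _ _ (by omega)) _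
    exact Nat.le_of_mul_le_mul_right h1 (by omega)
  rw [ha]
  rw [hm] at ha ⊢
  rcases hr.lt_or_eq with h5 | rfl
  · have h5 : 5 ≤ r := by
      obtain ⟨k, hk⟩ := hodd
      omega
    have h1 : q ^ r + 1 ≤ 2 * q ^ r := by
      have := Nat.one_le_pow r q (by omega)
      omega
    have h2 : (r - 1) * a ^ 2 ≤ q ^ (3 * r - 3) := by
      calc (r - 1) * a ^ 2 ≤ q * (q ^ (r - 1)) ^ 2 := by gcongr
        _ = q ^ (1 + (r - 1) * 2) := by rw [pow_add, pow_one, pow_mul]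
        _ ≤ _ := Nat.pow_le_pow_right (by omega) (by omega)
    have h3 : a * (q + 1) ^ (r - 1) ≤ q ^ (3 * r - 3) := by
      calc a * (q + 1) ^ (r - 1) ≤ q ^ (r - 1) * (q ^ 2) ^ (r - 1) := by
            gcongr; nlinarith
        _ = q ^ ((r - 1) + 2 * (r - 1)) := by rw [pow_add, pow_mul]
        _ ≤ _ := Nat.pow_le_pow_right (by omega) (by omega)
    have h4 : 2 ^ 4 ≤ q ^ 4 := Nat.pow_le_pow_left hq1 4
    have h6 : r ^ 2 ≥ 4 + r + 1 + (3 * r - 3) := by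
      have : 5 * r ≤ r ^ 2 := by nlinarith
      omega
    calc 3 * ((q ^ r + 1) * (r - 1) * ((r - 1) * a ^ 2 + a * (q + 1) ^ (r - 1)))
        ≤ 3 * (2 * q ^ r * q * (q ^ (3 * r - 3) + q ^ (3 * r - 3))) := by gcongr
      _ = 12 * (q ^ r * q * q ^ (3 * r - 3)) := by ring
      _ ≤ q ^ 4 * (q ^ r * q * q ^ (3 * r - 3)) := Nat.mul_le_mul_right _ (by omega)
      _ = q ^ (4 + r + 1 + (3 * r - 3)) := by ring
      _ ≤ q ^ r ^ 2 := Nat.pow_le_pow_right (by omega) h6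
      _ ≤ 2 * r * q ^ r ^ 2 := Nat.le_mul_of_pos_left _ (by omega)
  · norm_num
    rcases Nat.lt_or_ge q 3 with h2 | h3
    · obtain rfl : q = 2 := by omega
      obtain rfl : a = 3 := by omega
      norm_num
    · have hq5 : 5 ≤ q := by omega
      norm_num at haq
      have h1 : 4 * (q ^ 3 + 1) ≤ 5 * q ^ 3 := by nlinarith [Nat.pow_le_pow_left hq5 3]
      have h2 : (q + 1) ^ 2 ≤ 2 * q ^ 2 := by nlinarith
      calc 3 * ((q ^ 3 + 1) * 2 * (2 * a ^ 2 + a * (q + 1) ^ 2))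
          ≤ 3 * ((q ^ 3 + 1) * 2 * (2 * (q ^ 2) ^ 2 + q ^ 2 * (2 * q ^ 2))) := by gcongr
        _ = 6 * q ^ 4 * (4 * (q ^ 3 + 1)) := by ring
        _ ≤ 6 * q ^ 4 * (5 * q ^ 3) := by gcongr
        _ = 6 * q ^ 7 * 5 := by ring
        _ ≤ 6 * q ^ 7 * q ^ 2 := by gcongr; nlinarith
        _ = 6 * q ^ 9 := by ring

/-! ### The unitary group as a scalar model -/

/-- Groups of all unitary matrices over the field with `q ^ 2` elements are scalar models. -/
theorem isScalarModel_unitary {F Γ : Type} [Field F] [Finite F] [StarRing F] [Group Γ]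
    {p k r m a : ℕ} [Fact p.Prime] [CharP F p] (hstar : ∀ x : F, star x = x ^ p ^ k)
    (hF : Nat.card F = (p ^ k) ^ 2) {M : Γ →* Matrix (Fin r) (Fin r) F}
    (hinj : Function.Injective M) (hM : ∀ A, (∃ g, M g = A) ↔ A * Aᴴ = 1) (hr : r.Prime)
    (hodd : Odd r) (hm : r * m = p ^ k + 1) (ha : a * (r * m) = (p ^ k) ^ r + 1) (hra : r ∣ a) :
    IsScalarModel M m a := by
  set q := p ^ k with hq
  have hq1 := one_lt_of_natCard_eq_sq hF
  have hm0 : 0 < m := Nat.pos_of_ne_zero (by rintro rfl; omega)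
  have h3 : 3 ≤ r := by
    obtain ⟨k, hk⟩ := hodd
    have := hr.one_lt
    omega
  have hgcd : Nat.gcd (Nat.card F - 1) (r * (r * m)) = r * m := by
    rw [natCard_sub_one_eq hF, hm, mul_comm r, Nat.gcd_mul_left]
    -- The odd prime `r` divides `q + 1`; dividing `q - 1` too, it would divide `2`.
    have h1 : Nat.Coprime (q - 1) r := by
      rw [Nat.coprime_comm, hr.coprime_iff_not_dvd]
      intro h
      have h2 : r ∣ q + 1 - (q - 1) := Nat.dvd_sub (Dvd.intro m hm) h
      have h4 := Nat.le_of_dvd (by omega) h2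
      omega
    rw [h1.gcd_eq_one, mul_one]
  have : NeZero r := ⟨hr.ne_zero⟩
  have hU : ∀ g, M g * (M g)ᴴ = 1 := fun g => (hM _).1 ⟨g, rfl⟩
  have hinv : ∀ g, M g⁻¹ = (M g)ᴴ := by
    intro g
    have h1 : M g⁻¹ * M g = 1 := by rw [← map_mul, inv_mul_cancel, map_one]
    calc M g⁻¹ = M g⁻¹ * (M g * (M g)ᴴ) := by rw [hU, mul_one]
      _ = (M g)ᴴ := by rw [← mul_assoc, h1, one_mul]
  have hdiag : ∀ d : Fin r → F, Matrix.diagonal d * (Matrix.diagonal d)ᴴ = 1 ↔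
      ∀ i, d i ^ (r * m) = 1 := by
    intro d
    rw [Matrix.diagonal_conjTranspose, Matrix.diagonal_mul_diagonal, ← Matrix.diagonal_one,
      Matrix.diagonal_injective.eq_iff, funext_iff]
    refine forall_congr' fun i => ?_
    rw [Pi.star_apply, mul_star_eq_pow hstar, hm]
  have hne : ∀ x : F, x ^ (r * m) = 1 → x ^ m ≠ 1 → ∀ b : F, b ^ r ≠ x := fun x hx hx' =>
    pow_ne_of_gcd_eq hr.pos hm0 hgcd hx hx'
  have hroot : ∀ x : F, x ^ (r * m) = 1 →
      AdjoinRoot.root (Polynomial.X ^ r - Polynomial.C x) ^ (q ^ r + 1) = 1 := fun x hx => by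
    rw [← ha]; exact AdjoinRoot.root_X_pow_sub_C_pow hx hra
  refine
    { prime := hr
      odd := hodd
      injective := hinj
      gcd_eq := hgcd
      diag_mem := fun d hd => (hM _).2 ((hdiag d).2 hd)
      diag_pow := fun g d hg => (hdiag d).1 (hg ▸ hU g)
      perm_mem := ?_
      diagonalizable := ?_
      conj := ?_
      card_commutant := ?_
      exists_not_diag := ?_
      card_ge := ?_ }
  · intro e
    rw [hM, Matrix.conjTranspose_permMatrix, ← Matrix.permMatrix_mul, inv_mul_cancel,
      Matrix.permMatrix_one]
  · intro s hs
    obtain ⟨ζ, hζ⟩ := exists_isPrimitiveRoot_of_dvd (K := F) (d := r)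
      (natCard_sub_one_eq hF ▸ (Dvd.intro m hm).mul_right _)
    have hζs : ζ * star ζ = 1 := by
      rw [mul_star_eq_pow hstar, ← hm, pow_mul, hζ.pow_eq_one, one_pow]
    obtain ⟨P, d, hP, hd⟩ := Matrix.exists_unitary_conj_eq_diagonal hstar hF hζ hζs
      (mul_eq_one_comm.1 (hU s)) hs
    obtain ⟨g, rfl⟩ := (hM P).2 hP
    exact ⟨g, d, by rw [map_mul, map_mul, hinv, hd]⟩
  · intro s t x hx hx' hs ht
    obtain ⟨u, hu, hus⟩ := exists_unitary_conj_of_pow_eq hstar hF hr hodd (hne x hx hx') hs ht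
      (hU s) (hU t) (hroot x hx)
    obtain ⟨g, rfl⟩ := (hM u).2 (mul_eq_one_comm.1 hu)
    refine ⟨g, ?_⟩
    rw [mul_inv_eq_iff_eq_mul]
    exact hinj (by rw [map_mul, map_mul, hus])
  · intro s x hx hx' hs
    rw [ha, ← natCard_unitary_commutant hstar hF hr hodd (hne x hx hx') hs (hU s) (hroot x hx)]
    refine Nat.card_congr (Equiv.ofBijective (fun g => ⟨M g.1, hU _, g.2⟩) ⟨?_, ?_⟩)
    · intro g g' h
      exact Subtype.ext (hinj (congrArg Subtype.val h))
    · rintro ⟨A, hA1, hA2⟩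
      obtain ⟨g, rfl⟩ := (hM A).2 hA1
      exact ⟨⟨g, hA2⟩, rfl⟩
  · intro s d hs hns
    obtain ⟨i, j, hij⟩ : ∃ i j, d i ≠ d j := by
      by_contra! h
      refine hns (d 0) ?_
      rw [hs, Matrix.smul_one_eq_diagonal]
      exact congrArg _ (funext fun i => h i 0)
    obtain ⟨R, hR, hRd⟩ := exists_unitary_conj_ne_diagonal hstar hF h3 hij
    obtain ⟨g, rfl⟩ := (hM R).2 hR
    refine ⟨g, fun d' h => hRd d' ?_⟩
    rw [← hs, ← h, ← map_mul, ← map_mul, inv_mul_cancel_right]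
  · have h1 : Nat.card Γ = Nat.card {g : Matrix (Fin r) (Fin r) F // g * gᴴ = 1} := by
      refine Nat.card_congr (Equiv.ofBijective (fun g => ⟨M g, hU g⟩) ⟨?_, ?_⟩)
      · intro g g' h
        exact hinj (congrArg Subtype.val h)
      · rintro ⟨A, hA⟩
        obtain ⟨g, rfl⟩ := (hM A).2 hA
        exact ⟨g, rfl⟩
    have h2 := two_mul_pow_le_natCard_unitary (r := r) hstar hF
    rw [← h1] at h2
    have h4 := GU_card_bound h3 hodd hq1 hm ha
    refine Nat.le_of_mul_le_mul_left (h4.trans ?_) (by norm_num : 0 < 3)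
    calc 2 * r * q ^ r ^ 2 = r * (2 * q ^ r ^ 2) := by ring
      _ ≤ r * (3 * Nat.card Γ) := Nat.mul_le_mul_left _ h2
      _ = 3 * (r * Nat.card Γ) := by ring

/-- The star structure `x ↦ x ^ q` on the field with `q ^ 2` elements. -/
abbrev frobeniusStarRing {F : Type*} [Field F] [Finite F] (p k : ℕ) [Fact p.Prime] [CharP F p]
    (hF : Nat.card F = (p ^ k) ^ 2) : StarRing F where
  star x := x ^ p ^ k
  star_involutive x := by
    have := Fintype.ofFinite F
    change (x ^ p ^ k) ^ p ^ k = x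
    rw [← pow_mul, ← pow_two, ← hF, Nat.card_eq_fintype_card, FiniteField.pow_card]
  star_mul x y := by rw [mul_pow, mul_comm]
  star_add x y := add_pow_char_pow _ _ _ _

theorem isScalarModel_GU {p k r m a : ℕ} [Fact p.Prime] (hk : k ≠ 0) (hr : r.Prime)
    (hodd : Odd r) (hm : r * m = p ^ k + 1) (ha : a * (r * m) = (p ^ k) ^ r + 1) (hra : r ∣ a) :
    IsScalarModel ((Units.coeHom _).comp (GU r p k).subtype) m a := by
  have hF : Nat.card (GaloisField p (2 * k)) = (p ^ k) ^ 2 := by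
    rw [GaloisField.card p _ (by omega), ← pow_mul, mul_comm]
  let _ := frobeniusStarRing p k hF
  refine isScalarModel_unitary (fun x => rfl) hF (fun g h hgh => Subtype.ext (Units.ext hgh))
    (fun A => ⟨?_, fun hA => ?_⟩) hr hodd hm ha hra
  · rintro ⟨g, rfl⟩
    exact g.2
  · exact ⟨⟨⟨A, Aᴴ, hA, mul_eq_one_comm.1 hA⟩, hA⟩, rfl⟩

/-! ### Assembly of the theorem -/

/-- Commuting with `diag(1, ζ, …, ζ^(r-1))` forces a diagonal matrix, and commuting with
transpositions forces equal entries. -/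
theorem IsScalarModel.mem_center_iff {F Γ : Type} [Field F] [Finite F] [Group Γ] {r m a : ℕ}
    {M : Γ →* Matrix (Fin r) (Fin r) F} (hM : IsScalarModel M m a) (g : Γ) :
    g ∈ Subgroup.center Γ ↔ ∃ x : F, M g = x • 1 := by
  have := hM.neZero
  rw [Subgroup.mem_center_iff]
  constructor
  · intro h
    obtain ⟨ζ, hζ⟩ := hM.exists_primitive
    obtain ⟨s, hs⟩ := hM.diag_mem (fun i : Fin r => ζ ^ (i : ℕ)) fun i => by
      rw [← pow_mul, mul_comm, mul_assoc, pow_mul, hζ.pow_eq_one, one_pow]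
    have h1 := congrArg M (h s)
    rw [map_mul, map_mul, hs] at h1
    have hd := eq_diagonal_of_commute (d := fun i : Fin r => ζ ^ (i : ℕ))
      (fun i j hij => Fin.ext (hζ.pow_inj i.2 j.2 hij)) h1.symm
    refine ⟨M g 0 0, ?_⟩
    rw [hd, Matrix.smul_one_eq_diagonal]
    congr 1
    funext i
    obtain ⟨p, hp⟩ := hM.perm_mem (Equiv.swap 0 i)
    have h2 := congrArg M (h p)
    rw [map_mul, map_mul, hp, hd, permMatrix_mul_diagonal] at h2
    have h3 := congrFun (congrFun h2 0) i
    rw [Matrix.diagonal_mul, Matrix.diagonal_mul, Equiv.Perm.permMatrix, PEquiv.toMatrix_apply]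
      at h3
    simpa using h3
  · rintro ⟨x, hx⟩ h
    apply hM.injective
    rw [map_mul, map_mul, hx, mul_smul_comm, mul_one, smul_mul_assoc, one_mul]

theorem IsScalarModel.subdegrees_of_isCoatom {F Γ G : Type} [Field F] [Group Γ] [Group G]
    [Finite F] [Finite Γ] [Finite G] {r m a : ℕ} {M : Γ →* Matrix (Fin r) (Fin r) F}
    (hM : IsScalarModel M m a) {π : Γ →* G} (hπ : Function.Surjective π)
    (hker : ∀ g, π g = 1 ↔ ∃ x : F, M g = x • 1) (hra : r ∣ a) (ha : Odd a) {H : Subgroup G}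
    (hmax : IsCoatom H) (hH : IsCyclicByCyclic H a r) :
    subdegrees H = {1, Nat.card H, a, a / r} ∧
    subdegreeMult H 1 = 1 ∧
    (subdegreeMult H (Nat.card H) : ℚ) = (saxlVal H : ℚ) / (Nat.card H : ℚ) ∧
    (subdegreeMult H a : ℚ) =
      1 / (r : ℚ) ^ 3 *
        ((r : ℚ) * ((r : ℚ) - 1) * ((r * m : ℕ) : ℚ) ^ (r - 1)
          - (r : ℚ) ^ 4 + (r : ℚ) ^ 3 - (r : ℚ) ^ 2
          + ((r : ℚ) - 1) ^ 2 * (Nat.card H : ℚ)) ∧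
    subdegreeMult H (a / r) = r - 1 ∧
    (saxlVal H : ℚ) =
      (H.index : ℚ)
        - (Nat.card H : ℚ) / (r : ℚ) ^ 3 * ((r : ℚ) - 1) *
          (((r : ℚ) - 1) * ((Nat.card H : ℚ) / (r : ℚ) - (r : ℚ))
            + ((r * m : ℕ) : ℚ) ^ (r - 1))
        + (Nat.card H : ℚ) / (r : ℚ) ^ 2 - 1 := by
  have hr := hM.prime
  obtain ⟨b, hab⟩ := hra
  have hb : 0 < b := Nat.pos_of_ne_zero (by rintro rfl; rw [hab, mul_zero] at ha; simp at ha)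
  have hb1 := hM.one_lt_of_isCoatom hπ hker hb hab hmax hH
  have hcard := hH.natCard
  obtain ⟨s, x, hx, hx', hs, hHs⟩ := hM.exists_eq_centralizer hπ hker hb hab ha hmax hH
  obtain ⟨N, hN, h1, h2, h3, h4, h5, h6⟩ := hM.subdegrees_centralizer hπ hx hx' hs hker hab hb1
  rw [← hHs] at h1 h2 h3 h4 h5 h6
  have hdiv : a / r = b := by rw [hab, Nat.mul_div_cancel_left _ hr.pos]
  have hrq : (r : ℚ) ≠ 0 := by exact_mod_cast hr.ne_zero
  have hbq : (b : ℚ) ≠ 0 := by exact_mod_cast hb.ne'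
  have hN' : (r : ℚ) * (r * b + r * ((r - 1) * b) + N) =
      (r - 1) * b * ((r * m : ℕ) : ℚ) ^ (r - 1) + (r - 1) * b * (r + (r - 1) * (r * b)) := by
    have := congrArg (Nat.cast (R := ℚ)) hN
    push_cast [Nat.cast_sub hr.one_le] at this ⊢
    exact this
  rw [hdiv, hcard, hab]
  rw [hcard, hab] at h1
  generalize ((r * m : ℕ) : ℚ) ^ (r - 1) = X at hN' ⊢
  refine ⟨h1, h2, ?_, ?_, h3, ?_⟩
  · rw [← h5]
    push_cast
    field_simp
  · have h4' : (subdegreeMult H (r * b) : ℚ) * (r * b) = N := by exact_mod_cast h4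
    rw [← h4'] at hN'
    have h7 : (r : ℚ) ^ 2 * subdegreeMult H (r * b) =
        (r - 1) * X + (r - 1) * (r + (r - 1) * (r * b)) - r ^ 3 :=
      mul_right_cancel₀ hbq (by linear_combination hN')
    rw [one_div, eq_inv_mul_iff_mul_eq₀ (pow_ne_zero 3 hrq)]
    push_cast
    linear_combination r * h7
  · have h6' : (saxlVal H : ℚ) + (1 + (r - 1) * b + N) = H.index := by
      have := congrArg (Nat.cast (R := ℚ)) h6
      push_cast [Nat.cast_sub hr.one_le] at this
      exact this
    rw [← h6']
    push_cast
    field_simp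
    linear_combination -hN'

/-- With `y = ε q`, both signs give `a = 1 + y + ⋯ + y^(r-1)`, so `a ≡ r` modulo every divisor of `y
- 1`, in particular modulo `r`, and modulo `2` if `y` is odd. If `y` is even, `a (y - 1) = y^r - 1`
is odd. -/
theorem dvd_and_odd_of_mul_sub_eq {ε : LieSign} {q r a : ℕ} (hq : 1 < q) (hodd : Odd r)
    (hdvd : (r : ℤ) ∣ (q : ℤ) - ε.toInt)
    (ha : (a : ℤ) * ((q : ℤ) - ε.toInt) = (q : ℤ) ^ r - ε.toInt) : r ∣ a ∧ Odd a := by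
  obtain ⟨y, hy0, hy1, hy⟩ : ∃ y : ℤ, y ≠ 1 ∧ (r : ℤ) ∣ y - 1 ∧
      (a : ℤ) * (y - 1) = y ^ r - 1 := by
    cases ε with
    | plus => exact ⟨q, by omega, hdvd, ha⟩
    | minus =>
      simp only [LieSign.toInt, sub_neg_eq_add] at hdvd ha
      refine ⟨-q, by omega, ?_, ?_⟩
      · rw [← dvd_neg, neg_sub, sub_neg_eq_add, add_comm]; exact hdvd
      · rw [hodd.neg_pow]; linear_combination -ha
  have hsum : (a : ℤ) = ∑ i ∈ Finset.range r, y ^ i := by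
    refine mul_right_cancel₀ (sub_ne_zero.2 hy0) ?_
    rw [hy, geom_sum_mul]
  have hmod : ∀ n : ℤ, n ∣ y - 1 → (a : ℤ) ≡ r [ZMOD n] := by
    intro n hn
    have h1 : y ≡ 1 [ZMOD n] := Int.modEq_iff_dvd.2 (by rwa [← dvd_neg, neg_sub])
    rw [hsum]
    have h2 : ∑ i ∈ Finset.range r, y ^ i ≡ ∑ i ∈ Finset.range r, 1 [ZMOD n] := by
      refine Int.ModEq.sum fun i _ => ?_
      simpa using h1.pow i
    simpa using h2
  refine ⟨?_, ?_⟩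
  · have h1 := (hmod r hy1).trans (Int.modEq_zero_iff_dvd.2 dvd_rfl)
    exact_mod_cast Int.modEq_zero_iff_dvd.1 h1
  · rw [← Int.odd_coe_nat]
    rcases Int.even_or_odd y with h | h
    · have h1 : Odd (y ^ r - 1) := (h.pow_of_ne_zero hodd.pos.ne').sub_odd odd_one
      rw [← hy] at h1
      exact (Int.odd_mul.1 h1).1
    · have h1 := hmod 2 (even_iff_two_dvd.1 (h.sub_odd odd_one))
      have h2 : Odd (r : ℤ) := by exact_mod_cast hodd
      rw [Int.odd_iff] at h2 ⊢
      exact Eq.trans h1 h2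

theorem mainTheorem6 (ε : LieSign) (p k r q a : ℕ) [Fact p.Prime] (hk : k ≠ 0)
    (hq : q = p ^ k) (hr : r.Prime) (hr_odd : Odd r)
    (hdvd : (r : ℤ) ∣ (q : ℤ) - ε.toInt)
    (ha : (a : ℤ) * ((q : ℤ) - ε.toInt) = (q : ℤ) ^ r - ε.toInt)
    (H : Subgroup (PGLsign ε r p k)) (hmax : IsCoatom H) (hH : IsCyclicByCyclic H a r) :
    r ∣ a ∧
    subdegrees H = {1, Nat.card H, a, a / r} ∧
    subdegreeMult H 1 = 1 ∧
    (subdegreeMult H (Nat.card H) : ℚ) = (saxlVal H : ℚ) / (Nat.card H : ℚ) ∧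
    (subdegreeMult H a : ℚ) =
      1 / (r : ℚ) ^ 3 *
        ((r : ℚ) * ((r : ℚ) - 1) * ((q : ℚ) - (ε.toInt : ℚ)) ^ (r - 1)
          - (r : ℚ) ^ 4 + (r : ℚ) ^ 3 - (r : ℚ) ^ 2
          + ((r : ℚ) - 1) ^ 2 * (Nat.card H : ℚ)) ∧
    subdegreeMult H (a / r) = r - 1 ∧
    (saxlVal H : ℚ) =
      (H.index : ℚ)
        - (Nat.card H : ℚ) / (r : ℚ) ^ 3 * ((r : ℚ) - 1) *
          (((r : ℚ) - 1) * ((Nat.card H : ℚ) / (r : ℚ) - (r : ℚ))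
            + ((q : ℚ) - (ε.toInt : ℚ)) ^ (r - 1))
        + (Nat.card H : ℚ) / (r : ℚ) ^ 2 - 1 := by
  
  have hq1 : 1 < q := hq ▸ Nat.one_lt_pow hk (Fact.out : p.Prime).one_lt
  obtain ⟨hra, haodd⟩ := dvd_and_odd_of_mul_sub_eq hq1 hr_odd hdvd ha
  refine ⟨hra, ?_⟩
  -- The natural number `r m = q - ε` is the order of the group of scalars; the sign enters the
  -- remaining formulas only through it.
  obtain ⟨m, hm⟩ : ∃ m : ℕ, ((r * m : ℕ) : ℤ) = (q : ℤ) - ε.toInt := by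
    obtain ⟨m, hm⟩ := hdvd
    have h0 : 0 ≤ m := by
      by_contra! h
      have h1 : (r : ℤ) * m < 0 := mul_neg_of_pos_of_neg (by exact_mod_cast hr.pos) h
      cases ε <;> simp only [LieSign.toInt] at hm <;> omega
    obtain ⟨m, rfl⟩ := Int.eq_ofNat_of_zero_le h0
    exact ⟨m, by push_cast; exact hm.symm⟩
  have hmq : ((r * m : ℕ) : ℚ) = (q : ℚ) - (ε.toInt : ℚ) := by
    exact_mod_cast congrArg (Int.cast (R := ℚ)) hm
  rw [← hm] at ha
  rw [← hmq]
  cases ε with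
  | plus =>
    have hF : Nat.card (GaloisField p k) = q := by rw [hq, GaloisField.card p k hk]
    simp only [LieSign.toInt] at hm ha
    have hM := isScalarModel_GL (F := GaloisField p k) (m := m) (a := a) hr hr_odd
      (by rw [hF]; omega) (by
        rw [hF]
        have : ((a * (r * m) : ℕ) : ℤ) = ((q ^ r : ℕ) : ℤ) - 1 := by push_cast at ha ⊢; exact ha
        omega)
    exact hM.subdegrees_of_isCoatom (π := QuotientGroup.mk' (Subgroup.center _))
      (QuotientGroup.mk'_surjective _)
      (fun g => (QuotientGroup.eq_one_iff g).trans (hM.mem_center_iff g)) hra haodd hmax hH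
  | minus =>
    simp only [LieSign.toInt] at hm ha
    have hM := isScalarModel_GU (m := m) (a := a) hk hr hr_odd (by rw [← hq]; omega) (by
        rw [← hq]
        have : ((a * (r * m) : ℕ) : ℤ) = ((q ^ r : ℕ) : ℤ) + 1 := by
          push_cast at ha ⊢; rw [ha, sub_neg_eq_add]
        omega) hra
    exact hM.subdegrees_of_isCoatom (π := QuotientGroup.mk' (Subgroup.center _))
      (QuotientGroup.mk'_surjective _)
      (fun g => (QuotientGroup.eq_one_iff g).trans (hM.mem_center_iff g)) hra haodd hmax hH
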